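/- \textbf{Setting.} For each sample size $n$ let a linear model in dimension $p\le\infty$ be given (everything may depend on $n$, except $\sigma_x$): a second moment matrix $\Sigma=\sum_{i\ge1}\lambda_i v_iv_i^T$ with orthonormal eigenbasis $(v_i)$, $\lambda_1\ge\lambda_2\ge\dots>0$ and $\sum_i\lambda_i<\infty$; i.i.d. inputs $x_1,\dots,x_n$ distributed as $x=\sum_i\sqrt{\lambda_i}\,\eta_i v_i$, where the $\eta_i$ are independent $\sigma_x$-subgaussian random variables ($\mathbb E e^{t\eta_i}\le e^{\sigma_x^2t^2/2}$ for all $t$) with mean zero and unit variance; labels $y_i=x_i^T\theta+\varepsilon_i$, where the pairs $(x_i,\varepsilon_i)$ are i.i.d., $\mathbb E[\varepsilon_i\mid x_i]=0$ and $\mathbb E[\varepsilon_i^2\mid x_i]=\sigma^2>0$; and a parameter $\theta$ with $0<\|\theta\|_2<\infty$ whose coordinates $\tilde\theta_i=v_i^T\theta$ are given independent uniformly random signs, independently of the pairs $(x_i,\varepsilon_i)$. Put $X=[x_1,\dots,x_n]^T$ and, for $\lambda\ge0$, $\hat\theta_\lambda=X^T(XX^T+n\lambda I)^\dagger y$. Given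 $X$, let $$\mathcal R(\hat\theta_\lambda)=\mathbb E_\theta\,\mathbb E_y\,\mathbb E_{x_\star}\big[(x_\star^T\hat\theta_\lambda-x_\star^T\theta)^2\big],$$ where $x_\star$ is an independent copy of $x_1$, and let $\mathbb E_{\theta,y}\|\hat\theta_\lambda\|^2$ be the expectation over the signs of $\theta$ and the labels. Let $$r_k=\frac{\sum_{i>k}\lambda_i}{\lambda_{k+1}},\qquad R_k=\frac{(\sum_{i>k}\lambda_i)^2}{\sum_{i>k}\lambda_i^2},\qquad k^*=k^*(b)=\min\{k\ge0:\ r_k\ge bn\},$$ $$\|\theta_{k:\infty}\|^2_{\Sigma_{k:\infty}}=\sum_{i>k}\lambda_i\tilde\theta_i^2,\qquad \|\theta_{0:k}\|^2_{\Sigma_{0:k}^{-1}}=\sum_{i\le k}\tilde\theta_i^2/\lambda_i .$$ The sequence of models satisfies the \emph{benign overfitting condition} with constant $b>0$ if $k^*(b)$ is finite for all large $n$ and, as $n\to\infty$, the four quantities $\|\theta_{k^*:\infty}\|^2_{\Sigma_{k^*:\infty}}$, $\big(\lambda_{k^*+1}r_{k^*}/n\big)^2\|\theta_{0:k^*}\|^2_{\Sigma_{0:k^*}^{-1}}$,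 $k^*/n$ and $n/R_{k^*}$ all tend to $0$. \textbf{Statement.} For all $b>0$ and $\sigma_x>0$ there exist constants $C_3,C_4>0$ and $c>1$, depending only on $b$ and $\sigma_x$, such that the following holds. For every sequence of models as above that satisfies the benign overfitting condition with constant $b$, there is an $N$ such that for every $n\ge N$, every $\delta\in(0,1)$ with $\ln(1/\delta)<n/c$, and every $0\le\lambda\le\lambda_{k^*+1}r_{k^*}/n$, with probability at least $1-\delta$ over $X$, both $$\mathcal R(\hat\theta_\lambda)/C_3\le\|\theta_{k^*:\infty}\|^2_{\Sigma_{k^*:\infty}}+\Big(\frac{\lambda_{k^*+1}r_{k^*}}{n}\Big)^2\|\theta_{0:k^*}\|^2_{\Sigma_{0:k^*}^{-1}}+\sigma^2\Big(\frac{k^*}{n}+\frac{n}{R_{k^*}}\Big)$$ and $$\mathbb E_{\theta,y}\|\hat\theta_\lambda\|^2/C_4\ge\sum_{i\le k^*}\Big(\frac{\sigma^2}{\lambda_i}+n\tilde\theta_i^2\Big)\min\Big\{\frac1n,\frac{n\lambda_i^2}{r_{k^*}^2\lambda_{k^*+1}^2}\Big\}+\frac{n\sigma^2}{r_{k^*}\lambda_{k^*+1}}+\frac{n^2\sum_{j>k^*}\tilde\theta_j^2\lambda_j^2}{\lambda_{k^*+1}^2r_{k^*}^2}.$$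 -/

import Mathlib

open MeasureTheory ProbabilityTheory Filter Topology
open scoped NNReal ENNReal

noncomputable section

/-- The Moore–Penrose pseudoinverse of a real symmetric matrix `A = U diag(μ) Uᵀ`:
`U diag(μ⁻¹) Uᵀ`, where the inverse of a zero eigenvalue is zero. -/
def symPinv {n : ℕ} (A : Matrix (Fin n) (Fin n) ℝ) (hA : A.IsHermitian) :
    Matrix (Fin n) (Fin n) ℝ :=
  (hA.eigenvectorUnitary : Matrix (Fin n) (Fin n) ℝ) *
    Matrix.diagonal (fun i => (hA.eigenvalues i)⁻¹) *
    star (hA.eigenvectorUnitary : Matrix (Fin n) (Fin n) ℝ)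

/-- `symPinv` satisfies the four Penrose equations (which characterize the pseudoinverse). -/
theorem symPinv_penrose {n : ℕ} (A : Matrix (Fin n) (Fin n) ℝ) (hA : A.IsHermitian) :
    A * symPinv A hA * A = A ∧ symPinv A hA * A * symPinv A hA = symPinv A hA ∧
      (A * symPinv A hA).IsHermitian ∧ (symPinv A hA * A).IsHermitian := by
  have hU : star (hA.eigenvectorUnitary : Matrix (Fin n) (Fin n) ℝ) *
      (hA.eigenvectorUnitary : Matrix (Fin n) (Fin n) ℝ) = 1 := Unitary.coe_star_mul_self _
  have hS : A = (hA.eigenvectorUnitary : Matrix (Fin n) (Fin n) ℝ) *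
      Matrix.diagonal hA.eigenvalues *
      star (hA.eigenvectorUnitary : Matrix (Fin n) (Fin n) ℝ) := by
    have h := hA.spectral_theorem
    rw [Unitary.conjStarAlgAut_apply] at h
    exact h
  unfold symPinv
  generalize (hA.eigenvectorUnitary : Matrix (Fin n) (Fin n) ℝ) = U at hU hS
  generalize hA.eigenvalues = d at hS
  clear hA
  subst hS
  have key : ∀ D E : Matrix (Fin n) (Fin n) ℝ,
      (U * D * star U) * (U * E * star U) = U * (D * E) * star U := by
    intro D E
    calc (U * D * star U) * (U * E * star U) = U * D * (star U * U) * E * star U := by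
          simp only [Matrix.mul_assoc]
      _ = U * (D * E) * star U := by rw [hU]; simp only [Matrix.mul_assoc, Matrix.one_mul]
  have herm : ∀ f : Fin n → ℝ, (U * Matrix.diagonal f * star U).IsHermitian := by
    intro f
    simp [Matrix.IsHermitian, Matrix.star_eq_conjTranspose, Matrix.mul_assoc]
  refine ⟨?_, ?_, ?_, ?_⟩
  · simp only [key, Matrix.diagonal_mul_diagonal, mul_inv_mul_cancel]
  · have h : ∀ a : ℝ, a⁻¹ * a * a⁻¹ = a⁻¹ := fun a => by
      by_cases ha : a = 0 <;> simp [ha]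
    simp only [key, Matrix.diagonal_mul_diagonal, h]
  · simp only [key, Matrix.diagonal_mul_diagonal, herm]
  · simp only [key, Matrix.diagonal_mul_diagonal, herm]

/-- The positions `0, 1, …` of the coordinates of a vector in dimension `p ≤ ∞`. -/
abbrev CoordIdx (p : ℕ∞) : Type := {j : ℕ // (j : ℕ∞) < p}

/-- The linear model, in dimension `p ≤ ∞`, with `σx`-subgaussian feature components.
Positions are counted from `0`: the `i`-th largest eigenvalue of the second moment matrix
is `eig (i - 1)`, and `eig` is extended by `0` beyond the dimension. -/
structure LinearModel (H : Type*) [NormedAddCommGroup H] [InnerProductSpace ℝ H]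
    [MeasurableSpace H] (σx : ℝ≥0) where
  /-- the dimension -/
  p : ℕ∞
  /-- the eigenvalues of the second moment matrix -/
  eig : ℕ → ℝ
  eig_antitone : Antitone eig
  eig_pos : ∀ j : ℕ, (j : ℕ∞) < p → 0 < eig j
  eig_zero : ∀ j : ℕ, p ≤ (j : ℕ∞) → eig j = 0
  eig_summable : Summable eig
  /-- the eigenvectors of the second moment matrix -/
  v : HilbertBasis (CoordIdx p) ℝ H
  /-- the distribution of a feature vector `x = V Λ^{1/2} η` -/
  D : Measure H
  D_prob : IsProbabilityMeasure D
  /-- the components `η j = ⟪v j, x⟫ / √(eig j)` are independent, … -/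
  indep : iIndepFun (fun (j : CoordIdx p) (x : H) => inner ℝ (v j) x / √(eig j)) D
  /-- … centered, … -/
  mean_zero : ∀ j : CoordIdx p, ∫ x, inner ℝ (v j) x / √(eig j) ∂D = 0
  /-- … of unit variance, … -/
  unit_var : ∀ j : CoordIdx p, ∫ x, (inner ℝ (v j) x / √(eig j)) ^ 2 ∂D = 1
  /-- … and `σx`-subgaussian -/
  subgaussian : ∀ j : CoordIdx p,
    HasSubgaussianMGF (fun x : H => inner ℝ (v j) x / √(eig j)) (σx ^ 2) D
  /-- the conditional distribution of the label noise `y - ⟪x, θ⟫` given `x` -/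
  noise : Kernel H ℝ
  noise_markov : IsMarkovKernel noise
  /-- the noise variance `σ²` -/
  noiseVar : ℝ
  noiseVar_pos : 0 < noiseVar
  noise_memLp : ∀ᵐ x ∂D, MemLp (fun e : ℝ => e) 2 (noise x)
  noise_mean : ∀ᵐ x ∂D, ∫ e, e ∂(noise x) = 0
  noise_var : ∀ᵐ x ∂D, ∫ e, e ^ 2 ∂(noise x) = noiseVar
  /-- the true parameter, before its coordinates are given random signs -/
  θ : H
  θ_ne_zero : θ ≠ 0

/-- The law of independent fair coin flips, one for each coordinate. -/
def fairCoins (ι : Type*) : Measure (ι → Bool) :=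
  Measure.infinitePi (fun _ : ι => (PMF.uniformOfFintype Bool).toMeasure)

/-- The ridge regression estimator `Xᵀ (X Xᵀ + n λ I)† y`, where the rows of `X` are
`X 0, …, X (n - 1)` (so that `X Xᵀ` is their Gram matrix). -/
def ridge {H : Type*} [NormedAddCommGroup H] [InnerProductSpace ℝ H] {n : ℕ}
    (lam : ℝ) (X : Fin n → H) (y : Fin n → ℝ) : H :=
  ∑ i, ((symPinv (Matrix.gram ℝ X + ((n : ℝ) * lam) • (1 : Matrix (Fin n) (Fin n) ℝ))
    ((Matrix.isHermitian_gram (𝕜 := ℝ) X).add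
      (by simp [Matrix.IsHermitian]))).mulVec y) i • X i

/-- The ridge estimator for inputs `X`, true parameter `θ'` and label noise `e`. -/
def ridgeEstimator {H : Type*} [NormedAddCommGroup H] [InnerProductSpace ℝ H] {n : ℕ}
    (lam : ℝ) (X : Fin n → H) (θ' : H) (e : Fin n → ℝ) : H :=
  ridge lam X (fun i => inner ℝ (X i) θ' + e i)

namespace LinearModel

variable {H : Type*} [NormedAddCommGroup H] [InnerProductSpace ℝ H] [MeasurableSpace H]
  {σx : ℝ≥0} (M : LinearModel H σx)

/-- The coordinates of the true parameter in the eigenbasis, extended by `0`. -/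
def coord (j : ℕ) : ℝ :=
  open Classical in if h : (j : ℕ∞) < M.p then inner ℝ (M.v ⟨j, h⟩) M.θ else 0

/-- `∑_{i > k} λ_i` -/
def tailSum (k : ℕ) : ℝ := ∑' i : ℕ, M.eig (i + k)

/-- `∑_{i > k} λ_i²` -/
def tailSqSum (k : ℕ) : ℝ := ∑' i : ℕ, M.eig (i + k) ^ 2

/-- the effective rank `r_k` -/
def effRank (k : ℕ) : ℝ := M.tailSum k / M.eig k

/-- the effective rank `R_k` -/
def effRank₂ (k : ℕ) : ℝ := M.tailSum k ^ 2 / M.tailSqSum k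

/-- the critical index `k*(b)` for sample size `n`
(meaningful if some `k` has `r_k ≥ b n`, which is required in `BenignOverfitting`) -/
def critIndex (n : ℕ) (b : ℝ) : ℕ := sInf {k : ℕ | b * n ≤ M.effRank k}

/-- `‖θ_{k:∞}‖²` in the norm of `Σ_{k:∞}` -/
def tailNormSq (k : ℕ) : ℝ := ∑' i : ℕ, M.eig (i + k) * M.coord (i + k) ^ 2

/-- `‖θ_{0:k}‖²` in the norm of `Σ_{0:k}⁻¹` -/
def headNormSq (k : ℕ) : ℝ := ∑ i ∈ Finset.range k, M.coord i ^ 2 / M.eig i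

/-- The parameter whose coordinates in the eigenbasis have the signs `s`. -/
def signed (s : CoordIdx M.p → Bool) : H :=
  ∑' j : CoordIdx M.p, ((if s j then (1 : ℝ) else -1) * inner ℝ (M.v j) M.θ) • M.v j

/-- The standard risk of the ridge estimator given the inputs `X`: the excess mean squared error,
averaged over the signs of the true parameter, the training labels and a fresh input. -/
def stdRisk {n : ℕ} (lam : ℝ) (X : Fin n → H) : ℝ≥0∞ :=
  ∫⁻ s, ∫⁻ e, ∫⁻ x,
    ENNReal.ofReal ((inner ℝ x (ridgeEstimator lam X (M.signed s) e) - inner ℝ x (M.signed s)) ^ 2)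
    ∂M.D ∂(Measure.pi fun i => M.noise (X i)) ∂(fairCoins (CoordIdx M.p))

/-- The expected squared norm of the ridge estimator given the inputs `X`, averaged over the signs
of the true parameter and the training labels. -/
def normSqMean {n : ℕ} (lam : ℝ) (X : Fin n → H) : ℝ≥0∞ :=
  ∫⁻ s, ∫⁻ e, ENNReal.ofReal (‖ridgeEstimator lam X (M.signed s) e‖ ^ 2)
    ∂(Measure.pi fun i => M.noise (X i)) ∂(fairCoins (CoordIdx M.p))

end LinearModel

/-- The benign overfitting condition, with constant `b`, for a sequence of models, the `n`-th of
which is used with sample size `n`. -/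
structure BenignOverfitting {H : ℕ → Type*} [∀ n, NormedAddCommGroup (H n)]
    [∀ n, InnerProductSpace ℝ (H n)] [∀ n, MeasurableSpace (H n)] {σx : ℝ≥0}
    (M : ∀ n, LinearModel (H n) σx) (b : ℝ) : Prop where
  critIndex_finite : ∀ᶠ n : ℕ in atTop, ∃ k : ℕ, b * n ≤ (M n).effRank k
  tail : Tendsto (fun n => (M n).tailNormSq ((M n).critIndex n b)) atTop (𝓝 0)
  head : Tendsto (fun n : ℕ =>
      ((M n).eig ((M n).critIndex n b) * (M n).effRank ((M n).critIndex n b) / n) ^ 2 *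
        (M n).headNormSq ((M n).critIndex n b)) atTop (𝓝 0)
  index : Tendsto (fun n : ℕ => ((M n).critIndex n b : ℝ) / n) atTop (𝓝 0)
  rank : Tendsto (fun n : ℕ => (n : ℝ) / (M n).effRank₂ ((M n).critIndex n b)) atTop (𝓝 0)

end

/-! Put k = k*, S = ∑_{i>k} λ_i = λ_{k+1} r_k, call the first k coordinates the head and the others
the tail, and let z_j ∈ ℝⁿ be the column of whitened j-th components of the sample. Outside an event
of exponentially small probability, two things hold. The tail Gram matrix ∑_{i>k} λ_i z_i z_iᵀ lies
between two multiples of S·I: r_k ≥ bn keeps every tail eigenvalue below S/(bn), which gives the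
upper bound, and the smallness of n/R_k means that half of S comes from eigenvalues below a small
multiple of S/n, which gives the lower one. The head columns, few because k/n → 0, are nearly
orthogonal with squared length of order n. Both facts are net arguments over a sphere, fed by
exponential tail bounds for weighted sums of squares (`measure_hasSum_weighted_sq_ge_le`,
`measure_sum_weighted_sq_le_le`). As nλ ≤ S, the regularized tail Gram matrix A is still of order S,
uniformly in λ.

Risk. Write the estimator as Xᵀw, let Z have the head columns as its columns, δ be the whitened head
error, r the tail signal and e the noise. The normal equations become Zδ + Aw = r + e. Applying A⁻¹
and pairing with Zδ bounds δ (`norm_head_error_le`); then w = A⁻¹(r + e − Zδ) bounds the tail error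
(`LinearModel.cov_error_le`). Averaging over noise and signs removes cross terms and leaves weighted
sums of the ‖z_j‖², which concentrate (`IsStdSubgaussian.weighted_array_upper`).

Norm. Let Q = (XXᵀ + nλI)⁻¹ and t_j = λ_j⟨Qz_j, z_j⟩. The averaged squared norm is at least ∑_j
(θ_j² t_j² + σ² λ_j ‖Qz_j‖²). Cauchy–Schwarz against a vector dual to z_j and orthogonal to the
other head columns gives t_j ≳ min(1, nλ_j/S) (`LinearModel.TailBounds.shrinkage_ge`), and a second
Cauchy–Schwarz passes to ‖Qz_j‖. This needs the head enlarged by j to be well conditioned, which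
cannot be arranged for infinitely many j at once. By Markov's inequality, however, the bad j usually
carry at most half of the total weight in the target
(`measure_not_tsum_le_two_mul_tsum_indicator_compl_le`). -/

noncomputable section

/-! ### Squares of sub-Gaussian variables -/

section SubGaussianSquare

variable {Ω : Type*} [MeasurableSpace Ω] {μ : Measure Ω} {ξ : Ω → ℝ} {c : ℝ≥0}

theorem Real.pow_two_mul_div_factorial_le_cosh (x : ℝ) (m : ℕ) :
    x ^ (2 * m) / (2 * m).factorial ≤ Real.cosh x :=
  le_hasSum (Real.hasSum_cosh x) m fun j _ => by rw [pow_mul]; positivity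

/-- The normalised even moments of a sub-Gaussian variable grow at most geometrically. -/
theorem ProbabilityTheory.HasSubgaussianMGF.lintegral_sq_pow_div_factorial_le
    [IsProbabilityMeasure μ] (h : HasSubgaussianMGF ξ c μ) (hc : 0 < c) (m : ℕ) :
    ∫⁻ ω, ENNReal.ofReal ((ξ ω ^ 2) ^ m / m.factorial) ∂μ ≤ ENNReal.ofReal ((3 * (c : ℝ)) ^ m) := by
  rcases Nat.eq_zero_or_pos m with rfl | hm
  · simp
  have hc' : (0 : ℝ) < c := hc
  have hm' : (0 : ℝ) < m := by exact_mod_cast hm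
  -- This `t` minimizes `exp (c * t ^ 2 / 2) / t ^ (2 * m)`; the exponential then equals `exp m`.
  set t : ℝ := √(2 * m / c) with ht
  have ht2 : t ^ 2 = 2 * m / c := Real.sq_sqrt (by positivity)
  have ht0 : 0 < t := Real.sqrt_pos.2 (by positivity)
  have hint : Integrable (fun ω => Real.cosh (t * ξ ω)) μ := by
    have h1 := h.integrable_exp_mul t
    have h2 := h.integrable_exp_mul (-t)
    refine ((h1.add h2).div_const 2).congr (ae_of_all _ fun ω => ?_)
    simp [Real.cosh_eq]
  have hcosh : ∫ ω, Real.cosh (t * ξ ω) ∂μ ≤ Real.exp m := by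
    have h1 := h.integrable_exp_mul t
    have h2 := h.integrable_exp_mul (-t)
    have e1 := h.mgf_le t
    have e2 := h.mgf_le (-t)
    have : ∫ ω, Real.cosh (t * ξ ω) ∂μ = (mgf ξ μ t + mgf ξ μ (-t)) / 2 := by
      unfold mgf
      rw [← integral_add h1 h2, ← integral_div]
      simp [Real.cosh_eq]
    rw [this]
    have hx : (c : ℝ) * t ^ 2 / 2 = m := by rw [ht2]; field_simp
    have hx' : (c : ℝ) * (-t) ^ 2 / 2 = m := by rw [neg_sq, hx]
    rw [hx] at e1
    rw [hx'] at e2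
    linarith
  -- The power `(2 * m) ^ m` cancels against that in `t ^ (2 * m)`, so only `c ^ m * exp m` remains.
  have hfac : ((2 * m).factorial : ℝ) ≤ m.factorial * (2 * m) ^ m := by
    have h1 := Nat.factorial_mul_ascFactorial m m
    have h2 := Nat.ascFactorial_le_pow_add m m
    have h3 : (2 * m).factorial ≤ m.factorial * (2 * m) ^ m := by
      rw [two_mul, ← h1]; gcongr
    exact_mod_cast h3
  have hpt : ∀ ω, (ξ ω ^ 2) ^ m / m.factorial ≤ (c : ℝ) ^ m * Real.cosh (t * ξ ω) := by
    intro ω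
    have h1 := Real.pow_two_mul_div_factorial_le_cosh (t * ξ ω) m
    rw [pow_mul, mul_pow, ht2, mul_pow, div_pow] at h1
    have hpos : 0 ≤ (ξ ω ^ 2) ^ m := by positivity
    calc (ξ ω ^ 2) ^ m / m.factorial
        = (c : ℝ) ^ m * ((2 * m) ^ m / (c : ℝ) ^ m * (ξ ω ^ 2) ^ m / (m.factorial * (2 * m) ^ m)) := by
          field_simp
      _ ≤ (c : ℝ) ^ m * ((2 * m) ^ m / (c : ℝ) ^ m * (ξ ω ^ 2) ^ m / (2 * m).factorial) := by
          gcongr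
      _ ≤ _ := by gcongr
  calc ∫⁻ ω, ENNReal.ofReal ((ξ ω ^ 2) ^ m / m.factorial) ∂μ
      ≤ ∫⁻ ω, ENNReal.ofReal ((c : ℝ) ^ m * Real.cosh (t * ξ ω)) ∂μ :=
        lintegral_mono fun ω => ENNReal.ofReal_le_ofReal (hpt ω)
    _ = ENNReal.ofReal (∫ ω, (c : ℝ) ^ m * Real.cosh (t * ξ ω) ∂μ) :=
        (ofReal_integral_eq_lintegral_ofReal (hint.const_mul _)
          (ae_of_all _ fun ω => by have := Real.cosh_pos (t * ξ ω); positivity)).symm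
    _ ≤ ENNReal.ofReal ((3 * (c : ℝ)) ^ m) := by
        apply ENNReal.ofReal_le_ofReal
        rw [integral_const_mul, mul_pow, mul_comm]
        gcongr
        refine hcosh.trans ?_
        rw [← Real.exp_one_pow]
        gcongr
        linarith [Real.exp_one_lt_d9]

/-- Expanding the exponential, the moment bounds give a geometric series with sum `1 / (1 - 3 * c *
s)`, which is at most `1 + 6 * c * s` as long as `6 * c * s ≤ 1`. -/
theorem ProbabilityTheory.HasSubgaussianMGF.lintegral_exp_mul_sq_le [IsProbabilityMeasure μ]
    (h : HasSubgaussianMGF ξ c μ) (hc : 0 < c) {s : ℝ} (hs : 0 ≤ s) (hs' : 6 * c * s ≤ 1) :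
    ∫⁻ ω, ENNReal.ofReal (Real.exp (s * ξ ω ^ 2)) ∂μ ≤ ENNReal.ofReal (Real.exp (6 * c * s)) := by
  have hc' : (0 : ℝ) < c := hc
  have hmeas : AEMeasurable ξ μ := h.aemeasurable
  have hexp : ∀ ω, ENNReal.ofReal (Real.exp (s * ξ ω ^ 2)) =
      ∑' m : ℕ, ENNReal.ofReal (s ^ m * ((ξ ω ^ 2) ^ m / m.factorial)) := by
    intro ω
    have hsum := Real.summable_pow_div_factorial (s * ξ ω ^ 2)
    rw [Real.exp_eq_exp_ℝ, NormedSpace.exp_eq_tsum_div]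
    simp only
    rw [ENNReal.ofReal_tsum_of_nonneg (fun m => by positivity) hsum]
    exact tsum_congr fun m => by rw [mul_pow, mul_div_assoc]
  simp_rw [hexp]
  rw [lintegral_tsum (fun m => by fun_prop)]
  have hr : 3 * (c : ℝ) * s < 1 := by nlinarith
  have hr0 : 0 ≤ 3 * (c : ℝ) * s := by positivity
  calc ∑' m : ℕ, ∫⁻ ω, ENNReal.ofReal (s ^ m * ((ξ ω ^ 2) ^ m / m.factorial)) ∂μ
      ≤ ∑' m : ℕ, ENNReal.ofReal ((3 * c * s) ^ m) := by
        refine ENNReal.tsum_le_tsum fun m => ?_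
        simp_rw [ENNReal.ofReal_mul (pow_nonneg hs m)]
        rw [lintegral_const_mul' _ _ ENNReal.ofReal_ne_top]
        calc _ ≤ ENNReal.ofReal (s ^ m) * ENNReal.ofReal ((3 * (c : ℝ)) ^ m) := by
              gcongr; exact h.lintegral_sq_pow_div_factorial_le hc m
          _ = _ := by rw [← ENNReal.ofReal_mul (pow_nonneg hs m), mul_pow (3 * (c : ℝ)), mul_comm]
    _ = ENNReal.ofReal ((1 - 3 * c * s)⁻¹) := by
        rw [← ENNReal.ofReal_tsum_of_nonneg (fun m => by positivity)
          (summable_geometric_of_lt_one hr0 hr), tsum_geometric_of_lt_one hr0 hr]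
    _ ≤ _ := by
        apply ENNReal.ofReal_le_ofReal
        refine le_trans ?_ (Real.add_one_le_exp _)
        rw [inv_le_iff_one_le_mul₀ (by linarith)]
        nlinarith

/-- Invert `exp x ≥ 1 + x + x ^ 2 / 2`: the product of `1 + x + x ^ 2 / 2` and `1 - x + x ^ 2 / 2`
is `1 + x ^ 4 / 4`. -/
theorem Real.exp_neg_le_quadratic {x : ℝ} (hx : 0 ≤ x) : Real.exp (-x) ≤ 1 - x + x ^ 2 / 2 := by
  rw [Real.exp_neg]
  have h := Real.quadratic_le_exp_of_nonneg hx
  have h1 : 0 < 1 + x + x ^ 2 / 2 := by positivity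
  refine (inv_anti₀ h1 h).trans ?_
  rw [inv_le_iff_one_le_mul₀ h1]
  nlinarith [sq_nonneg (x ^ 2)]

/-- Squares are bounded below, so a second-order expansion serves for every `s ≥ 0`: the unit
variance gives the linear term, the moment bound with `m = 2` the quadratic one. -/
theorem ProbabilityTheory.HasSubgaussianMGF.lintegral_exp_neg_mul_sq_le [IsProbabilityMeasure μ]
    (h : HasSubgaussianMGF ξ c μ) (hc : 0 < c) (h2 : ∫ ω, ξ ω ^ 2 ∂μ = 1) {s : ℝ} (hs : 0 ≤ s) :
    ∫⁻ ω, ENNReal.ofReal (Real.exp (-(s * ξ ω ^ 2))) ∂μ ≤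
      ENNReal.ofReal (Real.exp (-s + 9 * c ^ 2 * s ^ 2)) := by
  have hi2 : Integrable (fun ω => ξ ω ^ 2) μ := (h.memLp 2).integrable_sq
  have hmeas : AEMeasurable ξ μ := h.aemeasurable
  have h4 := h.lintegral_sq_pow_div_factorial_le hc 2
  have hi4 : Integrable (fun ω => (ξ ω ^ 2) ^ 2 / (Nat.factorial 2 : ℝ)) μ := by
    refine ⟨by fun_prop, ?_⟩
    rw [hasFiniteIntegral_iff_ofReal (ae_of_all _ fun ω => by positivity)]
    exact h4.trans_lt ENNReal.ofReal_lt_top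
  have h4' : ∫ ω, (ξ ω ^ 2) ^ 2 / (Nat.factorial 2 : ℝ) ∂μ ≤ (3 * (c : ℝ)) ^ 2 := by
    rw [← ofReal_integral_eq_lintegral_ofReal hi4 (ae_of_all _ fun ω => by positivity)] at h4
    exact (ENNReal.ofReal_le_ofReal_iff (by positivity)).1 h4
  have hb : Integrable (fun ω => 1 - s * ξ ω ^ 2 + s ^ 2 * ((ξ ω ^ 2) ^ 2 / (Nat.factorial 2 : ℝ))) μ :=
    ((integrable_const _).sub (hi2.const_mul _)).add (hi4.const_mul _)
  have hpt : ∀ ω, Real.exp (-(s * ξ ω ^ 2)) ≤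
      1 - s * ξ ω ^ 2 + s ^ 2 * ((ξ ω ^ 2) ^ 2 / (Nat.factorial 2 : ℝ)) := fun ω => by
    refine (Real.exp_neg_le_quadratic (by positivity)).trans (le_of_eq ?_)
    simp only [Nat.factorial_two, Nat.cast_ofNat]; ring
  calc ∫⁻ ω, ENNReal.ofReal (Real.exp (-(s * ξ ω ^ 2))) ∂μ
      ≤ ∫⁻ ω, ENNReal.ofReal
          (1 - s * ξ ω ^ 2 + s ^ 2 * ((ξ ω ^ 2) ^ 2 / (Nat.factorial 2 : ℝ))) ∂μ :=
        lintegral_mono fun ω => ENNReal.ofReal_le_ofReal (hpt ω)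
    _ = ENNReal.ofReal (∫ ω,
          1 - s * ξ ω ^ 2 + s ^ 2 * ((ξ ω ^ 2) ^ 2 / (Nat.factorial 2 : ℝ)) ∂μ) :=
        (ofReal_integral_eq_lintegral_ofReal hb
          (ae_of_all _ fun ω => (Real.exp_pos _).le.trans (hpt ω))).symm
    _ ≤ _ := by
        apply ENNReal.ofReal_le_ofReal
        have hsub : Integrable (fun ω => 1 - s * ξ ω ^ 2) μ :=
          (integrable_const _).sub (hi2.const_mul _)
        rw [integral_add hsub (hi4.const_mul _),
          integral_sub (integrable_const _) (hi2.const_mul _), integral_const_mul, integral_const_mul,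
          h2]
        simp only [integral_const, probReal_univ, smul_eq_mul, mul_one]
        refine le_trans ?_ (Real.add_one_le_exp _)
        nlinarith [mul_le_mul_of_nonneg_left h4' (sq_nonneg s)]

end SubGaussianSquare

/-! ### Weighted sums of squares of independent sub-Gaussian variables -/

section WeightedSquares

variable {Ω : Type*} [MeasurableSpace Ω] {μ : Measure Ω}

theorem exists_seq_tendsto_finset (I : Type*) [Countable I] :
    ∃ u : ℕ → Finset I, Tendsto u atTop atTop := (atTop : Filter (Finset I)).exists_seq_tendsto

/-- Fatou's lemma along the net of finite subsets of a countable type. -/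
theorem lintegral_le_of_tendsto_finset {I : Type*} [Countable I] {f : Finset I → Ω → ℝ≥0∞}
    {g : Ω → ℝ≥0∞} (hf : ∀ s, AEMeasurable (f s) μ)
    (hfg : ∀ᵐ ω ∂μ, Tendsto (fun s => f s ω) atTop (𝓝 (g ω))) {C : ℝ≥0∞}
    (hC : ∀ s, ∫⁻ ω, f s ω ∂μ ≤ C) : ∫⁻ ω, g ω ∂μ ≤ C := by
  -- Fatou's lemma is applied along a cofinal sequence of finite sets, available because `I` is
  -- countable.
  obtain ⟨u, hu⟩ := exists_seq_tendsto_finset I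
  calc ∫⁻ ω, g ω ∂μ = ∫⁻ ω, liminf (fun m => f (u m) ω) atTop ∂μ :=
        lintegral_congr_ae (hfg.mono fun ω hω => ((hω.comp hu).liminf_eq).symm)
    _ ≤ liminf (fun m => ∫⁻ ω, f (u m) ω ∂μ) atTop := lintegral_liminf_le' fun m => hf _
    _ ≤ C := by
        refine liminf_le_of_le (by isBoundedDefault) fun b hb => ?_
        obtain ⟨m, hm⟩ := hb.exists
        exact hm.trans (hC _)

variable {I : Type*} {ξ : I → Ω → ℝ} {c : ℝ≥0} {w : I → ℝ}

theorem lintegral_exp_sum_eq_prod (hind : iIndepFun ξ μ) (hm : ∀ i, Measurable (ξ i))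
    (f : I → ℝ → ℝ) (hf : ∀ i, Measurable (f i)) (s : Finset I) :
    ∫⁻ ω, ENNReal.ofReal (Real.exp (∑ i ∈ s, f i (ξ i ω))) ∂μ =
      ∏ i ∈ s, ∫⁻ ω, ENNReal.ofReal (Real.exp (f i (ξ i ω))) ∂μ := by
  rw [← lintegral_prod_eq_prod_lintegral_of_indepFun s
    (fun i ω => ENNReal.ofReal (Real.exp (f i (ξ i ω))))]
  · refine lintegral_congr fun ω => ?_
    rw [Real.exp_sum, ENNReal.ofReal_prod_of_nonneg fun i _ => (Real.exp_pos _).le]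
  · exact hind.comp (fun i x => ENNReal.ofReal (Real.exp (f i x))) fun i => by
      have := hf i; fun_prop
  · intro i; have := hf i; have := hm i; fun_prop

/-- Upper tail of a weighted sum of squares. -/
theorem measure_hasSum_weighted_sq_ge_le [Countable I] [IsProbabilityMeasure μ]
    (hind : iIndepFun ξ μ) (hm : ∀ i, Measurable (ξ i))
    (hsub : ∀ i, HasSubgaussianMGF (ξ i) c μ) (hc : 0 < c) (hw : ∀ i, 0 ≤ w i) {W V : ℝ}
    (hW : 0 < W) (hwW : ∀ i, w i ≤ W) (hV : ∀ s : Finset I, ∑ i ∈ s, w i ≤ V) {Q : Ω → ℝ}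
    (hQ : ∀ ω, HasSum (fun i => w i * ξ i ω ^ 2) (Q ω)) (K : ℝ) :
    μ {ω | K * V ≤ Q ω} ≤ ENNReal.ofReal (Real.exp (-((K / (6 * c) - 1) * (V / W)))) := by
  have hc' : (0 : ℝ) < c := hc
  -- The largest `t` for which `w i ≤ W` guarantees the condition `6 * c * (t * w i) ≤ 1` of the
  -- one-variable bound.
  set t : ℝ := 1 / (6 * c * W) with ht
  have ht0 : 0 < t := by positivity
  have hbound : ∫⁻ ω, ENNReal.ofReal (Real.exp (t * Q ω)) ∂μ ≤
      ENNReal.ofReal (Real.exp (V / W)) := by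
    refine lintegral_le_of_tendsto_finset (I := I)
      (f := fun s ω => ENNReal.ofReal (Real.exp (∑ i ∈ s, t * (w i * ξ i ω ^ 2)))) ?_ ?_ ?_
    · intro s
      refine Measurable.aemeasurable ?_
      have : Measurable fun ω => ∑ i ∈ s, t * (w i * ξ i ω ^ 2) :=
        Finset.measurable_fun_sum s fun i _ => by have := hm i; fun_prop
      fun_prop
    · refine ae_of_all _ fun ω => ?_
      have : Tendsto (fun s : Finset I => ∑ i ∈ s, t * (w i * ξ i ω ^ 2)) atTop (𝓝 (t * Q ω)) :=
        (hQ ω).mul_left t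
      exact (ENNReal.continuous_ofReal.tendsto _).comp ((Real.continuous_exp.tendsto _).comp this)
    · intro s
      rw [lintegral_exp_sum_eq_prod hind hm (fun i x => t * (w i * x ^ 2)) (fun i => by fun_prop)]
      calc _ ≤ ∏ i ∈ s, ENNReal.ofReal (Real.exp (6 * c * (t * w i))) := by
            gcongr with i hi
            simp_rw [← mul_assoc t]
            refine (hsub i).lintegral_exp_mul_sq_le hc (mul_nonneg ht0.le (hw i)) ?_
            calc 6 * c * (t * w i) ≤ 6 * c * (t * W) := by gcongr; exact hwW i
              _ = 1 := by rw [ht]; field_simp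
        _ = ENNReal.ofReal (Real.exp (∑ i ∈ s, 6 * c * (t * w i))) := by
            rw [Real.exp_sum, ENNReal.ofReal_prod_of_nonneg fun i _ => (Real.exp_pos _).le]
        _ ≤ _ := by
            gcongr
            rw [← Finset.mul_sum, ← Finset.mul_sum]
            calc 6 * c * (t * ∑ i ∈ s, w i) ≤ 6 * c * (t * V) := by gcongr; exact hV s
              _ = V / W := by rw [ht]; field_simp
  have hQm : Measurable Q := by
    refine measurable_of_tendsto_metrizable' (atTop : Filter (Finset I))
      (f := fun s ω => ∑ i ∈ s, w i * ξ i ω ^ 2) ?_ ?_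
    · exact fun s => Finset.measurable_fun_sum s fun i _ => by have := hm i; fun_prop
    · rw [tendsto_pi_nhds]; exact hQ
  have hmark := meas_ge_le_lintegral_div (μ := μ)
    (f := fun ω => ENNReal.ofReal (Real.exp (t * Q ω))) (by fun_prop)
    (ε := ENNReal.ofReal (Real.exp (t * (K * V)))) (by simp [Real.exp_pos]) ENNReal.ofReal_ne_top
  refine (measure_mono ?_).trans (hmark.trans ((ENNReal.div_le_div_right hbound _).trans ?_))
  · intro ω hω
    simp only [Set.mem_ofPred_eq] at hω ⊢
    gcongr
  · rw [← ENNReal.ofReal_div_of_pos (Real.exp_pos _), ← Real.exp_sub]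
    apply le_of_eq; congr 2; rw [ht]; field_simp; ring

/-- Lower tail of a finite weighted sum of squares. -/
theorem measure_sum_weighted_sq_le_le [IsProbabilityMeasure μ]
    (hind : iIndepFun ξ μ) (hm : ∀ i, Measurable (ξ i))
    (hsub : ∀ i, HasSubgaussianMGF (ξ i) c μ) (hc : 0 < c) (h2 : ∀ i, ∫ ω, ξ i ω ^ 2 ∂μ = 1)
    (s : Finset I) (hw : ∀ i ∈ s, 0 ≤ w i) {W V : ℝ}
    (hW : 0 < W) (hwW : ∀ i ∈ s, w i ≤ W) (hV : V ≤ ∑ i ∈ s, w i) :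
    μ {ω | ∑ i ∈ s, w i * ξ i ω ^ 2 ≤ V / 2} ≤
      ENNReal.ofReal (Real.exp (-(V / (144 * c ^ 2 * W)))) := by
  have hc' : (0 : ℝ) < c := hc
  -- Small enough for the quadratic term `9 * c ^ 2 * (t * w i) ^ 2` to be at most a quarter of the
  -- linear term `t * w i`. Markov's inequality at `V / 2` then leaves `exp (-(t * V / 4))`.
  set t : ℝ := 1 / (36 * c ^ 2 * W) with ht
  have ht0 : 0 < t := by positivity
  set V' := ∑ i ∈ s, w i with hV'
  have hbound : ∫⁻ ω, ENNReal.ofReal (Real.exp (∑ i ∈ s, -(t * w i * ξ i ω ^ 2))) ∂μ ≤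
      ENNReal.ofReal (Real.exp (-(3 / 4 * t * V'))) := by
    rw [lintegral_exp_sum_eq_prod hind hm (fun i x => -(t * w i * x ^ 2)) (fun i => by fun_prop)]
    calc _ ≤ ∏ i ∈ s, ENNReal.ofReal (Real.exp (-(3 / 4 * t * w i))) := by
          gcongr with i hi
          refine ((hsub i).lintegral_exp_neg_mul_sq_le hc (h2 i)
            (mul_nonneg ht0.le (hw i hi))).trans ?_
          gcongr
          have h1 : 9 * (c : ℝ) ^ 2 * (t * W) = 1 / 4 := by rw [ht]; field_simp; norm_num
          have h3 : 9 * (c : ℝ) ^ 2 * (t * w i) ≤ 1 / 4 := by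
            rw [← h1]; gcongr; exact hwW i hi
          have h4 : 0 ≤ t * w i := mul_nonneg ht0.le (hw i hi)
          nlinarith
      _ = ENNReal.ofReal (Real.exp (∑ i ∈ s, -(3 / 4 * t * w i))) := by
          rw [Real.exp_sum, ENNReal.ofReal_prod_of_nonneg fun i _ => (Real.exp_pos _).le]
      _ = _ := by rw [Finset.sum_neg_distrib, ← Finset.mul_sum]
  have hQm : Measurable fun ω => ∑ i ∈ s, -(t * w i * ξ i ω ^ 2) :=
    Finset.measurable_fun_sum s fun i _ => by have := hm i; fun_prop
  have hmark := meas_ge_le_lintegral_div (μ := μ)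
    (f := fun ω => ENNReal.ofReal (Real.exp (∑ i ∈ s, -(t * w i * ξ i ω ^ 2)))) (by fun_prop)
    (ε := ENNReal.ofReal (Real.exp (-(t * (V / 2))))) (by simp [Real.exp_pos]) ENNReal.ofReal_ne_top
  refine (measure_mono ?_).trans (hmark.trans ((ENNReal.div_le_div_right hbound _).trans ?_))
  · intro ω hω
    simp only [Set.mem_ofPred_eq] at hω ⊢
    gcongr
    rw [Finset.sum_neg_distrib]
    simp_rw [mul_assoc]
    rw [← Finset.mul_sum]
    gcongr
  · rw [← ENNReal.ofReal_div_of_pos (Real.exp_pos _), ← Real.exp_sub]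
    gcongr
    have : V / (144 * c ^ 2 * W) = t * V / 4 := by rw [ht]; field_simp; ring
    rw [this]
    nlinarith

end WeightedSquares

/-! ### Nets of the unit sphere -/

/-- A unit vector has a net point within `ε`, and over that distance the image moves by at most `V *
ε`. Hence the a priori norm bound `V`, to be supplied by the upper estimate. -/
theorem le_norm_of_net {E F : Type*} [NormedAddCommGroup E] [NormedSpace ℝ E]
    [NormedAddCommGroup F] [NormedSpace ℝ F] {ε V l : ℝ} {s : Set E}
    (hnet : ∀ x : E, ‖x‖ = 1 → ∃ y ∈ s, ‖x - y‖ ≤ ε) (L : E →ₗ[ℝ] F) (hV : 0 ≤ V)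
    (hL : ∀ x, ‖L x‖ ≤ V * ‖x‖) (hl : ∀ y ∈ s, l ≤ ‖L y‖) (x : E) :
    (l - V * ε) * ‖x‖ ≤ ‖L x‖ := by
  rcases eq_or_ne x 0 with rfl | hx
  · simp
  have hx0 : 0 < ‖x‖ := norm_pos_iff.2 hx
  set z := ‖x‖⁻¹ • x with hz
  have hz1 : ‖z‖ = 1 := by rw [hz, norm_smul, norm_inv, norm_norm, inv_mul_cancel₀ hx0.ne']
  obtain ⟨y, hy, hzy⟩ := hnet z hz1
  have h1 := hL (y - z)
  rw [norm_sub_rev] at h1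
  have h2 : ‖L y‖ ≤ ‖L z‖ + ‖L (y - z)‖ := by
    calc ‖L y‖ = ‖L z + L (y - z)‖ := by rw [map_sub]; congr 1; abel
      _ ≤ _ := norm_add_le _ _
  have h3 : V * ‖z - y‖ ≤ V * ε := by gcongr
  have h4 : ‖L z‖ = ‖x‖⁻¹ * ‖L x‖ := by rw [hz, map_smul, norm_smul, norm_inv, norm_norm]
  have h5 : l - V * ε ≤ ‖x‖⁻¹ * ‖L x‖ := by
    rw [← h4]; linarith [hl y hy]
  calc (l - V * ε) * ‖x‖ ≤ (‖x‖⁻¹ * ‖L x‖) * ‖x‖ := by gcongr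
    _ = ‖L x‖ := by field_simp

theorem measure_biUnion_finset_le_card_mul {Ω ι : Type*} [MeasurableSpace Ω] {μ : Measure Ω}
    {s : Finset ι} {N p : ℝ} (hs : (s.card : ℝ) ≤ N)
    (hp : 0 ≤ p) {A : ι → Set Ω} (hA : ∀ y ∈ s, μ (A y) ≤ ENNReal.ofReal p) :
    μ (⋃ y ∈ s, A y) ≤ ENNReal.ofReal (N * p) :=
  calc μ (⋃ y ∈ s, A y) ≤ ∑ y ∈ s, μ (A y) := measure_biUnion_finset_le s _
    _ ≤ ∑ y ∈ s, ENNReal.ofReal p := Finset.sum_le_sum hA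
    _ = ENNReal.ofReal (s.card * p) := by
        rw [Finset.sum_const, nsmul_eq_mul, ENNReal.ofReal_mul (Nat.cast_nonneg _),
          ENNReal.ofReal_natCast]
    _ ≤ _ := by gcongr

section Nets

variable {E : Type*} [NormedAddCommGroup E] [NormedSpace ℝ E] [FiniteDimensional ℝ E]

/-- Volume comparison: the balls of radius `ε / 2` about the points are disjoint and lie in the ball
of radius `1 + ε / 2`. -/
theorem card_le_of_separated_of_norm_le_one {ε : ℝ} (hε : 0 < ε) (hε1 : ε ≤ 1) (s : Finset E)
    (hs : ∀ c ∈ s, ‖c‖ ≤ 1) (h : ∀ c ∈ s, ∀ d ∈ s, c ≠ d → ε ≤ ‖c - d‖) :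
    (s.card : ℝ) ≤ (3 / ε) ^ Module.finrank ℝ E := by
  borelize E
  let ν : Measure E := Measure.addHaar
  set ρ : ℝ := 1 + ε / 2 with hρ
  have δpos : 0 < ε / 2 := by positivity
  have ρpos : 0 < ρ := by positivity
  have hdisj : Set.Pairwise (s : Set E) (Function.onFun Disjoint fun c => Metric.ball c (ε / 2)) := by
    intro c hc d hd hcd
    apply Metric.ball_disjoint_ball
    rw [dist_eq_norm]
    linarith [h c hc d hd hcd]
  have hsub : (⋃ c ∈ s, Metric.ball (c : E) (ε / 2)) ⊆ Metric.ball (0 : E) ρ := by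
    refine Set.iUnion₂_subset fun x hx => Metric.ball_subset_ball' ?_
    rw [dist_zero_right, hρ]
    linarith [hs x hx]
  have hI : (s.card : ℝ≥0∞) * ENNReal.ofReal ((ε / 2) ^ Module.finrank ℝ E) * ν (Metric.ball 0 1) ≤
      ENNReal.ofReal (ρ ^ Module.finrank ℝ E) * ν (Metric.ball 0 1) := by
    calc (s.card : ℝ≥0∞) * ENNReal.ofReal ((ε / 2) ^ Module.finrank ℝ E) * ν (Metric.ball 0 1)
        = ν (⋃ c ∈ s, Metric.ball (c : E) (ε / 2)) := by
          rw [measure_biUnion_finset hdisj fun c _ => measurableSet_ball]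
          simp only [ν.addHaar_ball_of_pos _ δpos, Finset.sum_const, nsmul_eq_mul, mul_assoc]
      _ ≤ ν (Metric.ball (0 : E) ρ) := measure_mono hsub
      _ = _ := by simp only [ν.addHaar_ball_of_pos _ ρpos]
  have hJ := (ENNReal.mul_le_mul_iff_left (Metric.measure_ball_pos ν (0 : E) one_pos).ne'
    measure_ball_lt_top.ne).1 hI
  have hK : (s.card : ℝ) * (ε / 2) ^ Module.finrank ℝ E ≤ ρ ^ Module.finrank ℝ E := by
    have := ENNReal.toReal_le_of_le_ofReal (by positivity) hJ
    rwa [ENNReal.toReal_mul, ENNReal.toReal_natCast, ENNReal.toReal_ofReal (by positivity)] at this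
  calc (s.card : ℝ) ≤ ρ ^ Module.finrank ℝ E / (ε / 2) ^ Module.finrank ℝ E := by
        rwa [le_div_iff₀ (by positivity)]
    _ = (ρ / (ε / 2)) ^ Module.finrank ℝ E := (div_pow _ _ _).symm
    _ ≤ _ := by
        gcongr ?_ ^ _
        rw [div_le_div_iff₀ δpos hε, hρ]
        nlinarith

/-- A separated set of unit vectors of maximal cardinality is a net, since an uncovered unit vector
could be added to it; the volume bound makes the maximum exist. -/
theorem exists_sphere_net {ε : ℝ} (hε : 0 < ε) (hε1 : ε ≤ 1) :
    ∃ s : Finset E, (∀ y ∈ s, ‖y‖ = 1) ∧ (∀ x : E, ‖x‖ = 1 → ∃ y ∈ s, ‖x - y‖ ≤ ε) ∧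
      (s.card : ℝ) ≤ (3 / ε) ^ Module.finrank ℝ E := by
  classical
  let P : Finset E → Prop := fun s =>
    (∀ y ∈ s, ‖y‖ = 1) ∧ ∀ c ∈ s, ∀ d ∈ s, c ≠ d → ε ≤ ‖c - d‖
  have hcard : ∀ s, P s → (s.card : ℝ) ≤ (3 / ε) ^ Module.finrank ℝ E := fun s hs =>
    card_le_of_separated_of_norm_le_one hε hε1 s (fun c hc => (hs.1 c hc).le) hs.2
  obtain ⟨s, hs, hmax⟩ : ∃ s, P s ∧ ∀ t, P t → t.card ≤ s.card := by
    let A : Set ℕ := {m | ∃ s, P s ∧ s.card = m}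
    have hA : A.Nonempty := ⟨0, ∅, ⟨by simp, by simp⟩, rfl⟩
    have hB : BddAbove A := ⟨⌊(3 / ε) ^ Module.finrank ℝ E⌋₊, by
      rintro m ⟨s, hs, rfl⟩; exact Nat.le_floor (hcard s hs)⟩
    obtain ⟨s, hs, hsc⟩ := Nat.sSup_mem hA hB
    exact ⟨s, hs, fun t ht => hsc ▸ le_csSup hB ⟨t, ht, rfl⟩⟩
  refine ⟨s, hs.1, fun x hx => ?_, hcard s hs⟩
  by_contra! hcon
  have hxs : x ∉ s := fun h => by
    have := hcon x h
    rw [sub_self, norm_zero] at this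
    linarith
  have hP : P (insert x s) := by
    refine ⟨fun y hy => ?_, fun c hc d hd hcd => ?_⟩
    · rcases Finset.mem_insert.1 hy with rfl | hy
      exacts [hx, hs.1 y hy]
    · rcases Finset.mem_insert.1 hc with rfl | hc' <;> rcases Finset.mem_insert.1 hd with rfl | hd'
      · exact absurd rfl hcd
      · exact (hcon d hd').le
      · rw [norm_sub_rev]; exact (hcon c hc').le
      · exact hs.2 c hc' d hd' hcd
  have := hmax _ hP
  rw [Finset.card_insert_of_notMem hxs] at this
  omega

variable {F : Type*} [NormedAddCommGroup F] [NormedSpace ℝ F]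

/-- The operator norm bounds itself: passing to a net point shows that it is at most `U` plus half
of itself. -/
theorem norm_le_of_net {ε U : ℝ} (hε : ε ≤ 1 / 2) {s : Set E}
    (hnet : ∀ x : E, ‖x‖ = 1 → ∃ y ∈ s, ‖x - y‖ ≤ ε) (L : E →ₗ[ℝ] F)
    (hL : ∀ y ∈ s, ‖L y‖ ≤ U) (hU : 0 ≤ U) (x : E) : ‖L x‖ ≤ 2 * U * ‖x‖ := by
  let T : E →L[ℝ] F := LinearMap.toContinuousLinearMap L
  have hT : ∀ z, ‖L z‖ ≤ ‖T‖ * ‖z‖ := fun z => T.le_opNorm z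
  have key : ‖T‖ ≤ U + ‖T‖ / 2 := by
    refine T.opNorm_le_of_unit_norm (by positivity) fun z hz => ?_
    obtain ⟨y, hy, hzy⟩ := hnet z hz
    calc ‖L z‖ = ‖L y + L (z - y)‖ := by rw [map_sub]; congr 1; abel
      _ ≤ ‖L y‖ + ‖L (z - y)‖ := norm_add_le _ _
      _ ≤ U + ‖T‖ * (1 / 2) := add_le_add (hL y hy)
          ((hT _).trans (mul_le_mul_of_nonneg_left (hzy.trans hε) (norm_nonneg _)))
      _ = U + ‖T‖ / 2 := by ring
  exact (hT x).trans (mul_le_mul_of_nonneg_right (by linarith) (norm_nonneg _))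

variable {Ω : Type*} [MeasurableSpace Ω] {μ : Measure Ω}

/-- Uniform upper bound for a random linear map from pointwise bounds on the unit sphere. -/
theorem measure_not_norm_le_le (L : Ω → E →ₗ[ℝ] F) {U p : ℝ} (hU : 0 ≤ U) (hp : 0 ≤ p)
    (hup : ∀ y : E, ‖y‖ = 1 → μ {ω | U ^ 2 ≤ ‖L ω y‖ ^ 2} ≤ ENNReal.ofReal p) :
    μ {ω | ¬ ∀ x, ‖L ω x‖ ≤ 2 * U * ‖x‖} ≤ ENNReal.ofReal (6 ^ Module.finrank ℝ E * p) := by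
  obtain ⟨s, hs1, hnet, hcard⟩ := exists_sphere_net (E := E) (ε := 1 / 2) (by norm_num) (by norm_num)
  norm_num at hcard
  refine (measure_mono (fun ω hω => ?_)).trans
    (measure_biUnion_finset_le_card_mul hcard hp fun y hy => hup y (hs1 y hy))
  by_contra hcon
  simp only [Set.mem_iUnion, Set.mem_ofPred_eq, not_exists, not_le] at hcon
  exact hω fun x => norm_le_of_net le_rfl hnet (L ω)
    (fun y hy => (abs_le_of_sq_le_sq' (hcon y hy).le hU).2) hU x

/-- Uniform lower bound for a bounded random linear map from pointwise bounds on the unit sphere. -/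
theorem measure_not_le_norm_le (L : Ω → E →ₗ[ℝ] F) {ε V l p : ℝ} (hε : 0 < ε) (hε1 : ε ≤ 1)
    (hV : 0 ≤ V) (hp : 0 ≤ p)
    (hlow : ∀ y : E, ‖y‖ = 1 → μ {ω | ‖L ω y‖ ^ 2 ≤ l ^ 2} ≤ ENNReal.ofReal p) :
    μ {ω | (∀ x, ‖L ω x‖ ≤ V * ‖x‖) ∧ ¬ ∀ x, (l - V * ε) * ‖x‖ ≤ ‖L ω x‖} ≤
      ENNReal.ofReal ((3 / ε) ^ Module.finrank ℝ E * p) := by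
  obtain ⟨s, hs1, hnet, hcard⟩ := exists_sphere_net (E := E) hε hε1
  refine (measure_mono (fun ω hω => ?_)).trans
    (measure_biUnion_finset_le_card_mul hcard hp fun y hy => hlow y (hs1 y hy))
  by_contra hcon
  simp only [Set.mem_iUnion, Set.mem_ofPred_eq, not_exists, not_le] at hcon
  exact hω.2 fun x => le_norm_of_net hnet (L ω) hV hω.1
    (fun y hy => (abs_le_of_sq_le_sq' (hcon y hy).le (norm_nonneg _)).2) x

end Nets

/-! ### Independent standardized families -/

section Families

variable {Ω : Type*} [MeasurableSpace Ω] {μ : Measure Ω}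

/-- Independence and vanishing means remove all cross terms. The common variance `τ` is `1` for the
features and the signs, and the noise variance for the labels. -/
theorem integral_affine_sq_of_iIndepFun [IsProbabilityMeasure μ] {I : Type*} {ξ : I → Ω → ℝ}
    (hind : iIndepFun ξ μ) (hL : ∀ i, MemLp (ξ i) 2 μ) (h0 : ∀ i, ∫ ω, ξ i ω ∂μ = 0) {τ : ℝ}
    (h2 : ∀ i, ∫ ω, ξ i ω ^ 2 ∂μ = τ) (s : Finset I) (a : ℝ) (u : I → ℝ) :
    ∫ ω, (a + ∑ i ∈ s, u i * ξ i ω) ^ 2 ∂μ = a ^ 2 + τ * ∑ i ∈ s, u i ^ 2 := by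
  have hLu : ∀ i, MemLp (fun ω => u i * ξ i ω) 2 μ := fun i => (hL i).const_mul _
  have hS : MemLp (fun ω => ∑ i ∈ s, u i * ξ i ω) 2 μ := memLp_finsetSum _ fun i _ => hLu i
  have hS0 : ∫ ω, ∑ i ∈ s, u i * ξ i ω ∂μ = 0 := by
    rw [integral_finsetSum _ fun i _ => (hLu i).integrable one_le_two]
    refine Finset.sum_eq_zero fun i _ => ?_
    rw [integral_const_mul, h0, mul_zero]
  have hvar : ∫ ω, (∑ i ∈ s, u i * ξ i ω) ^ 2 ∂μ = τ * ∑ i ∈ s, u i ^ 2 := by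
    have h1 := variance_eq_sub hS
    rw [hS0] at h1
    have h3 : variance (fun ω => ∑ i ∈ s, u i * ξ i ω) μ =
        ∑ i ∈ s, variance (fun ω => u i * ξ i ω) μ := by
      rw [← IndepFun.variance_sum (fun i _ => hLu i) fun i _ j _ hij =>
        (hind.indepFun hij).comp (measurable_const_mul (u i)) (measurable_const_mul (u j))]
      congr 1
      ext ω
      simp
    have h4 : ∀ i, variance (fun ω => u i * ξ i ω) μ = u i ^ 2 * τ := fun i => by
      rw [variance_const_mul, variance_eq_sub (hL i), h0 i, ← h2 i]
      simp
    rw [h3] at h1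
    simp only [h4, Pi.pow_apply] at h1
    rw [← Finset.sum_mul] at h1
    linarith
  have hi2 := hS.integrable_sq
  have hi1 := hS.integrable one_le_two
  have hexp : ∀ ω, (a + ∑ i ∈ s, u i * ξ i ω) ^ 2 =
      a ^ 2 + (2 * a * ∑ i ∈ s, u i * ξ i ω + (∑ i ∈ s, u i * ξ i ω) ^ 2) := fun ω => by ring
  simp_rw [hexp]
  have hi12 : Integrable (fun ω => 2 * a * ∑ i ∈ s, u i * ξ i ω +
      (∑ i ∈ s, u i * ξ i ω) ^ 2) μ := (hi1.const_mul _).add hi2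
  rw [integral_add (integrable_const _) hi12,
    integral_add (hi1.const_mul _) hi2, integral_const_mul, hS0, hvar]
  simp

theorem lintegral_affine_sq_of_iIndepFun [IsProbabilityMeasure μ] {I : Type*} {ξ : I → Ω → ℝ}
    (hind : iIndepFun ξ μ) (hL : ∀ i, MemLp (ξ i) 2 μ) (h0 : ∀ i, ∫ ω, ξ i ω ∂μ = 0) {τ : ℝ}
    (h2 : ∀ i, ∫ ω, ξ i ω ^ 2 ∂μ = τ) (s : Finset I) (a : ℝ) (u : I → ℝ) :
    ∫⁻ ω, ENNReal.ofReal ((a + ∑ i ∈ s, u i * ξ i ω) ^ 2) ∂μ =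
      ENNReal.ofReal (a ^ 2 + τ * ∑ i ∈ s, u i ^ 2) := by
  rw [← integral_affine_sq_of_iIndepFun hind hL h0 h2 s a u,
    ofReal_integral_eq_lintegral_ofReal _ (ae_of_all _ fun ω => sq_nonneg _)]
  exact ((memLp_const a).add (memLp_finsetSum s fun i _ => (hL i).const_mul (u i))).integrable_sq

/-- Rows of a jointly independent array are independent. -/
theorem iIndepFun_curry {A B : Type*} {ξ : A × B → Ω → ℝ} (hm : ∀ p, Measurable (ξ p))
    (hind : iIndepFun ξ μ) : iIndepFun (fun (b : B) ω (a : A) => ξ (a, b) ω) μ := by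
  have := hind.isProbabilityMeasure
  have hind' : iIndepFun (fun p : B × A => ξ (p.2, p.1)) μ :=
    hind.precomp (Equiv.prodComm B A).injective
  have hp : ∀ p, IsProbabilityMeasure (μ.map (ξ p)) := fun p =>
    Measure.isProbabilityMeasure_map (hm p).aemeasurable
  -- Independence means that the joint law is a product measure, and a product over pairs is a
  -- product of products.
  rw [iIndepFun_iff_map_fun_eq_infinitePi_map (by fun_prop)]
  have h1 := (iIndepFun_iff_map_fun_eq_infinitePi_map (by fun_prop)).1 hind'
  have h2 : ∀ b, μ.map (fun ω a => ξ (a, b) ω) =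
      Measure.infinitePi fun a => μ.map (ξ (a, b)) := fun b =>
    (iIndepFun_iff_map_fun_eq_infinitePi_map (by fun_prop)).1
      (hind.precomp (g := fun a => (a, b)) fun a a' h => (Prod.ext_iff.1 h).1)
  simp_rw [h2]
  rw [← Measure.infinitePi_map_curry (fun b a => μ.map (ξ (a, b))), ← h1,
    Measure.map_map (by fun_prop) (by fun_prop)]
  rfl

/-- Independent, centered, sub-Gaussian variables of unit variance. -/
structure IsStdSubgaussian {I : Type*} (ξ : I → Ω → ℝ) (c : ℝ≥0) (μ : Measure Ω) : Prop where
  measurable : ∀ i, Measurable (ξ i)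
  indep : iIndepFun ξ μ
  mean : ∀ i, ∫ ω, ξ i ω ∂μ = 0
  second : ∀ i, ∫ ω, ξ i ω ^ 2 ∂μ = 1
  sub : ∀ i, HasSubgaussianMGF (ξ i) c μ

namespace IsStdSubgaussian

variable {I : Type*} {ξ : I → Ω → ℝ} {c : ℝ≥0}

theorem precomp (h : IsStdSubgaussian ξ c μ) {J : Type*} {g : J → I} (hg : Function.Injective g) :
    IsStdSubgaussian (fun j => ξ (g j)) c μ :=
  ⟨fun _ => h.measurable _, h.indep.precomp hg, fun _ => h.mean _, fun _ => h.second _,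
    fun _ => h.sub _⟩

/-- Variances and sub-Gaussian constants both combine with the weights `y a ^ 2`, which add up to
`1`. Every point of a unit sphere in the net arguments is thus covered by the same tail bounds. -/
theorem linComb {A B : Type*} [Fintype A] {ξ : A × B → Ω → ℝ} (h : IsStdSubgaussian ξ c μ)
    {y : A → ℝ} (hy : ∑ a, y a ^ 2 = 1) :
    IsStdSubgaussian (fun (b : B) ω => ∑ a, y a * ξ (a, b) ω) c μ := by
  have := h.indep.isProbabilityMeasure
  have hinj : ∀ b : B, Function.Injective fun a : A => (a, b) := fun b a a' h => (Prod.ext_iff.1 h).1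
  have hL : ∀ p, MemLp (ξ p) 2 μ := fun p => (h.sub p).memLp 2
  refine ⟨fun b => ?_, ?_, fun b => ?_, fun b => ?_, fun b => ?_⟩
  · exact Finset.measurable_fun_sum _ fun a _ => (h.measurable (a, b)).const_mul _
  · exact (iIndepFun_curry h.measurable h.indep).comp (fun _ x => ∑ a, y a * x a) fun b => by fun_prop
  · rw [integral_finsetSum _ fun a _ => ((hL _).integrable one_le_two).const_mul _]
    exact Finset.sum_eq_zero fun a _ => by rw [integral_const_mul, h.mean, mul_zero]
  · have := integral_affine_sq_of_iIndepFun (h.indep.precomp (hinj b)) (fun _ => hL _)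
      (fun _ => h.mean _) (fun _ => h.second _) Finset.univ 0 y
    simpa [hy] using this
  · let q : A → ℝ≥0 := fun a => ⟨y a ^ 2, sq_nonneg (y a)⟩
    have hq : ∀ a, HasSubgaussianMGF ((fun x => y a * x) ∘ ξ (a, b)) (q a * c) μ := fun a =>
      (h.sub (a, b)).const_mul (y a)
    have h1 := HasSubgaussianMGF.sum_of_iIndepFun (s := Finset.univ)
      ((h.indep.precomp (hinj b)).comp (fun a x => y a * x) fun a => measurable_const_mul (y a))
      fun a _ => hq a
    have h2 : ∑ a : A, q a * c = c := by
      apply NNReal.coe_injective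
      have : ∀ a, (q a : ℝ) = y a ^ 2 := fun a => rfl
      rw [NNReal.coe_sum]
      simp only [NNReal.coe_mul, this, ← Finset.sum_mul, hy, one_mul]
    rw [h2] at h1
    exact h1

end IsStdSubgaussian

/-- Independent copies of a standardized family form a standardized family. -/
theorem IsStdSubgaussian.pi {I : Type*} {ξ : I → Ω → ℝ} {c : ℝ≥0} [IsProbabilityMeasure μ]
    (h : IsStdSubgaussian ξ c μ) (n : ℕ) :
    IsStdSubgaussian (fun (p : Fin n × I) (X : Fin n → Ω) => ξ p.2 (X p.1)) c
      (Measure.pi fun _ : Fin n => μ) := by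
  have hmp : ∀ l : Fin n, MeasurePreserving (Function.eval l) (Measure.pi fun _ : Fin n => μ) μ :=
    fun l => measurePreserving_eval (fun _ : Fin n => μ) l
  have hm := h.measurable
  have hint : ∀ (l : Fin n) (g : Ω → ℝ), Measurable g →
      ∫ X : Fin n → Ω, g (X l) ∂(Measure.pi fun _ : Fin n => μ) = ∫ ω, g ω ∂μ := fun l g hg => by
    conv_rhs => rw [← (hmp l).map_eq,
      integral_map (measurable_pi_apply l).aemeasurable hg.aestronglyMeasurable]
  refine ⟨fun p => (h.measurable _).comp (measurable_pi_apply _), ?_, fun p => ?_, fun p => ?_,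
    fun p => ?_⟩
  · refine iIndepFun_uncurry' (X := fun (l : Fin n) (i : I) (X : Fin n → Ω) => ξ i (X l))
      (fun l i => (h.measurable _).comp (measurable_pi_apply _)) ?_ fun l => ?_
    · exact iIndepFun_pi (X := fun (_ : Fin n) x i => ξ i x) fun l =>
        (measurable_pi_lambda _ hm).aemeasurable
    · have hp : ∀ i, IsProbabilityMeasure (μ.map (ξ i)) := fun i =>
        Measure.isProbabilityMeasure_map (hm i).aemeasurable
      have h1 := (iIndepFun_iff_map_fun_eq_infinitePi_map hm).1 h.indep
      rw [iIndepFun_iff_map_fun_eq_infinitePi_map (by fun_prop)]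
      have h2 : ∀ i, Measure.map (fun X : Fin n → Ω => ξ i (X l)) (Measure.pi fun _ : Fin n => μ) =
          μ.map (ξ i) := fun i => by
        conv_rhs => rw [← (hmp l).map_eq, Measure.map_map (hm i) (measurable_pi_apply l)]
        rfl
      simp_rw [h2]
      rw [← h1]
      conv_rhs => rw [← (hmp l).map_eq,
        Measure.map_map (measurable_pi_lambda _ hm) (measurable_pi_apply l)]
      rfl
  · exact (hint p.1 _ (hm p.2)).trans (h.mean p.2)
  · exact (hint p.1 _ ((hm p.2).pow_const 2)).trans (h.second p.2)
  · have := h.sub p.2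
    rw [← (hmp p.1).map_eq] at this
    exact HasSubgaussianMGF.of_map (measurable_pi_apply _).aemeasurable this

end Families

/-! ### Whitened features of the model -/

namespace LinearModel

variable {H : Type*} [NormedAddCommGroup H] [InnerProductSpace ℝ H] [MeasurableSpace H]
  {σx : ℝ≥0} (M : LinearModel H σx)

/-- The standardized components of a feature vector. -/
def feature (j : CoordIdx M.p) (x : H) : ℝ := inner ℝ (M.v j) x / √(M.eig j)

theorem eig_coe_pos (j : CoordIdx M.p) : 0 < M.eig j := M.eig_pos j j.2

theorem inner_eq_sqrt_mul_feature (j : CoordIdx M.p) (x : H) :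
    inner ℝ (M.v j) x = √(M.eig j) * M.feature j x := by
  have := (Real.sqrt_pos.2 (M.eig_coe_pos j)).ne'
  rw [feature]; field_simp

theorem inner_sq_eq_mul_feature_sq (j : CoordIdx M.p) (x : H) :
    inner ℝ (M.v j) x ^ 2 = M.eig j * M.feature j x ^ 2 := by
  rw [inner_eq_sqrt_mul_feature, mul_pow, Real.sq_sqrt (M.eig_coe_pos j).le]

variable [BorelSpace H]

theorem isStdSubgaussian_feature : IsStdSubgaussian M.feature (σx ^ 2) M.D where
  measurable j := by unfold feature; fun_prop
  indep := M.indep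
  mean := M.mean_zero
  second := M.unit_var
  sub := M.subgaussian

theorem isStdSubgaussian_array (n : ℕ) :
    IsStdSubgaussian (fun (p : Fin n × CoordIdx M.p) (X : Fin n → H) => M.feature p.2 (X p.1))
      (σx ^ 2) (Measure.pi fun _ : Fin n => M.D) :=
  have := M.D_prob
  M.isStdSubgaussian_feature.pi n

end LinearModel

/-! ### Concentration for arrays of standardized variables -/

namespace IsStdSubgaussian

variable {Ω : Type*} [MeasurableSpace Ω] {μ : Measure Ω} [IsProbabilityMeasure μ] {c : ℝ≥0}
  {n : ℕ} {J : Type*} {ζ : Fin n × J → Ω → ℝ}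

/-- Union bound for a `1 / 2`-net: since `6 ≤ exp 2`, the net points cost at most `exp (2 * n)`. -/
theorem six_pow_mul_exp_le {m n : ℕ} (h : m ≤ n) :
    (6 : ℝ) ^ m * Real.exp (-(3 * n)) ≤ Real.exp (-n) := by
  have h6 : (6 : ℝ) ≤ Real.exp 2 := by
    have := Real.exp_one_gt_d9
    rw [show (2 : ℝ) = 1 + 1 by norm_num, Real.exp_add]
    nlinarith
  calc (6 : ℝ) ^ m * Real.exp (-(3 * n)) ≤ (6 : ℝ) ^ n * Real.exp (-(3 * n)) := by
        gcongr; norm_num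
    _ ≤ Real.exp 2 ^ n * Real.exp (-(3 * n)) := by gcongr
    _ = Real.exp (-n) := by rw [← Real.exp_nat_mul, ← Real.exp_add]; ring_nf

/-- Two-sided bounds for the columns of a tall random matrix. -/
theorem exists_tall_matrix_bounds (c : ℝ≥0) (hc : 0 < c) :
    ∃ a > (0 : ℝ), ∃ A > (0 : ℝ), ∃ m > (0 : ℝ), ∃ κ > (0 : ℝ), ∀ {Ω : Type*} [MeasurableSpace Ω]
      {μ : Measure Ω} [IsProbabilityMeasure μ] {n : ℕ} {J : Type*} [Fintype J]
      {ζ : Fin n × J → Ω → ℝ}, 0 < n → IsStdSubgaussian ζ c μ → (Fintype.card J : ℝ) ≤ m * n →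
      ∀ L : Ω → EuclideanSpace ℝ J →ₗ[ℝ] EuclideanSpace ℝ (Fin n),
      (∀ ω x l, L ω x l = ∑ j, x j * ζ (l, j) ω) →
      μ {ω | ¬ ∀ x, a * n * ‖x‖ ^ 2 ≤ ‖L ω x‖ ^ 2 ∧ ‖L ω x‖ ^ 2 ≤ A * n * ‖x‖ ^ 2} ≤
        ENNReal.ofReal (2 * Real.exp (-(κ * n))) := by
  have hc' : (0 : ℝ) < c := hc
  -- With upper bound `2 * U` and lower bound `l` on the net, `U / l = √(48 * c)`; this `ε` makes
  -- the net loss `2 * U * ε` at most `l / 2`.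
  set ε : ℝ := min 1 (1 / (4 * √(48 * c))) with hε
  have hε0 : 0 < ε := by positivity
  have hε1 : ε ≤ 1 := min_le_left _ _
  have hlog : 0 < Real.log (3 / ε) := Real.log_pos (by rw [lt_div_iff₀ hε0]; linarith)
  -- With at most `m * n` columns, the net of cardinality at most `(3 / ε) ^ card J` uses up at most
  -- half of the exponent `n / (144 * c ^ 2)` of the lower tail.
  set m : ℝ := min 1 (1 / (288 * c ^ 2 * Real.log (3 / ε))) with hm
  have hm0 : 0 < m := by positivity
  set κ : ℝ := min 1 (1 / (288 * c ^ 2)) with hκ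
  refine ⟨1 / 8, by norm_num, 96 * c, by positivity, m, hm0, κ, by positivity, ?_⟩
  intro Ω _ μ _ n J _ ζ hn hζ hcard L hL
  have hn' : (0 : ℝ) < n := by exact_mod_cast hn
  have hJn : Fintype.card J ≤ n := by
    have : (Fintype.card J : ℝ) ≤ n := hcard.trans (by
      calc m * n ≤ 1 * n := by gcongr; exact min_le_left _ _
        _ = n := one_mul _)
    exact_mod_cast this
  have hsq : ∀ ω (y : EuclideanSpace ℝ J), ‖L ω y‖ ^ 2 = ∑ l, (∑ j, y j * ζ (l, j) ω) ^ 2 := by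
    intro ω y
    rw [EuclideanSpace.real_norm_sq_eq]
    simp_rw [hL]
  have hcomb : ∀ y : EuclideanSpace ℝ J, ‖y‖ = 1 →
      IsStdSubgaussian (fun (l : Fin n) ω => ∑ j, y j * ζ (l, j) ω) c μ := by
    intro y hy
    refine (hζ.precomp (g := fun p : J × Fin n => (p.2, p.1))
      (Equiv.prodComm J (Fin n)).injective).linComb (y := y) ?_
    rw [← EuclideanSpace.real_norm_sq_eq, hy, one_pow]
  -- The factor `24 * c` makes the exponent in the upper tail bound equal to `3 * n`.
  set U : ℝ := √(24 * c * n) with hU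
  have hU2 : U ^ 2 = 24 * c * n := Real.sq_sqrt (by positivity)
  set l : ℝ := √(n / 2) with hl
  have hl2 : l ^ 2 = n / 2 := Real.sq_sqrt (by positivity)
  have hup := measure_not_norm_le_le (μ := μ) L (U := U) (p := Real.exp (-(3 * n)))
    (Real.sqrt_nonneg _) (Real.exp_pos _).le (by
      intro y hy
      have h1 := hcomb y hy
      have h2 := measure_hasSum_weighted_sq_ge_le h1.indep h1.measurable h1.sub hc
        (w := fun _ => 1) (fun _ => zero_le_one) one_pos (fun _ => le_rfl) (V := n)
        (fun s => by simpa using s.card_le_univ)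
        (Q := fun ω => ‖L ω y‖ ^ 2) (fun ω => by
          rw [hsq]; simpa using hasSum_fintype fun l : Fin n => (∑ j, y j * ζ (l, j) ω) ^ 2) (24 * c)
      rw [hU2]
      refine h2.trans (ENNReal.ofReal_le_ofReal (le_of_eq ?_))
      congr 1; field_simp; norm_num)
  have hlow := measure_not_le_norm_le (μ := μ) L (ε := ε) (V := 2 * U) (l := l)
    (p := Real.exp (-(n / (144 * c ^ 2)))) hε0 hε1 (by positivity) (Real.exp_pos _).le (by
      intro y hy
      have h1 := hcomb y hy
      have h2 := measure_sum_weighted_sq_le_le h1.indep h1.measurable h1.sub hc h1.second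
        Finset.univ (w := fun _ => 1) (fun _ _ => zero_le_one) one_pos (fun _ _ => le_rfl) (V := n)
        (by simp)
      simp only [one_mul, mul_one] at h2
      simp_rw [hl2, hsq]
      exact h2)
  rw [finrank_euclideanSpace] at hup hlow
  have hVε : 2 * U * ε ≤ l / 2 := by
    have hs : 0 < √(48 * (c : ℝ)) := Real.sqrt_pos.2 (by positivity)
    have hUl : U = √(48 * c) * l := by
      rw [hU, hl, ← Real.sqrt_mul (by positivity)]; congr 1; ring
    calc 2 * U * ε ≤ 2 * U * (1 / (4 * √(48 * c))) := by
          gcongr; exact min_le_right _ _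
      _ = l / 2 := by rw [hUl]; field_simp; ring
  have hsub : {ω | ¬ ∀ x, 1 / 8 * n * ‖x‖ ^ 2 ≤ ‖L ω x‖ ^ 2 ∧ ‖L ω x‖ ^ 2 ≤ 96 * c * n * ‖x‖ ^ 2} ⊆
      {ω | ¬ ∀ x, ‖L ω x‖ ≤ 2 * U * ‖x‖} ∪
      {ω | (∀ x, ‖L ω x‖ ≤ 2 * U * ‖x‖) ∧ ¬ ∀ x, (l - 2 * U * ε) * ‖x‖ ≤ ‖L ω x‖} := by
    intro ω hω
    by_contra hcon
    simp only [Set.mem_union, Set.mem_ofPred_eq, not_or, not_not, not_and] at hcon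
    refine hω fun x => ⟨?_, ?_⟩
    · have h1 := hcon.2 hcon.1 x
      have h2 : l / 2 * ‖x‖ ≤ ‖L ω x‖ := le_trans (by gcongr; linarith) h1
      calc 1 / 8 * n * ‖x‖ ^ 2 = (l / 2 * ‖x‖) ^ 2 := by rw [mul_pow, div_pow, hl2]; ring
        _ ≤ _ := by gcongr
    · calc ‖L ω x‖ ^ 2 ≤ (2 * U * ‖x‖) ^ 2 := by gcongr; exact hcon.1 x
        _ = _ := by rw [mul_pow, mul_pow, hU2]; ring
  refine (measure_mono hsub).trans ((measure_union_le _ _).trans ((add_le_add hup hlow).trans ?_))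
  rw [← ENNReal.ofReal_add (by positivity) (by positivity)]
  apply ENNReal.ofReal_le_ofReal
  have e1 : Real.exp (-(n : ℝ)) ≤ Real.exp (-(κ * n)) := by
    gcongr
    calc κ * n ≤ 1 * n := by gcongr; exact min_le_left _ _
      _ = n := one_mul _
  have e2 : (3 / ε) ^ Fintype.card J * Real.exp (-(n / (144 * c ^ 2))) ≤ Real.exp (-(κ * n)) := by
    rw [← Real.exp_log (show 0 < 3 / ε by positivity), ← Real.exp_nat_mul, ← Real.exp_add]
    gcongr
    have h1 : (Fintype.card J : ℝ) * Real.log (3 / ε) ≤ n / (288 * c ^ 2) := by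
      calc (Fintype.card J : ℝ) * Real.log (3 / ε) ≤ m * n * Real.log (3 / ε) := by gcongr
        _ ≤ 1 / (288 * c ^ 2 * Real.log (3 / ε)) * n * Real.log (3 / ε) := by
            gcongr; exact min_le_right _ _
        _ = _ := by field_simp
    have h2 : κ * n ≤ n / (288 * c ^ 2) := by
      calc κ * n ≤ 1 / (288 * c ^ 2) * n := by gcongr; exact min_le_right _ _
        _ = _ := by ring
    have h3 : (n : ℝ) / (144 * c ^ 2) = 2 * (n / (288 * c ^ 2)) := by field_simp; norm_num
    linarith
  linarith [six_pow_mul_exp_le hJn]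

/-- Upper bound for a wide random matrix with weighted columns. -/
theorem wide_matrix_upper [Countable J] (hc : 0 < c) (hζ : IsStdSubgaussian ζ c μ) {w : J → ℝ}
    (hw : ∀ j, 0 ≤ w j) {W S β : ℝ} (hW : 0 < W) (hwW : ∀ j, w j ≤ W)
    (hS : ∀ s : Finset J, ∑ j ∈ s, w j ≤ S) (hβ : 0 < β) (hWS : W * n ≤ β * S) (hS0 : 0 ≤ S)
    {F : Type*} [NormedAddCommGroup F] [NormedSpace ℝ F]
    (L : Ω → EuclideanSpace ℝ (Fin n) →ₗ[ℝ] F)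
    (hL : ∀ ω x, HasSum (fun j => w j * (∑ l, x l * ζ (l, j) ω) ^ 2) (‖L ω x‖ ^ 2)) :
    μ {ω | ¬ ∀ x, ‖L ω x‖ ≤ 2 * √(6 * c * (3 * β + 1) * S) * ‖x‖} ≤
      ENNReal.ofReal (Real.exp (-n)) := by
  have hc' : (0 : ℝ) < c := hc
  -- With this factor the exponent of the upper tail is `3 * β * (S / W)`, at least `3 * n` by
  -- `hWS`.
  have h := measure_not_norm_le_le (μ := μ) L (U := √(6 * c * (3 * β + 1) * S))
    (p := Real.exp (-(3 * n))) (Real.sqrt_nonneg _) (Real.exp_pos _).le (by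
      intro y hy
      have h1 : IsStdSubgaussian (fun (j : J) ω => ∑ l, y l * ζ (l, j) ω) c μ :=
        hζ.linComb (y := y) (by rw [← EuclideanSpace.real_norm_sq_eq, hy, one_pow])
      have h2 := measure_hasSum_weighted_sq_ge_le h1.indep h1.measurable h1.sub hc hw hW hwW hS
        (fun ω => hL ω y) (6 * c * (3 * β + 1))
      rw [Real.sq_sqrt (by positivity)]
      refine h2.trans (ENNReal.ofReal_le_ofReal (Real.exp_le_exp.2 ?_))
      have h3 : (n : ℝ) ≤ β * (S / W) := by
        rw [← mul_div_assoc, le_div_iff₀ hW, mul_comm]; exact hWS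
      have h4 : 6 * (c : ℝ) * (3 * β + 1) / (6 * c) - 1 = 3 * β := by field_simp; ring
      rw [h4]
      linarith [mul_assoc 3 β (S / W)])
  refine h.trans (ENNReal.ofReal_le_ofReal ?_)
  rw [finrank_euclideanSpace, Fintype.card_fin]
  exact six_pow_mul_exp_le le_rfl

/-- Lower bound for a wide random matrix, if enough of the weight is spread out. -/
theorem exists_wide_matrix_lower (c : ℝ≥0) (hc : 0 < c) {K : ℝ} (hK : 0 < K) :
    ∃ η > (0 : ℝ), ∀ {Ω : Type*} [MeasurableSpace Ω]
      {μ : Measure Ω} [IsProbabilityMeasure μ] {n : ℕ} {J : Type*}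
      {ζ : Fin n × J → Ω → ℝ}, 0 < n → IsStdSubgaussian ζ c μ → ∀ {w : J → ℝ}, (∀ j, 0 ≤ w j) →
      ∀ {S : ℝ}, 0 < S → ∀ G : Finset J, (∀ j ∈ G, w j ≤ η * S / n) → S / 2 ≤ ∑ j ∈ G, w j →
      ∀ {F : Type*} [NormedAddCommGroup F] [NormedSpace ℝ F]
        (L : Ω → EuclideanSpace ℝ (Fin n) →ₗ[ℝ] F),
      (∀ ω x, HasSum (fun j => w j * (∑ l, x l * ζ (l, j) ω) ^ 2) (‖L ω x‖ ^ 2)) →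
      μ {ω | (∀ x, ‖L ω x‖ ≤ 2 * √(K * S) * ‖x‖) ∧ ¬ ∀ x, √S / 4 * ‖x‖ ≤ ‖L ω x‖} ≤
        ENNReal.ofReal (Real.exp (-n)) := by
  have hc' : (0 : ℝ) < c := hc
  set ε : ℝ := min 1 (1 / (8 * √K)) with hε
  have hε0 : 0 < ε := by positivity
  have hε1 : ε ≤ 1 := min_le_left _ _
  have hlog : 0 < Real.log (3 / ε) := Real.log_pos (by rw [lt_div_iff₀ hε0]; linarith)
  -- With weights at most `η * S / n` on `G`, the lower tail at one point of the sphere has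
  -- probability at most `exp (-(n * (log (3 / ε) + 1)))`, which outweighs the `(3 / ε) ^ n` net
  -- points by a factor `exp (-n)`.
  refine ⟨1 / (288 * c ^ 2 * (Real.log (3 / ε) + 1)), by positivity, ?_⟩
  intro Ω _ μ _ n J ζ hn hζ w hw S hS G hG hGS F _ _ L hL
  have hn' : (0 : ℝ) < n := by exact_mod_cast hn
  have hsqS : √S ^ 2 = S := Real.sq_sqrt hS.le
  have h := measure_not_le_norm_le (μ := μ) L (ε := ε) (V := 2 * √(K * S)) (l := √S / 2)
    (p := Real.exp (-(n * (Real.log (3 / ε) + 1)))) hε0 hε1 (by positivity) (Real.exp_pos _).le (by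
      intro y hy
      have h1 : IsStdSubgaussian (fun (j : J) ω => ∑ l, y l * ζ (l, j) ω) c μ :=
        hζ.linComb (y := y) (by rw [← EuclideanSpace.real_norm_sq_eq, hy, one_pow])
      have h2 := measure_sum_weighted_sq_le_le h1.indep h1.measurable h1.sub hc h1.second
        G (fun j _ => hw j)
        (W := 1 / (288 * c ^ 2 * (Real.log (3 / ε) + 1)) * S / n) (by positivity) hG hGS
      refine (measure_mono fun ω hω => ?_).trans (h2.trans (ENNReal.ofReal_le_ofReal ?_))
      · simp only [Set.mem_ofPred_eq] at hω ⊢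
        refine (sum_le_hasSum G (fun j _ => mul_nonneg (hw j) (sq_nonneg _)) (hL ω y)).trans
          (hω.trans (le_of_eq ?_))
        rw [div_pow, hsqS]; ring
      · apply le_of_eq; congr 2; field_simp; norm_num)
  have hVε : 2 * √(K * S) * ε ≤ √S / 4 := by
    have hs : 0 < √K := Real.sqrt_pos.2 hK
    calc 2 * √(K * S) * ε ≤ 2 * √(K * S) * (1 / (8 * √K)) := by
          gcongr; exact min_le_right _ _
      _ = √S / 4 := by rw [Real.sqrt_mul hK.le]; field_simp; norm_num
  refine (measure_mono ?_).trans (h.trans (ENNReal.ofReal_le_ofReal ?_))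
  · rintro ω ⟨h1, h2⟩
    refine ⟨h1, fun hcon => h2 fun x => le_trans ?_ (hcon x)⟩
    gcongr; linarith
  · rw [finrank_euclideanSpace, Fintype.card_fin,
      ← Real.exp_log (show 0 < 3 / ε by positivity), ← Real.exp_nat_mul, ← Real.exp_add,
      Real.log_exp]
    gcongr
    linarith

/-- A weighted sum of squares over the whole array. -/
theorem weighted_array_upper [Countable J] (hc : 0 < c) (hζ : IsStdSubgaussian ζ c μ) {w : J → ℝ}
    (hw : ∀ j, 0 ≤ w j) {V : ℝ} (hV : HasSum w V) {Q : Ω → ℝ}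
    (hQ : ∀ ω, HasSum (fun j => w j * ∑ l, ζ (l, j) ω ^ 2) (Q ω)) :
    μ {ω | ¬ Q ω ≤ 12 * c * n * V} ≤ ENNReal.ofReal (Real.exp (-n)) := by
  have hc' : (0 : ℝ) < c := hc
  have hV0 : 0 ≤ V := hV.nonneg hw
  rcases hV0.eq_or_lt with hV0 | hV0
  · have hw0 : w = 0 := (hasSum_zero_iff_of_nonneg hw).1 (by rwa [← hV0] at hV)
    have : {ω | ¬ Q ω ≤ 12 * c * n * V} = ∅ := by
      ext ω
      have h1 := hQ ω
      simp only [hw0, Pi.zero_apply, zero_mul] at h1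
      have : Q ω = 0 := h1.unique hasSum_zero
      simp [this, ← hV0]
    rw [this]; simp
  · have hQ' : ∀ ω, HasSum (fun p : Fin n × J => w p.2 * ζ p ω ^ 2) (Q ω) := by
      intro ω
      have hsum : Summable fun p : Fin n × J => w p.2 * ζ p ω ^ 2 := by
        refine (summable_prod_of_nonneg fun p => mul_nonneg (hw _) (sq_nonneg _)).2
          ⟨fun l => ?_, (hasSum_fintype _).summable⟩
        refine (hQ ω).summable.of_nonneg_of_le (fun j => mul_nonneg (hw _) (sq_nonneg _)) fun j => ?_
        exact mul_le_mul_of_nonneg_left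
          (Finset.single_le_sum (f := fun l => ζ (l, j) ω ^ 2) (fun l _ => sq_nonneg _)
            (Finset.mem_univ l)) (hw j)
      have h1 := (Equiv.prodComm J (Fin n)).hasSum_iff.2 hsum.hasSum
      have h2 := h1.prod_fiberwise fun j => hasSum_fintype _
      simp only [Function.comp, Equiv.prodComm_apply, Prod.swap] at h2
      simp_rw [← Finset.mul_sum] at h2
      rw [(hQ ω).unique h2]
      exact hsum.hasSum
    -- No weight exceeds `V` and the whole array has weight at most `n * V`, so the ratio in the
    -- exponent is `n`.
    have h := measure_hasSum_weighted_sq_ge_le hζ.indep hζ.measurable hζ.sub hc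
      (w := fun p : Fin n × J => w p.2) (fun p => hw _) hV0 (fun p => le_hasSum hV p.2 fun j _ => hw j)
      (V := n * V) (fun s => ?_) hQ' (12 * c)
    · refine (measure_mono fun ω hω => ?_).trans (h.trans (ENNReal.ofReal_le_ofReal ?_))
      · simp only [Set.mem_ofPred_eq, not_le] at hω ⊢
        linarith
      · apply le_of_eq; congr 1; field_simp; norm_num
    · classical
      calc ∑ p ∈ s, w p.2 ≤ ∑ p ∈ Finset.univ ×ˢ s.image Prod.snd, w p.2 := by
            refine Finset.sum_le_sum_of_subset_of_nonneg (fun p hp => ?_) fun p _ _ => hw _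
            simp only [Finset.mem_product, Finset.mem_univ, true_and]
            exact Finset.mem_image_of_mem _ hp
        _ = ∑ l : Fin n, ∑ j ∈ s.image Prod.snd, w j := Finset.sum_product _ _ _
        _ ≤ ∑ l : Fin n, V := Finset.sum_le_sum fun l _ => sum_le_hasSum _ (fun j _ => hw j) hV
        _ = n * V := by simp

end IsStdSubgaussian

/-! ### Regularized Gram operators -/

section Gram

variable {E : Type*} [NormedAddCommGroup E] [InnerProductSpace ℝ E]

/-- A coercive symmetric operator in finite dimension has a symmetric inverse. -/
theorem exists_inverse_of_coercive [FiniteDimensional ℝ E] (A : E →ₗ[ℝ] E) (hA : A.IsSymmetric)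
    {m : ℝ} (hm : 0 < m) (hlow : ∀ u, m * ‖u‖ ^ 2 ≤ inner ℝ (A u) u) :
    ∃ R : E →ₗ[ℝ] E, (∀ u, A (R u) = u) ∧ (∀ u, R (A u) = u) ∧ R.IsSymmetric ∧
      (∀ u, ‖R u‖ ^ 2 ≤ ‖u‖ ^ 2 / m ^ 2) ∧ ∀ C, (∀ u, inner ℝ (A u) u ≤ C * ‖u‖ ^ 2) →
        ∀ u, ‖u‖ ^ 2 ≤ C * inner ℝ (R u) u := by
  have hinj : Function.Injective A := by
    rw [← LinearMap.ker_eq_bot, LinearMap.ker_eq_bot']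
    intro u hu
    have := hlow u
    rw [hu, inner_zero_left] at this
    have h2 : ‖u‖ ^ 2 ≤ 0 := by nlinarith [sq_nonneg ‖u‖]
    exact norm_eq_zero.1 (pow_eq_zero_iff two_ne_zero |>.1 (le_antisymm h2 (sq_nonneg _)))
  let e := LinearEquiv.ofInjectiveEndo A hinj
  have he : ∀ u, e u = A u := fun u => rfl
  have h1 : ∀ u, A (e.symm u) = u := fun u => by rw [← he, e.apply_symm_apply]
  have h2 : ∀ u, e.symm (A u) = u := fun u => by rw [← he, e.symm_apply_apply]
  have hpos : ∀ u, 0 ≤ inner ℝ (A u) u := fun u => le_trans (by positivity) (hlow u)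
  refine ⟨e.symm.toLinearMap, h1, h2, fun u v => ?_, fun u => ?_, fun C hup u => ?_⟩
  · change inner ℝ (e.symm u) v = inner ℝ u (e.symm v)
    conv_lhs => rw [← h1 v]
    conv_rhs => rw [← h1 u]
    exact (hA _ _).symm
  · change ‖e.symm u‖ ^ 2 ≤ _
    have h3 := hlow (e.symm u)
    rw [h1] at h3
    have h4 := real_inner_le_norm u (e.symm u)
    have h5 : m * ‖e.symm u‖ ≤ ‖u‖ := by
      rcases (norm_nonneg (e.symm u)).eq_or_lt with h0 | h0
      · rw [← h0]; simp
      · nlinarith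
    rw [le_div_iff₀ (by positivity), ← mul_pow, mul_comm]
    gcongr
  · change ‖u‖ ^ 2 ≤ C * inner ℝ (e.symm u) u
    set x := e.symm u with hx
    have hu : u = A x := (h1 u).symm
    rcases eq_or_ne u 0 with h0 | h0
    · rw [h0]; simp
    -- Cauchy-Schwarz for the form `A`
    have hcs : inner ℝ (A x) (A x) ^ 2 ≤ inner ℝ (A x) x * inner ℝ (A (A x)) (A x) := by
      have hq : ∀ t : ℝ, 0 ≤ inner ℝ (A x) x + t * (2 * inner ℝ (A x) (A x)) +
          t ^ 2 * inner ℝ (A (A x)) (A x) := fun t => by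
        have := hpos (x + t • A x)
        rw [map_add, map_smul, inner_add_left, inner_add_right, inner_add_right, inner_smul_left,
          inner_smul_left, inner_smul_right, inner_smul_right, hA (A x) x] at this
        simp only [conj_trivial] at this
        linarith
      have := discrim_le_zero (a := inner ℝ (A (A x)) (A x)) (b := 2 * inner ℝ (A x) (A x))
        (c := inner ℝ (A x) x) fun t => by linarith [hq t, sq t]
      rw [discrim] at this
      nlinarith
    have hC := hup (A x)
    rw [real_inner_self_eq_norm_sq] at hcs
    have hpos' : 0 < ‖u‖ ^ 2 := by positivity
    rw [hu] at hpos' ⊢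
    rw [real_inner_comm (A x) x]
    have := mul_le_mul_of_nonneg_left hC (hpos x)
    have h6 : ‖A x‖ ^ 2 * ‖A x‖ ^ 2 ≤ (C * inner ℝ (A x) x) * ‖A x‖ ^ 2 := by nlinarith
    exact le_of_mul_le_mul_right h6 hpos'

variable {n : ℕ}

/-- The linear combinations of a finite family of vectors. -/
def combMap (X : Fin n → E) : EuclideanSpace ℝ (Fin n) →ₗ[ℝ] E where
  toFun w := ∑ l, w l • X l
  map_add' u w := by simp [add_smul, Finset.sum_add_distrib]
  map_smul' c w := by simp [Finset.smul_sum, smul_smul]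

theorem combMap_apply (X : Fin n → E) (w : EuclideanSpace ℝ (Fin n)) :
    combMap X w = ∑ l, w l • X l := rfl

theorem inner_combMap (X : Fin n → E) (w : EuclideanSpace ℝ (Fin n)) (h : E) :
    inner ℝ h (combMap X w) = ∑ l, w l * inner ℝ h (X l) := by
  rw [combMap_apply, inner_sum]
  simp_rw [inner_smul_right]

/-- The regularized Gram operator. -/
def regGram (X : Fin n → E) (ρ : ℝ) : EuclideanSpace ℝ (Fin n) →ₗ[ℝ] EuclideanSpace ℝ (Fin n) where
  toFun w := WithLp.toLp 2 fun l => inner ℝ (X l) (combMap X w) + ρ * w l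
  map_add' u w := by ext l; simp [inner_add_right]; ring
  map_smul' c w := by ext l; simp [inner_smul_right]; ring

theorem regGram_apply (X : Fin n → E) (ρ : ℝ) (w : EuclideanSpace ℝ (Fin n)) (l : Fin n) :
    regGram X ρ w l = inner ℝ (X l) (combMap X w) + ρ * w l := rfl

theorem EuclideanSpace.real_inner_eq_sum {J : Type*} [Fintype J] (x y : EuclideanSpace ℝ J) :
    inner ℝ x y = ∑ j, x j * y j := by
  rw [PiLp.inner_apply]
  exact Finset.sum_congr rfl fun j _ => by simp [mul_comm]

theorem inner_regGram (X : Fin n → E) (ρ : ℝ) (u w : EuclideanSpace ℝ (Fin n)) :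
    inner ℝ (regGram X ρ u) w = inner ℝ (combMap X u) (combMap X w) + ρ * inner ℝ u w := by
  rw [EuclideanSpace.real_inner_eq_sum, EuclideanSpace.real_inner_eq_sum, inner_combMap,
    Finset.mul_sum, ← Finset.sum_add_distrib]
  refine Finset.sum_congr rfl fun l _ => ?_
  rw [regGram_apply, real_inner_comm]; ring

theorem regGram_isSymmetric (X : Fin n → E) (ρ : ℝ) : (regGram X ρ).IsSymmetric := fun u w => by
  rw [inner_regGram, real_inner_comm (regGram X ρ w) u, inner_regGram,
    real_inner_comm (combMap X u) (combMap X w), real_inner_comm u w]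

theorem inner_regGram_self (X : Fin n → E) (ρ : ℝ) (u : EuclideanSpace ℝ (Fin n)) :
    inner ℝ (regGram X ρ u) u = ‖combMap X u‖ ^ 2 + ρ * ‖u‖ ^ 2 := by
  rw [inner_regGram, real_inner_self_eq_norm_sq, real_inner_self_eq_norm_sq]

/-- The ridge estimator, if the regularized Gram operator is invertible. -/
theorem ridge_eq (lam : ℝ) (X : Fin n → E) (y : Fin n → ℝ)
    (R : EuclideanSpace ℝ (Fin n) →ₗ[ℝ] EuclideanSpace ℝ (Fin n))
    (hR : ∀ u, R (regGram X (n * lam) u) = u) :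
    ridge lam X y = combMap X (R (WithLp.toLp 2 y)) := by
  unfold ridge
  set hG := ((Matrix.isHermitian_gram (𝕜 := ℝ) X).add (by simp [Matrix.IsHermitian] :
    (((n : ℝ) * lam) • (1 : Matrix (Fin n) (Fin n) ℝ)).IsHermitian)) with hGdef
  obtain ⟨hP, -⟩ := symPinv_penrose _ hG
  set G := Matrix.gram ℝ X + ((n : ℝ) * lam) • (1 : Matrix (Fin n) (Fin n) ℝ) with hGd
  set P := symPinv G hG with hPd
  have hmul : ∀ u : Fin n → ℝ, WithLp.toLp 2 (G.mulVec u) =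
      regGram X (n * lam) (WithLp.toLp 2 u) := by
    intro u
    ext l
    rw [regGram_apply, inner_combMap]
    rw [hGd, Matrix.add_mulVec, Matrix.smul_mulVec, Matrix.one_mulVec]
    simp [Matrix.mulVec, dotProduct, Matrix.gram_apply, mul_comm]
  have hinj : ∀ u w : Fin n → ℝ, G.mulVec u = G.mulVec w → u = w := by
    intro u w h
    have h1 := congrArg (fun z => R (WithLp.toLp 2 z)) h
    simp only [hmul, hR] at h1
    exact (WithLp.toLp_injective 2) h1
  -- Cancelling the injective `G` in the Penrose equation `G * P * G = G` shows that the
  -- pseudoinverse is an inverse here.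
  have hPG : P * G = 1 := by
    apply Matrix.ext_of_mulVec_single
    intro i
    apply hinj
    rw [Matrix.mulVec_mulVec, ← Matrix.mul_assoc, hP, Matrix.one_mulVec]
  have hGP : G * P = 1 := mul_eq_one_comm.1 hPG
  have hw : R (WithLp.toLp 2 y) = WithLp.toLp 2 (P.mulVec y) := by
    rw [← hR (WithLp.toLp 2 (P.mulVec y)), ← hmul, Matrix.mulVec_mulVec, hGP, Matrix.one_mulVec]
  rw [hw, combMap_apply]

end Gram

/-! ### Head and tail of the data matrix -/

namespace LinearModel

variable {H : Type*} [NormedAddCommGroup H] [InnerProductSpace ℝ H] [MeasurableSpace H]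
  {σx : ℝ≥0} (M : LinearModel H σx)

/-- The orthogonal projection away from finitely many eigenvectors. -/
def tailProj (F : Finset (CoordIdx M.p)) : H →ₗ[ℝ] H where
  toFun h := h - ∑ j ∈ F, (inner ℝ (M.v j) h : ℝ) • M.v j
  map_add' a b := by
    simp only [inner_add_right, add_smul, Finset.sum_add_distrib]; abel
  map_smul' c a := by
    simp [inner_smul_right, smul_sub, Finset.smul_sum, smul_smul]

theorem inner_v_v (i j : CoordIdx M.p) : inner ℝ (M.v i) (M.v j) = if i = j then (1 : ℝ) else 0 :=
  orthonormal_iff_ite.1 M.v.orthonormal i j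

theorem inner_v_tailProj (F : Finset (CoordIdx M.p)) (j : CoordIdx M.p) (h : H) :
    inner ℝ (M.v j) (M.tailProj F h) = if j ∈ F then 0 else inner ℝ (M.v j) h := by
  change inner ℝ (M.v j) (h - ∑ i ∈ F, (inner ℝ (M.v i) h : ℝ) • M.v i) = _
  rw [inner_sub_right, inner_sum]
  simp_rw [inner_smul_right, inner_v_v]
  simp only [mul_ite, mul_one, mul_zero, Finset.sum_ite_eq]
  split_ifs <;> simp

theorem hasSum_norm_sq (h : H) : HasSum (fun j => inner ℝ (M.v j) h ^ 2) (‖h‖ ^ 2) := by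
  have := M.v.hasSum_inner_mul_inner h h
  rw [real_inner_self_eq_norm_sq] at this
  refine this.congr_fun ?_ |> fun h => h
  intro j
  rw [real_inner_comm, sq]

theorem hasSum_inner (g h : H) :
    HasSum (fun j => inner ℝ (M.v j) g * inner ℝ (M.v j) h) (inner ℝ g h) := by
  have := M.v.hasSum_inner_mul_inner g h
  simpa only [real_inner_comm] using this

theorem hasSum_norm_sq_tailProj (F : Finset (CoordIdx M.p)) (h : H) :
    HasSum (fun j => if j ∈ F then 0 else inner ℝ (M.v j) h ^ 2) (‖M.tailProj F h‖ ^ 2) := by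
  have := M.hasSum_norm_sq (M.tailProj F h)
  simp_rw [inner_v_tailProj, ite_pow] at this
  simpa using this

/-- The whitened values of the `j`-th component over the sample. -/
def col {n : ℕ} (X : Fin n → H) (j : CoordIdx M.p) : EuclideanSpace ℝ (Fin n) :=
  WithLp.toLp 2 fun l => M.feature j (X l)

theorem inner_v_combMap {n : ℕ} (X : Fin n → H) (j : CoordIdx M.p)
    (w : EuclideanSpace ℝ (Fin n)) :
    inner ℝ (M.v j) (combMap X w) = √(M.eig j) * inner ℝ (M.col X j) w := by
  rw [inner_combMap, EuclideanSpace.real_inner_eq_sum, Finset.mul_sum]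
  refine Finset.sum_congr rfl fun l _ => ?_
  rw [inner_eq_sqrt_mul_feature, col]; ring

theorem norm_col_sq {n : ℕ} (X : Fin n → H) (j : CoordIdx M.p) :
    ‖M.col X j‖ ^ 2 = ∑ l, M.feature j (X l) ^ 2 := EuclideanSpace.real_norm_sq_eq _

/-- The linear combinations of finitely many columns. -/
def headMap {n : ℕ} (F : Finset (CoordIdx M.p)) (X : Fin n → H) :
    EuclideanSpace ℝ F →ₗ[ℝ] EuclideanSpace ℝ (Fin n) where
  toFun a := ∑ j, a j • M.col X j
  map_add' u w := by simp [add_smul, Finset.sum_add_distrib]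
  map_smul' c w := by simp [Finset.smul_sum, smul_smul]

theorem headMap_apply {n : ℕ} (F : Finset (CoordIdx M.p)) (X : Fin n → H)
    (a : EuclideanSpace ℝ F) : M.headMap F X a = ∑ j, a j • M.col X j := rfl

theorem headMap_apply_apply {n : ℕ} (F : Finset (CoordIdx M.p)) (X : Fin n → H)
    (a : EuclideanSpace ℝ F) (l : Fin n) :
    M.headMap F X a l = ∑ j : F, a j * M.feature j (X l) := by
  rw [headMap_apply]
  simp [col]

theorem headMap_single {n : ℕ} (F : Finset (CoordIdx M.p)) (X : Fin n → H) (j : F) :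
    M.headMap F X (EuclideanSpace.single j 1) = M.col X j := by
  classical
  rw [headMap_apply, Finset.sum_eq_single j]
  · simp
  · intro i _ hij; simp [hij]
  · simp

theorem inner_headMap {n : ℕ} (F : Finset (CoordIdx M.p)) (X : Fin n → H)
    (a : EuclideanSpace ℝ F) (w : EuclideanSpace ℝ (Fin n)) :
    inner ℝ (M.headMap F X a) w = ∑ j : F, a j * inner ℝ (M.col X j) w := by
  rw [headMap_apply, sum_inner]
  simp_rw [real_inner_smul_left]

theorem tailProj_combMap {n : ℕ} (F : Finset (CoordIdx M.p)) (X : Fin n → H)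
    (w : EuclideanSpace ℝ (Fin n)) :
    M.tailProj F (combMap X w) = combMap (fun l => M.tailProj F (X l)) w := by
  simp [combMap_apply]

theorem hasSum_tailProj_combMap {n : ℕ} (F : Finset (CoordIdx M.p)) (X : Fin n → H)
    (w : EuclideanSpace ℝ (Fin n)) :
    HasSum (fun j => (if j ∈ F then 0 else M.eig j) * inner ℝ (M.col X j) w ^ 2)
      (‖M.tailProj F (combMap X w)‖ ^ 2) := by
  have := M.hasSum_norm_sq_tailProj F (combMap X w)
  simp_rw [inner_v_combMap, mul_pow, Real.sq_sqrt (M.eig_coe_pos _).le] at this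
  simpa only [ite_mul, zero_mul] using this

end LinearModel

/-! ### The error of the ridge estimator on a well-conditioned sample -/

section LinearAlgebra

variable {E E' : Type*} [NormedAddCommGroup E] [InnerProductSpace ℝ E]
  [NormedAddCommGroup E'] [InnerProductSpace ℝ E']

/-- Apply Cauchy–Schwarz to `‖Zt u‖ ^ 2 = ⟪Z (Zt u), u⟫` and cancel one factor `‖Zt u‖ ^ 2` after
squaring. -/
theorem norm_sq_adjoint_le {Z : E' →ₗ[ℝ] E} {Zt : E → E'}
    (hZt : ∀ x u, inner ℝ (Z x) u = inner ℝ x (Zt u)) {B : ℝ} (hB : 0 ≤ B)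
    (hZ : ∀ x, ‖Z x‖ ^ 2 ≤ B * ‖x‖ ^ 2) (u : E) : ‖Zt u‖ ^ 2 ≤ B * ‖u‖ ^ 2 := by
  have h1 : ‖Zt u‖ ^ 2 = inner ℝ (Z (Zt u)) u := by rw [hZt, real_inner_self_eq_norm_sq]
  have h2 := real_inner_le_norm (Z (Zt u)) u
  rw [← h1] at h2
  have h3 : (‖Zt u‖ ^ 2) ^ 2 ≤ (B * ‖u‖ ^ 2) * ‖Zt u‖ ^ 2 := by
    calc (‖Zt u‖ ^ 2) ^ 2 ≤ (‖Z (Zt u)‖ * ‖u‖) ^ 2 := by gcongr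
      _ = ‖Z (Zt u)‖ ^ 2 * ‖u‖ ^ 2 := mul_pow _ _ _
      _ ≤ (B * ‖Zt u‖ ^ 2) * ‖u‖ ^ 2 := by gcongr; exact hZ _
      _ = _ := by ring
  rcases (sq_nonneg ‖Zt u‖).eq_or_lt with h0 | h0
  · rw [← h0]; positivity
  · rw [sq (‖Zt u‖ ^ 2)] at h3
    exact le_of_mul_le_mul_right h3 h0

/-- The error in the leading components, from the normal equations with the trailing components
eliminated. -/
theorem norm_head_error_le {Z : E' →ₗ[ℝ] E} {Zt : E → E'}
    (hZt : ∀ x u, inner ℝ (Z x) u = inner ℝ x (Zt u)) {α C : ℝ} (hα : 0 < α) (hC : 0 ≤ C)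
    (hZ : ∀ x, α * ‖x‖ ^ 2 ≤ ‖Z x‖ ^ 2) {A R : E →ₗ[ℝ] E} (hRA : ∀ u, R (A u) = u)
    (hR : R.IsSymmetric) (hRC : ∀ u, ‖u‖ ^ 2 ≤ C * inner ℝ (R u) u) {δ g : E'} {w r : E}
    (heq : Z δ + A w = r) (hg : inner ℝ δ g ≤ inner ℝ (Z δ) w) :
    ‖δ‖ ≤ C / α * (‖Zt (R r)‖ + ‖g‖) := by
  -- `R` removes `A` from `Z δ = r - A w`. Paired with `Z δ`, the unknown `w` remains only in a term
  -- that `hg` bounds from below.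
  have h1 : inner ℝ (R (Z δ)) (Z δ) = inner ℝ δ (Zt (R r)) - inner ℝ (Z δ) w := by
    have h2 : Z δ = r - A w := by rw [← heq]; abel
    calc inner ℝ (R (Z δ)) (Z δ) = inner ℝ (Z δ) (R (r - A w)) := by rw [hR, ← h2]
      _ = _ := by rw [map_sub, hRA, inner_sub_right, hZt δ (R r)]
  have h3 := real_inner_le_norm δ (Zt (R r))
  have h4 := abs_le.1 (abs_real_inner_le_norm δ g)
  have h5 : α * ‖δ‖ ^ 2 ≤ C * (‖δ‖ * (‖Zt (R r)‖ + ‖g‖)) := by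
    refine (hZ δ).trans ((hRC _).trans (mul_le_mul_of_nonneg_left ?_ hC))
    rw [h1]; linarith [h4.1]
  rcases (norm_nonneg δ).eq_or_lt with h0 | h0
  · rw [← h0]; positivity
  · rw [div_mul_eq_mul_div, le_div_iff₀ hα]
    nlinarith

theorem hasSum_ite_mem_finset {J : Type*} [DecidableEq J] (F : Finset J) (f : J → ℝ) :
    HasSum (fun j => if j ∈ F then f j else 0) (∑ j ∈ F, f j) := by
  have h := hasSum_sum_of_ne_finset_zero (s := F) (f := fun j => if j ∈ F then f j else 0)
    (L := SummationFilter.unconditional J) fun j hj => by simp [hj]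
  rwa [Finset.sum_congr rfl fun j hj => if_pos hj] at h

end LinearAlgebra

/-! ### Error decomposition on a sample with good head and tail -/

namespace LinearModel

variable {H : Type*} [NormedAddCommGroup H] [InnerProductSpace ℝ H] [MeasurableSpace H]
  {σx : ℝ≥0} (M : LinearModel H σx)

/-- The quadratic form of the second moment matrix on the trailing components. -/
def tailCov (F : Finset (CoordIdx M.p)) (h : H) : ℝ :=
  ∑' j, (if j ∈ F then 0 else M.eig j) * inner ℝ (M.v j) h ^ 2

theorem eig_le_zero_idx (j : ℕ) : M.eig j ≤ M.eig 0 := M.eig_antitone (Nat.zero_le j)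

theorem tailEig_nonneg (F : Finset (CoordIdx M.p)) (j : CoordIdx M.p) :
    0 ≤ if j ∈ F then 0 else M.eig j := by
  split_ifs
  exacts [le_rfl, (M.eig_coe_pos j).le]

theorem summable_tailCov (F : Finset (CoordIdx M.p)) (h : H) :
    Summable fun j => (if j ∈ F then 0 else M.eig j) * inner ℝ (M.v j) h ^ 2 := by
  refine ((M.hasSum_norm_sq h).summable.mul_left (M.eig 0)).of_nonneg_of_le
    (fun j => mul_nonneg (M.tailEig_nonneg F j) (sq_nonneg _)) fun j => ?_
  gcongr
  split_ifs
  · exact (M.eig_coe_pos j).le.trans (M.eig_le_zero_idx j)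
  · exact M.eig_le_zero_idx j

theorem tailCov_nonneg (F : Finset (CoordIdx M.p)) (h : H) : 0 ≤ M.tailCov F h :=
  tsum_nonneg fun j => mul_nonneg (M.tailEig_nonneg F j) (sq_nonneg _)

theorem tailCov_le (F : Finset (CoordIdx M.p)) {W : ℝ} (hW : ∀ j ∉ F, M.eig j ≤ W) (h : H) :
    M.tailCov F h ≤ W * ‖M.tailProj F h‖ ^ 2 := by
  have h1 := M.hasSum_norm_sq_tailProj F h
  rw [← h1.tsum_eq, ← tsum_mul_left]
  refine (M.summable_tailCov F h).tsum_le_tsum (fun j => ?_) (h1.summable.mul_left W)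
  split_ifs with hj
  · simp
  · gcongr; exact hW j hj

theorem tailCov_sub_le (F : Finset (CoordIdx M.p)) (g h : H) :
    M.tailCov F (g - h) ≤ 2 * M.tailCov F g + 2 * M.tailCov F h := by
  have hg := (M.summable_tailCov F g).mul_left 2
  have hh := (M.summable_tailCov F h).mul_left 2
  unfold tailCov
  rw [← tsum_mul_left, ← tsum_mul_left, ← hg.tsum_add hh]
  refine (M.summable_tailCov F _).tsum_le_tsum (fun j => ?_) (hg.add hh)
  rw [inner_sub_right]
  have := M.tailEig_nonneg F j
  nlinarith [mul_nonneg this (sq_nonneg (inner ℝ (M.v j) g + inner ℝ (M.v j) h))]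

theorem tailCov_add_sub_le (F : Finset (CoordIdx M.p)) (f g h : H) :
    M.tailCov F (f + g - h) ≤ 3 * M.tailCov F f + 3 * M.tailCov F g + 3 * M.tailCov F h := by
  have hf := (M.summable_tailCov F f).mul_left 3
  have hg := (M.summable_tailCov F g).mul_left 3
  have hh := (M.summable_tailCov F h).mul_left 3
  unfold tailCov
  rw [← tsum_mul_left, ← tsum_mul_left, ← tsum_mul_left, ← hf.tsum_add hg,
    ← (hf.add hg).tsum_add hh]
  refine (M.summable_tailCov F _).tsum_le_tsum (fun j => ?_) ((hf.add hg).add hh)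
  rw [inner_sub_right, inner_add_right]
  have h0 := M.tailEig_nonneg F j
  set x : ℝ := inner ℝ (M.v j) f
  set y : ℝ := inner ℝ (M.v j) g
  set z : ℝ := inner ℝ (M.v j) h
  rw [mul_left_comm 3, mul_left_comm 3, mul_left_comm 3, ← mul_add, ← mul_add]
  gcongr
  nlinarith [sq_nonneg (x - y), sq_nonneg (x + z), sq_nonneg (y + z)]

theorem hasSum_cov (F : Finset (CoordIdx M.p)) (h : H) :
    HasSum (fun j : CoordIdx M.p => M.eig j * inner ℝ (M.v j) h ^ 2)
      (∑ j ∈ F, M.eig j * inner ℝ (M.v j) h ^ 2 + M.tailCov F h) := by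
  have h1 : HasSum (fun j => if j ∈ F then M.eig j * inner ℝ (M.v j) h ^ 2 else 0)
      (∑ j ∈ F, M.eig j * inner ℝ (M.v j) h ^ 2) := hasSum_ite_mem_finset F _
  refine (h1.add (M.summable_tailCov F h).hasSum).congr_fun ?_ |> fun h => h
  intro j
  split_ifs <;> simp

theorem norm_tailProj_le (F : Finset (CoordIdx M.p)) (h : H) : ‖M.tailProj F h‖ ^ 2 ≤ ‖h‖ ^ 2 := by
  refine hasSum_le (fun j => ?_) (M.hasSum_norm_sq_tailProj F h) (M.hasSum_norm_sq h)
  split_ifs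
  exacts [sq_nonneg _, le_rfl]

/-- A sample whose trailing components form a well-conditioned Gram matrix of size `S`. -/
structure TailBounds {n : ℕ} (F : Finset (CoordIdx M.p)) (X : Fin n → H) (S c₁ C₁ : ℝ) : Prop where
  low : ∀ u, c₁ * S * ‖u‖ ^ 2 ≤ ‖M.tailProj F (combMap X u)‖ ^ 2
  up : ∀ u, ‖M.tailProj F (combMap X u)‖ ^ 2 ≤ C₁ * S * ‖u‖ ^ 2

/-- A sample whose components in `F` are nearly orthogonal. -/
structure HeadBounds {n : ℕ} (F : Finset (CoordIdx M.p)) (X : Fin n → H) (a A : ℝ) : Prop where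
  low : ∀ x, a * n * ‖x‖ ^ 2 ≤ ‖M.headMap F X x‖ ^ 2
  up : ∀ x, ‖M.headMap F X x‖ ^ 2 ≤ A * n * ‖x‖ ^ 2

variable {M} {n : ℕ} {F : Finset (CoordIdx M.p)} {X : Fin n → H} {S c₁ C₁ ρ : ℝ}

/-- A shift by `ρ` between `0` and `S` keeps the tail Gram operator between `c₁ * S` and `(C₁ + 1) *
S`, so the bounds on its inverse do not depend on the ridge parameter. -/
theorem TailBounds.exists_inverse (hT : M.TailBounds F X S c₁ C₁) (hS : 0 < S) (hc₁ : 0 < c₁)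
    (hρ : 0 ≤ ρ) (hρS : ρ ≤ S) :
    ∃ R : EuclideanSpace ℝ (Fin n) →ₗ[ℝ] EuclideanSpace ℝ (Fin n),
      (∀ u, R (regGram (fun l => M.tailProj F (X l)) ρ u) = u) ∧ R.IsSymmetric ∧
      (∀ u, ‖R u‖ ^ 2 ≤ ‖u‖ ^ 2 / (c₁ * S) ^ 2) ∧
      ∀ u, ‖u‖ ^ 2 ≤ ((C₁ + 1) * S) * inner ℝ (R u) u := by
  obtain ⟨R, -, h2, h3, h4, h5⟩ := exists_inverse_of_coercive
    (regGram (fun l => M.tailProj F (X l)) ρ) (regGram_isSymmetric _ _) (m := c₁ * S)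
    (by positivity) (fun u => by
      rw [inner_regGram_self, ← tailProj_combMap]
      have := hT.low u
      have : 0 ≤ ρ * ‖u‖ ^ 2 := by positivity
      linarith)
  refine ⟨R, h2, h3, h4, h5 _ fun u => ?_⟩
  rw [inner_regGram_self, ← tailProj_combMap]
  have h6 := hT.up u
  have h7 : ρ * ‖u‖ ^ 2 ≤ S * ‖u‖ ^ 2 := by gcongr
  linarith

/-- The head only adds a nonnegative form, so the coercivity of the tail carries over, even without
regularization. -/
theorem TailBounds.exists_full_inverse (hT : M.TailBounds F X S c₁ C₁) (hS : 0 < S) (hc₁ : 0 < c₁)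
    (hρ : 0 ≤ ρ) :
    ∃ R : EuclideanSpace ℝ (Fin n) →ₗ[ℝ] EuclideanSpace ℝ (Fin n),
      (∀ u, regGram X ρ (R u) = u) ∧ (∀ u, R (regGram X ρ u) = u) ∧ R.IsSymmetric := by
  obtain ⟨R, h1, h2, h3, -⟩ := exists_inverse_of_coercive
    (regGram X ρ) (regGram_isSymmetric _ _) (m := c₁ * S) (by positivity) (fun u => by
      rw [inner_regGram_self]
      have := hT.low u
      have := M.norm_tailProj_le F (combMap X u)
      have : 0 ≤ ρ * ‖u‖ ^ 2 := by positivity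
      linarith)
  exact ⟨R, h1, h2, h3⟩

theorem inner_eq_sum_head_add_tail (F : Finset (CoordIdx M.p)) (x d : H) :
    inner ℝ x d = ∑ j : F, (√(M.eig j) * inner ℝ (M.v j) d) * M.feature j x +
      inner ℝ (M.tailProj F x) (M.tailProj F d) := by
  have h1 := M.hasSum_inner (M.tailProj F x) (M.tailProj F d)
  simp_rw [inner_v_tailProj] at h1
  have h2 : HasSum (fun j => if j ∈ F then inner ℝ (M.v j) x * inner ℝ (M.v j) d else (0 : ℝ))
      (∑ j ∈ F, inner ℝ (M.v j) x * inner ℝ (M.v j) d) := hasSum_ite_mem_finset F _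
  have h3 := h2.add h1
  rw [(M.hasSum_inner x d).unique (h3.congr_fun fun j => by split_ifs <;> simp)]
  congr 1
  rw [← Finset.sum_coe_sort F]
  refine Finset.sum_congr rfl fun j _ => ?_
  rw [M.inner_eq_sqrt_mul_feature j x]; ring

/-- The transpose of `headMap`. -/
def headMapT (M : LinearModel H σx) {n : ℕ} (F : Finset (CoordIdx M.p)) (X : Fin n → H)
    (u : EuclideanSpace ℝ (Fin n)) : EuclideanSpace ℝ F :=
  WithLp.toLp 2 fun j => inner ℝ (M.col X j) u

theorem inner_headMap_eq (F : Finset (CoordIdx M.p)) (X : Fin n → H) (x : EuclideanSpace ℝ F)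
    (u : EuclideanSpace ℝ (Fin n)) :
    inner ℝ (M.headMap F X x) u = inner ℝ x (M.headMapT F X u) := by
  rw [inner_headMap, EuclideanSpace.real_inner_eq_sum]; rfl

theorem norm_headMapT_sq (F : Finset (CoordIdx M.p)) (X : Fin n → H)
    (u : EuclideanSpace ℝ (Fin n)) :
    ‖M.headMapT F X u‖ ^ 2 = ∑ j ∈ F, inner ℝ (M.col X j) u ^ 2 := by
  rw [EuclideanSpace.real_norm_sq_eq, ← Finset.sum_coe_sort F]; rfl

theorem headMapT_add (F : Finset (CoordIdx M.p)) (X : Fin n → H)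
    (u w : EuclideanSpace ℝ (Fin n)) :
    M.headMapT F X (u + w) = M.headMapT F X u + M.headMapT F X w := by
  ext j; simp [headMapT, inner_add_right]

/-- The error of the ridge estimator, bounded by the parts of the parameter and of the noise. -/
theorem cov_error_le (hT : M.TailBounds F X S c₁ C₁) {a A β lam : ℝ} (hH : M.HeadBounds F X a A)
    (hn : 0 < n) (hS : 0 < S) (hc₁ : 0 < c₁) (hC₁ : 0 < C₁) (ha : 0 < a) (hA : 0 < A) (hβ : 0 < β)
    (hW : ∀ j ∉ F, M.eig j ≤ β * S / n) (hlam : 0 ≤ lam)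
    {R : EuclideanSpace ℝ (Fin n) →ₗ[ℝ] EuclideanSpace ℝ (Fin n)}
    (hRA : ∀ u, R (regGram (fun l => M.tailProj F (X l)) (n * lam) u) = u) (hR : R.IsSymmetric)
    (hRn : ∀ u, ‖R u‖ ^ 2 ≤ ‖u‖ ^ 2 / (c₁ * S) ^ 2)
    (hRC : ∀ u, ‖u‖ ^ 2 ≤ ((C₁ + 1) * S) * inner ℝ (R u) u) (θ : H) (e : Fin n → ℝ) {κ B : ℝ}
    (hκ : κ = 1 + 6 * β * C₁ * A / c₁ ^ 2) (hB : B = 3 * κ * (C₁ + 1) ^ 2 / a ^ 2) :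
    ∑' j : CoordIdx M.p, M.eig j * inner ℝ (M.v j) (ridgeEstimator lam X θ e - θ) ^ 2 ≤
      2 * M.tailCov F θ + B * (S / n) ^ 2 * ∑ j ∈ F, inner ℝ (M.v j) θ ^ 2 / M.eig j +
      (B * A / c₁ ^ 2 + 6 * β * C₁ / c₁ ^ 2) / n * ∑ l, inner ℝ (X l) (M.tailProj F θ) ^ 2 +
      B * (S / n) ^ 2 * ∑ j ∈ F, inner ℝ (M.col X j) (R (WithLp.toLp 2 e)) ^ 2 +
      6 * M.tailCov F (combMap X (R (WithLp.toLp 2 e))) := by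
  have hn' : (0 : ℝ) < n := by exact_mod_cast hn
  obtain ⟨Q, hQ1, hQ2, -⟩ := hT.exists_full_inverse (ρ := n * lam) hS hc₁ (by positivity)
  set y : Fin n → ℝ := fun i => inner ℝ (X i) θ + e i with hy
  set w := Q (WithLp.toLp 2 y) with hw
  have hθ' : ridgeEstimator lam X θ e = combMap X w := ridge_eq lam X y Q hQ2
  rw [hθ']
  set h := combMap X w with hh
  set d := h - θ with hd
  have hGw : ∀ l, inner ℝ (X l) h + n * lam * w l = inner ℝ (X l) θ + e l := fun l => by
    have := congrArg (fun z : EuclideanSpace ℝ (Fin n) => z l) (hQ1 (WithLp.toLp 2 y))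
    simpa [regGram_apply] using this
  set δ : EuclideanSpace ℝ F := WithLp.toLp 2 fun j => √(M.eig j) * inner ℝ (M.v j) d with hδ
  set g : EuclideanSpace ℝ F := WithLp.toLp 2 fun j => inner ℝ (M.v j) θ / √(M.eig j) with hg
  set r : EuclideanSpace ℝ (Fin n) := WithLp.toLp 2 fun l => inner ℝ (X l) (M.tailProj F θ) with hr
  set ev : EuclideanSpace ℝ (Fin n) := WithLp.toLp 2 e with hev
  set At := regGram (fun l => M.tailProj F (X l)) (n * lam) with hAt
  have htail : ∀ l (z : H), inner ℝ (X l) (M.tailProj F z) =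
      inner ℝ (M.tailProj F (X l)) (M.tailProj F z) := fun l z => by
    rw [inner_eq_sum_head_add_tail F (X l)]
    have h1 : ∀ j : F, inner ℝ (M.v j) (M.tailProj F z) = (0 : ℝ) := fun j => by
      rw [inner_v_tailProj, if_pos j.2]
    have h2 : M.tailProj F (M.tailProj F z) = M.tailProj F z := by
      change M.tailProj F z - ∑ j ∈ F, (inner ℝ (M.v j) (M.tailProj F z) : ℝ) • M.v j = _
      rw [Finset.sum_eq_zero fun j hj => by rw [inner_v_tailProj, if_pos hj, zero_smul], sub_zero]
    rw [h2]
    simp [h1]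
  -- The equations `⟪X l, d⟫ + n * lam * w l = e l`, with the error `d` split into head and tail.
  -- The tail of the estimator goes into `At w`, the tail of the parameter into `r`.
  have heq : M.headMap F X δ + At w = r + ev := by
    ext l
    have h1 := inner_eq_sum_head_add_tail F (X l) d
    have h2 : inner ℝ (X l) d = inner ℝ (X l) h - inner ℝ (X l) θ := inner_sub_right _ _ _
    have h3 := hGw l
    have h4 : M.tailProj F d = M.tailProj F h - M.tailProj F θ := map_sub _ _ _
    rw [h2, h4, inner_sub_right, ← htail l θ, hh, tailProj_combMap] at h1
    simp only [PiLp.add_apply, headMap_apply_apply, hAt, regGram_apply, hr, hev, hδ]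
    rw [← hh] at h1
    linarith
  -- Since `√(eig j) * ⟪col j, w⟫` is the coordinate of the estimator, hence that of `θ` plus that
  -- of `d`, the right side exceeds the left by the sum of the squared head coordinates of `d`.
  have hginner : inner ℝ δ g ≤ inner ℝ (M.headMap F X δ) w := by
    rw [inner_headMap_eq, EuclideanSpace.real_inner_eq_sum, EuclideanSpace.real_inner_eq_sum]
    refine Finset.sum_le_sum fun j _ => ?_
    have hpos := M.eig_coe_pos j
    have hspos := Real.sqrt_pos.2 hpos
    have h1 : inner ℝ (M.v j) h = √(M.eig j) * inner ℝ (M.col X j) w := M.inner_v_combMap X j w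
    have h2 : inner ℝ (M.v j) d = inner ℝ (M.v j) h - inner ℝ (M.v j) θ := inner_sub_right _ _ _
    have h3 : inner ℝ (M.col X j) w =
        inner ℝ (M.v j) θ / √(M.eig j) + inner ℝ (M.v j) d / √(M.eig j) := by
      rw [h2, h1]; field_simp; ring
    simp only [hδ, hg, headMapT, h3, mul_add]
    have : 0 ≤ √(M.eig j) * inner ℝ (M.v j) d * (inner ℝ (M.v j) d / √(M.eig j)) := by
      have : √(M.eig j) * inner ℝ (M.v j) d * (inner ℝ (M.v j) d / √(M.eig j)) =
          inner ℝ (M.v j) d ^ 2 := by field_simp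
      rw [this]; positivity
    linarith
  have hδ1 := norm_head_error_le (inner_headMap_eq F X) (α := a * n) (C := (C₁ + 1) * S)
    (by positivity) (by positivity) hH.low hRA hR hRC heq hginner
  have hZt := norm_sq_adjoint_le (inner_headMap_eq F X) (B := A * n) (by positivity) hH.up
  have hRr : ‖M.headMapT F X (R r)‖ ^ 2 ≤ A * n * (‖r‖ ^ 2 / (c₁ * S) ^ 2) :=
    (hZt _).trans (by gcongr; exact hRn r)
  set q := ‖M.headMapT F X (R ev)‖ ^ 2 with hq
  have hδ2 : ‖δ‖ ^ 2 ≤ 3 * ((C₁ + 1) * S / (a * n)) ^ 2 *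
      (A * n * (‖r‖ ^ 2 / (c₁ * S) ^ 2) + q + ‖g‖ ^ 2) := by
    rw [map_add, headMapT_add] at hδ1
    have h1 : ‖δ‖ ≤ (C₁ + 1) * S / (a * n) *
        (‖M.headMapT F X (R r)‖ + ‖M.headMapT F X (R ev)‖ + ‖g‖) :=
      hδ1.trans (by gcongr; exact norm_add_le _ _)
    set x1 := ‖M.headMapT F X (R r)‖
    set x2 := ‖M.headMapT F X (R ev)‖
    calc ‖δ‖ ^ 2 ≤ ((C₁ + 1) * S / (a * n) * (x1 + x2 + ‖g‖)) ^ 2 := by gcongr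
      _ = ((C₁ + 1) * S / (a * n)) ^ 2 * (x1 + x2 + ‖g‖) ^ 2 := mul_pow _ _ _
      _ ≤ ((C₁ + 1) * S / (a * n)) ^ 2 * (3 * (x1 ^ 2 + x2 ^ 2 + ‖g‖ ^ 2)) := by
          gcongr
          nlinarith [sq_nonneg (x1 - x2), sq_nonneg (x1 - ‖g‖), sq_nonneg (x2 - ‖g‖)]
      _ ≤ ((C₁ + 1) * S / (a * n)) ^ 2 *
          (3 * (A * n * (‖r‖ ^ 2 / (c₁ * S) ^ 2) + q + ‖g‖ ^ 2)) := by gcongr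
      _ = _ := by ring
  -- The head error determines `w`, and `w` determines the tail of the estimator.
  have hwR : w = R r + R ev - R (M.headMap F X δ) := by
    rw [← map_add, ← heq, map_add, hRA]; abel
  have hcovR : ∀ u, M.tailCov F (combMap X (R u)) ≤
      β * C₁ / (c₁ ^ 2 * n) * ‖u‖ ^ 2 := fun u => by
    calc M.tailCov F (combMap X (R u)) ≤ β * S / n * ‖M.tailProj F (combMap X (R u))‖ ^ 2 :=
          M.tailCov_le F hW _
      _ ≤ β * S / n * (C₁ * S * (‖u‖ ^ 2 / (c₁ * S) ^ 2)) := by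
          gcongr
          exact (hT.up _).trans (by gcongr; exact hRn u)
      _ = _ := by field_simp
  have hcovh : M.tailCov F h ≤ 3 * (β * C₁ / (c₁ ^ 2 * n) * ‖r‖ ^ 2) +
      3 * M.tailCov F (combMap X (R ev)) + 3 * (β * C₁ / (c₁ ^ 2 * n) * (A * n * ‖δ‖ ^ 2)) := by
    rw [hh, hwR, map_sub, map_add]
    refine (M.tailCov_add_sub_le F _ _ _).trans ?_
    have h1 := hcovR r
    have h2 : M.tailCov F (combMap X (R (M.headMap F X δ))) ≤
        β * C₁ / (c₁ ^ 2 * n) * (A * n * ‖δ‖ ^ 2) :=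
      (hcovR _).trans (by gcongr; exact hH.up δ)
    linarith
  have hnδ : ∑ j ∈ F, M.eig j * inner ℝ (M.v j) d ^ 2 = ‖δ‖ ^ 2 := by
    rw [EuclideanSpace.real_norm_sq_eq, ← Finset.sum_coe_sort F]
    refine Finset.sum_congr rfl fun j _ => ?_
    simp only [hδ]
    rw [mul_pow, Real.sq_sqrt (M.eig_coe_pos j).le]
  have hng : ‖g‖ ^ 2 = ∑ j ∈ F, inner ℝ (M.v j) θ ^ 2 / M.eig j := by
    rw [EuclideanSpace.real_norm_sq_eq, ← Finset.sum_coe_sort F]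
    refine Finset.sum_congr rfl fun j _ => ?_
    simp only [hg]
    rw [div_pow, Real.sq_sqrt (M.eig_coe_pos j).le]
  have hnr : ‖r‖ ^ 2 = ∑ l, inner ℝ (X l) (M.tailProj F θ) ^ 2 := EuclideanSpace.real_norm_sq_eq _
  rw [(M.hasSum_cov F d).tsum_eq, hnδ, ← hng, ← hnr, ← norm_headMapT_sq, ← hq]
  -- `κ` adds to the head error the tail error that it causes: a factor `2` from splitting off `θ`,
  -- a factor `3` from the three parts of `w`.
  have hfin : ‖δ‖ ^ 2 + M.tailCov F d ≤ κ * ‖δ‖ ^ 2 + 2 * M.tailCov F θ +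
      6 * (β * C₁ / (c₁ ^ 2 * n) * ‖r‖ ^ 2) + 6 * M.tailCov F (combMap X (R ev)) := by
    have h1 := M.tailCov_sub_le F h θ
    have h2 : κ * ‖δ‖ ^ 2 = ‖δ‖ ^ 2 + 6 * (β * C₁ / (c₁ ^ 2 * n) * (A * n * ‖δ‖ ^ 2)) := by
      rw [hκ]; field_simp
    rw [h2]
    linarith
  have hκ0 : 0 < κ := by rw [hκ]; positivity
  have hκδ : κ * ‖δ‖ ^ 2 ≤ B * A / c₁ ^ 2 / n * ‖r‖ ^ 2 + B * (S / n) ^ 2 * q +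
      B * (S / n) ^ 2 * ‖g‖ ^ 2 := by
    refine (mul_le_mul_of_nonneg_left hδ2 hκ0.le).trans (le_of_eq ?_)
    rw [hB]; field_simp
  have hsplit : (B * A / c₁ ^ 2 + 6 * β * C₁ / c₁ ^ 2) / n * ‖r‖ ^ 2 =
      B * A / c₁ ^ 2 / n * ‖r‖ ^ 2 + 6 * (β * C₁ / (c₁ ^ 2 * n) * ‖r‖ ^ 2) := by
    field_simp
  rw [hsplit]
  linarith

end LinearModel

/-! ### Dual vectors and shrinkage factors -/

namespace LinearModel

variable {H : Type*} [NormedAddCommGroup H] [InnerProductSpace ℝ H] [MeasurableSpace H]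
  {σx : ℝ≥0} {M : LinearModel H σx} {n : ℕ} {F : Finset (CoordIdx M.p)} {X : Fin n → H}
  {S c₁ C₁ ρ a A : ℝ}

/-- The combination of the columns in `F` that is dual to the column `j`. -/
theorem HeadBounds.exists_dual (hH : M.HeadBounds F X a A) (hn : 0 < n) (ha : 0 < a)
    {j : CoordIdx M.p} (hj : j ∈ F) :
    ∃ u : EuclideanSpace ℝ (Fin n), inner ℝ (M.col X j) u = 1 ∧
      (∀ i ∈ F, i ≠ j → inner ℝ (M.col X i) u = 0) ∧ ‖u‖ ^ 2 ≤ 1 / (a * n) := by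
  have hn' : (0 : ℝ) < n := by exact_mod_cast hn
  set Z := M.headMap F X with hZ
  set N := LinearMap.adjoint Z ∘ₗ Z with hN
  have hNi : ∀ x y, inner ℝ (N x) y = inner ℝ (Z x) (Z y) := fun x y => by
    rw [hN, LinearMap.comp_apply, LinearMap.adjoint_inner_left]
  obtain ⟨R, hR, -⟩ := exists_inverse_of_coercive N
    (fun x y => by rw [hNi, real_inner_comm (N y) x, hNi, real_inner_comm])
    (m := a * n) (by positivity) fun x => by
      rw [hNi, real_inner_self_eq_norm_sq]; exact hH.low x
  -- The dual vector is `Z (ZᵗZ)⁻¹ e_j`. Its squared norm is the diagonal entry `x j` of the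
  -- inverse, and `ZᵗZ ≥ a * n` bounds that entry.
  set x := R (EuclideanSpace.single ⟨j, hj⟩ 1) with hx
  have hcol : ∀ i (hi : i ∈ F), inner ℝ (M.col X i) (Z x) =
      (EuclideanSpace.single (⟨j, hj⟩ : F) (1 : ℝ) : EuclideanSpace ℝ F) ⟨i, hi⟩ := fun i hi => by
    rw [← M.headMap_single F X ⟨i, hi⟩, real_inner_comm, ← hNi, hR]
    simp [EuclideanSpace.inner_single_right]
  have h1 : ‖Z x‖ ^ 2 = x ⟨j, hj⟩ := by
    rw [← real_inner_self_eq_norm_sq, ← hNi, hR]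
    simp [EuclideanSpace.inner_single_left]
  refine ⟨Z x, by rw [hcol j hj]; simp, fun i hi hij => ?_, ?_⟩
  · rw [hcol i hi]
    simp [hij]
  · have h2 := hH.low x
    have h3 : x ⟨j, hj⟩ ≤ ‖x‖ := (le_abs_self _).trans (PiLp.norm_apply_le x _)
    rw [h1] at h2 ⊢
    rw [le_div_iff₀ (by positivity)]
    have h4 : a * n * ‖x‖ ≤ 1 := by
      rcases (norm_nonneg x).eq_or_lt with h0 | h0
      · rw [← h0]; simp
      · nlinarith
    nlinarith [mul_le_mul_of_nonneg_left h3 (by positivity : 0 ≤ a * n)]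

theorem norm_combMap_sq (F : Finset (CoordIdx M.p)) (X : Fin n → H)
    (u : EuclideanSpace ℝ (Fin n)) :
    ‖combMap X u‖ ^ 2 = ∑ i ∈ F, M.eig i * inner ℝ (M.col X i) u ^ 2 +
      ‖M.tailProj F (combMap X u)‖ ^ 2 := by
  have h1 := (hasSum_ite_mem_finset F fun i => inner ℝ (M.v i) (combMap X u) ^ 2).add
    (M.hasSum_norm_sq_tailProj F (combMap X u))
  rw [(M.hasSum_norm_sq (combMap X u)).unique (h1.congr_fun fun j => by split_ifs <;> simp)]
  congr 1
  refine Finset.sum_congr rfl fun i _ => ?_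
  rw [inner_v_combMap, mul_pow, Real.sq_sqrt (M.eig_coe_pos i).le]

/-- Lower bound for the shrinkage factor of a component. -/
theorem TailBounds.shrinkage_ge (hT : M.TailBounds F X S c₁ C₁) {j : CoordIdx M.p}
    (hH : M.HeadBounds (insert j F) X a A) (hn : 0 < n) (hS : 0 < S) (hC₁ : 0 < C₁) (ha : 0 < a)
    (hρ : 0 ≤ ρ) (hρS : ρ ≤ S)
    {Q : EuclideanSpace ℝ (Fin n) →ₗ[ℝ] EuclideanSpace ℝ (Fin n)}
    (hQ : ∀ u, regGram X ρ (Q u) = u) :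
    a / (a + (C₁ + 1)) * min 1 (n * M.eig j / S) ≤
      M.eig j * inner ℝ (Q (M.col X j)) (M.col X j) := by
  have hn' : (0 : ℝ) < n := by exact_mod_cast hn
  have hlam := M.eig_coe_pos j
  obtain ⟨u, hu1, hu0, hun⟩ := hH.exists_dual hn ha (Finset.mem_insert_self j F)
  set z := M.col X j with hz
  set G := regGram X ρ with hG
  -- Duality leaves at most the component `j` of the head sum. For `j ∉ F` that sum vanishes, and
  -- the component `j` is part of the tail term.
  have hGu : inner ℝ (G u) u ≤ M.eig j + (C₁ + 1) * S / (a * n) := by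
    rw [inner_regGram_self, norm_combMap_sq F X u]
    have h1 : ∑ i ∈ F, M.eig i * inner ℝ (M.col X i) u ^ 2 ≤ M.eig j := by
      calc ∑ i ∈ F, M.eig i * inner ℝ (M.col X i) u ^ 2
          ≤ ∑ i ∈ insert j F, M.eig i * inner ℝ (M.col X i) u ^ 2 :=
            Finset.sum_le_sum_of_subset_of_nonneg (Finset.subset_insert j F) fun i _ _ =>
              mul_nonneg (M.eig_coe_pos i).le (sq_nonneg _)
        _ = M.eig j * inner ℝ (M.col X j) u ^ 2 := by
            refine Finset.sum_eq_single j (fun i hi hij => ?_) fun h =>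
              absurd (Finset.mem_insert_self j F) h
            rw [hu0 i hi hij]; ring
        _ = M.eig j := by rw [← hz, hu1]; ring
    have h2 := hT.up u
    have h3 : ρ * ‖u‖ ^ 2 ≤ S * ‖u‖ ^ 2 := by gcongr
    have h4 : (C₁ + 1) * S * ‖u‖ ^ 2 ≤ (C₁ + 1) * S * (1 / (a * n)) := by gcongr
    rw [mul_one_div] at h4
    linarith
  set x := Q z with hx
  have hGx : G x = z := hQ z
  have hpos : ∀ t : EuclideanSpace ℝ (Fin n), 0 ≤ inner ℝ (G t) t := fun t => by
    rw [inner_regGram_self]; positivity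
  -- Cauchy–Schwarz for the form of `G`, as `⟪G u, x⟫ = ⟪u, z⟫ = 1`.
  have hcs : 1 ≤ inner ℝ (G u) u * inner ℝ x z := by
    have hq : ∀ t : ℝ, 0 ≤ inner ℝ (G u) u * (t * t) + 2 * t + inner ℝ x z := fun t => by
      have := hpos (x + t • u)
      have e1 : inner ℝ (G u) x = 1 := by
        rw [hG, regGram_isSymmetric X ρ u x, ← hG, hGx, real_inner_comm, hu1]
      rw [map_add, map_smul, inner_add_left, inner_add_right, inner_add_right, inner_smul_left,
        inner_smul_left, inner_smul_right, inner_smul_right, hGx, e1, hu1,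
        real_inner_comm x z] at this
      simp only [conj_trivial] at this
      linarith
    have := discrim_le_zero (a := inner ℝ (G u) u) (b := 2) (c := inner ℝ x z) hq
    rw [discrim] at this
    linarith
  have hxz : 0 ≤ inner ℝ x z := by
    have := hpos x
    rwa [hGx, real_inner_comm] at this
  have hcs' : 1 ≤ (M.eig j + (C₁ + 1) * S / (a * n)) * inner ℝ x z :=
    hcs.trans (mul_le_mul_of_nonneg_right hGu hxz)
  set q : ℝ := n * M.eig j / S with hq
  have hq0 : 0 < q := by positivity
  have hkey : a * q ≤ (a * q + (C₁ + 1)) * (M.eig j * inner ℝ x z) := by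
    have h1 := mul_le_mul_of_nonneg_left hcs' (by positivity : 0 ≤ a * n * M.eig j / S)
    have h2 : a * n * M.eig j / S * ((M.eig j + (C₁ + 1) * S / (a * n)) * inner ℝ x z) =
        (a * q + (C₁ + 1)) * (M.eig j * inner ℝ x z) := by
      rw [hq]; field_simp
    rw [h2] at h1
    calc a * q = a * n * M.eig j / S * 1 := by rw [hq]; ring
      _ ≤ _ := h1
  set t := M.eig j * inner ℝ x z with ht
  have ht0 : 0 ≤ t := mul_nonneg hlam.le hxz
  rw [div_mul_eq_mul_div, div_le_iff₀ (by positivity)]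
  rcases le_total 1 q with h | h
  · rw [min_eq_left h]
    by_contra! hlt
    have ht1 : t < 1 := by nlinarith
    nlinarith [mul_nonneg (mul_nonneg ha.le (sub_nonneg.2 ht1.le)) (sub_nonneg.2 h)]
  · rw [min_eq_right h]
    nlinarith [mul_nonneg (mul_nonneg ha.le ht0) (sub_nonneg.2 h)]

theorem HeadBounds.norm_col_sq_le (hH : M.HeadBounds F X a A) {j : CoordIdx M.p} (hj : j ∈ F) :
    ‖M.col X j‖ ^ 2 ≤ A * n := by
  have := hH.up (EuclideanSpace.single ⟨j, hj⟩ 1)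
  rw [headMap_single] at this
  simpa using this

/-! ### Averages over the noise and the signs -/

/-- The inputs at which the conditional law of the noise has the moments of the model. -/
def NoiseRegular (M : LinearModel H σx) {n : ℕ} (X : Fin n → H) : Prop :=
  ∀ l, MemLp (fun e : ℝ => e) 2 (M.noise (X l)) ∧ ∫ e, e ∂(M.noise (X l)) = 0 ∧
    ∫ e, e ^ 2 ∂(M.noise (X l)) = M.noiseVar

theorem ae_noiseRegular (M : LinearModel H σx) (n : ℕ) :
    ∀ᵐ X ∂(Measure.pi fun _ : Fin n => M.D), M.NoiseRegular X := by
  have := M.D_prob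
  refine ae_all_iff.2 fun l => ?_
  have h := M.noise_memLp.and (M.noise_mean.and M.noise_var)
  exact (measurePreserving_eval (fun _ : Fin n => M.D) l).quasiMeasurePreserving.ae h

theorem NoiseRegular.lintegral_affine_sq (hX : M.NoiseRegular X) (b : ℝ) (u : Fin n → ℝ) :
    ∫⁻ e, ENNReal.ofReal ((b + ∑ l, u l * e l) ^ 2) ∂(Measure.pi fun l => M.noise (X l)) =
      ENNReal.ofReal (b ^ 2 + M.noiseVar * ∑ l, u l ^ 2) := by
  have := M.noise_markov
  have hmp : ∀ l, MeasurePreserving (Function.eval l) (Measure.pi fun l => M.noise (X l))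
      (M.noise (X l)) := fun l => measurePreserving_eval (fun l => M.noise (X l)) l
  have hint : ∀ l (g : ℝ → ℝ), Measurable g →
      ∫ e : Fin n → ℝ, g (e l) ∂(Measure.pi fun l => M.noise (X l)) = ∫ t, g t ∂(M.noise (X l)) :=
    fun l g hg => by
      conv_rhs => rw [← (hmp l).map_eq,
        integral_map (measurable_pi_apply l).aemeasurable hg.aestronglyMeasurable]
  exact lintegral_affine_sq_of_iIndepFun (ξ := fun l (e : Fin n → ℝ) => e l)
    (iIndepFun_pi (X := fun _ (t : ℝ) => t) fun l => aemeasurable_id)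
    (fun l => (hX l).1.comp_measurePreserving (hmp l))
    (fun l => (hint l _ measurable_id).trans (hX l).2.1)
    (fun l => (hint l _ (measurable_id.pow_const 2)).trans (hX l).2.2) Finset.univ b u

/-- The value `±1` of a coin. -/
def coinSign (b : Bool) : ℝ := if b then 1 else -1

theorem coinSign_sq (b : Bool) : coinSign b ^ 2 = 1 := by cases b <;> simp [coinSign]

theorem integral_fairCoins {ι : Type*} (j : ι) (g : Bool → ℝ) :
    ∫ s, g (s j) ∂(fairCoins ι) = (g true + g false) / 2 := by
  have h1 : (fairCoins ι).map (fun s => s j) = (PMF.uniformOfFintype Bool).toMeasure :=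
    Measure.infinitePi_map_eval _ j
  have h2 := integral_map (μ := fairCoins ι) (measurable_pi_apply j).aemeasurable
    (f := g) (measurable_of_finite g).aestronglyMeasurable
  rw [h1, PMF.integral_eq_sum] at h2
  rw [← h2]
  simp
  ring

instance {ι : Type*} : IsProbabilityMeasure (fairCoins ι) := by
  unfold fairCoins; infer_instance

theorem iIndepFun_coinSign (ι : Type*) :
    iIndepFun (fun (j : ι) (s : ι → Bool) => coinSign (s j)) (fairCoins ι) :=
  iIndepFun_infinitePi (X := fun _ b => coinSign b) fun _ => measurable_of_finite _

theorem memLp_coinSign {ι : Type*} (j : ι) :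
    MemLp (fun s : ι → Bool => coinSign (s j)) 2 (fairCoins ι) :=
  MemLp.of_bound ((measurable_of_finite coinSign).comp (measurable_pi_apply j)).aestronglyMeasurable
    1 (ae_of_all _ fun s => by cases h : s j <;> simp [coinSign])

/-- The partial sums are bounded by `∑ |u j|` uniformly in the signs, so dominated convergence
applies to their second moments, which independence makes diagonal. -/
theorem lintegral_coinSign_hasSum_sq {ι : Type*} [Countable ι] {u : ι → ℝ} (hu : Summable u)
    {f : (ι → Bool) → ℝ} (hf : ∀ s, HasSum (fun j => u j * coinSign (s j)) (f s)) :
    ∫⁻ s, ENNReal.ofReal (f s ^ 2) ∂(fairCoins ι) = ENNReal.ofReal (∑' j, u j ^ 2) := by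
  have hua : Summable fun j => |u j| := hu.abs
  have hm : ∀ j, Measurable fun s : ι → Bool => coinSign (s j) := fun j =>
    (measurable_of_finite coinSign).comp (measurable_pi_apply j)
  have hms : ∀ F : Finset ι, Measurable fun s : ι → Bool => ∑ j ∈ F, u j * coinSign (s j) :=
    fun F => Finset.measurable_fun_sum F fun j _ => (hm j).const_mul _
  have hb : ∀ (F : Finset ι) (s : ι → Bool), |∑ j ∈ F, u j * coinSign (s j)| ≤ ∑' j, |u j| := by
    intro F s
    refine (Finset.abs_sum_le_sum_abs _ _).trans ?_
    calc ∑ j ∈ F, |u j * coinSign (s j)| = ∑ j ∈ F, |u j| := Finset.sum_congr rfl fun j _ => by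
          cases h : s j <;> simp [coinSign]
      _ ≤ _ := hua.sum_le_tsum F fun _ _ => abs_nonneg _
  have hlim := tendsto_integral_filter_of_dominated_convergence (μ := fairCoins ι)
    (l := (atTop : Filter (Finset ι))) (F := fun F s => (∑ j ∈ F, u j * coinSign (s j)) ^ 2)
    (f := fun s => f s ^ 2) (fun _ => (∑' j, |u j|) ^ 2)
    (.of_forall fun F => ((hms F).pow_const 2).aestronglyMeasurable)
    (.of_forall fun F => ae_of_all _ fun s => by
      rw [Real.norm_eq_abs, abs_pow]
      gcongr
      exact hb F s) (integrable_const _) (ae_of_all _ fun s => (hf s).pow 2)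
  have hval : ∀ F : Finset ι, ∫ s, (∑ j ∈ F, u j * coinSign (s j)) ^ 2 ∂(fairCoins ι) =
      ∑ j ∈ F, u j ^ 2 := fun F => by
    have := integral_affine_sq_of_iIndepFun (iIndepFun_coinSign ι) memLp_coinSign
      (fun j => by rw [integral_fairCoins j coinSign]; simp [coinSign]) (τ := 1)
      (fun j => by rw [integral_fairCoins j fun b => coinSign b ^ 2]; simp [coinSign_sq]) F 0 u
    simpa using this
  simp_rw [hval] at hlim
  have husq : Summable fun j => u j ^ 2 := by
    have := summable_of_sum_le (f := fun j => u j ^ 2) (c := (∑' j, |u j|) ^ 2)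
      (fun j => sq_nonneg _) fun F => by
        calc ∑ j ∈ F, u j ^ 2 = ∑ j ∈ F, |u j| ^ 2 := by simp
          _ ≤ (∑ j ∈ F, |u j|) ^ 2 := Finset.sum_sq_le_sq_sum_of_nonneg (fun j _ => abs_nonneg (u j))
          _ ≤ _ := by
            gcongr
            exact hua.sum_le_tsum F fun _ _ => abs_nonneg _
    exact this
  have heq := tendsto_nhds_unique hlim husq.hasSum
  have hfm : Measurable f := by
    refine measurable_of_tendsto_metrizable' (atTop : Filter (Finset ι)) hms ?_
    rw [tendsto_pi_nhds]; exact hf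
  rw [← heq, ofReal_integral_eq_lintegral_ofReal _ (ae_of_all _ fun s => sq_nonneg _)]
  refine Integrable.of_bound (hfm.pow_const 2).aestronglyMeasurable ((∑' j, |u j|) ^ 2)
    (ae_of_all _ fun s => ?_)
  rw [Real.norm_eq_abs, abs_pow]
  gcongr
  exact le_of_tendsto (hf s).abs (.of_forall fun F => hb F s)

/-- Sign changes preserve square summability, so by completeness the series converges; otherwise the
`tsum` in `signed` could be its default value `0`. -/
theorem hasSum_signed (M : LinearModel H σx) [CompleteSpace H] (s : CoordIdx M.p → Bool) :
    HasSum (fun j => (coinSign (s j) * inner ℝ (M.v j) M.θ) • M.v j) (M.signed s) ∧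
      ∀ j, inner ℝ (M.v j) (M.signed s) = coinSign (s j) * inner ℝ (M.v j) M.θ := by
  have hmem : Memℓp (fun j => coinSign (s j) * inner ℝ (M.v j) M.θ) 2 := by
    refine memℓp_gen ?_
    refine (M.hasSum_norm_sq M.θ).summable.congr fun j => ?_
    simp [mul_pow, coinSign_sq]
  have h1 := M.v.hasSum_repr_symm ⟨_, hmem⟩
  have h2 : M.signed s = M.v.repr.symm ⟨_, hmem⟩ := h1.tsum_eq
  refine ⟨h2 ▸ h1, fun j => ?_⟩
  rw [h2, ← M.v.repr_apply_apply, LinearIsometryEquiv.apply_symm_apply]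

theorem hasSum_inner_signed (M : LinearModel H σx) [CompleteSpace H] (g : H)
    (s : CoordIdx M.p → Bool) :
    HasSum (fun j => inner ℝ (M.v j) g * inner ℝ (M.v j) M.θ * coinSign (s j))
      (inner ℝ g (M.signed s)) := by
  refine (M.hasSum_inner g (M.signed s)).congr_fun ?_ |> fun h => h
  intro j
  rw [(M.hasSum_signed s).2]; ring

theorem measurable_inner_signed (M : LinearModel H σx) [CompleteSpace H] (g : H) :
    Measurable fun s : CoordIdx M.p → Bool => inner ℝ g (M.signed s) := by
  refine measurable_of_tendsto_metrizable' (atTop : Filter (Finset (CoordIdx M.p)))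
    (f := fun F s => ∑ j ∈ F, inner ℝ (M.v j) g * inner ℝ (M.v j) M.θ * coinSign (s j))
    (fun F => ?_) ?_
  · exact Finset.measurable_fun_sum F fun j _ =>
      ((measurable_of_finite coinSign).comp (measurable_pi_apply j)).const_mul _
  · rw [tendsto_pi_nhds]; exact M.hasSum_inner_signed g

theorem lintegral_inner_signed_sq (M : LinearModel H σx) [CompleteSpace H] (g : H) :
    ∫⁻ s, ENNReal.ofReal (inner ℝ g (M.signed s) ^ 2) ∂(fairCoins (CoordIdx M.p)) =
      ENNReal.ofReal (∑' j, inner ℝ (M.v j) g ^ 2 * inner ℝ (M.v j) M.θ ^ 2) := by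
  rw [lintegral_coinSign_hasSum_sq (M.hasSum_inner g M.θ).summable (M.hasSum_inner_signed g)]
  simp_rw [mul_pow]

end LinearModel

namespace LinearModel

variable {H : Type*} [NormedAddCommGroup H] [InnerProductSpace ℝ H] [MeasurableSpace H]
  {σx : ℝ≥0} {M : LinearModel H σx} {n : ℕ} {F : Finset (CoordIdx M.p)} {X : Fin n → H}
  {S c₁ C₁ ρ a A : ℝ}

/-! ### The averaged risk -/

/-- Fatou's lemma along the partial sums in the eigenbasis; an inequality is all that an upper bound
for the risk requires. -/
theorem lintegral_inner_sq_le [BorelSpace H] (M : LinearModel H σx) (d : H) :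
    ∫⁻ x, ENNReal.ofReal (inner ℝ x d ^ 2) ∂M.D ≤
      ENNReal.ofReal (∑' j : CoordIdx M.p, M.eig j * inner ℝ (M.v j) d ^ 2) := by
  have := M.D_prob
  have hξ := M.isStdSubgaussian_feature
  have hsum := M.hasSum_cov ∅ d
  set u : CoordIdx M.p → ℝ := fun j => √(M.eig j) * inner ℝ (M.v j) d with hu
  have hu2 : ∀ j, u j ^ 2 = M.eig j * inner ℝ (M.v j) d ^ 2 := fun j => by
    rw [hu]; simp only; rw [mul_pow, Real.sq_sqrt (M.eig_coe_pos j).le]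
  refine lintegral_le_of_tendsto_finset (I := CoordIdx M.p)
    (f := fun G x => ENNReal.ofReal ((0 + ∑ j ∈ G, u j * M.feature j x) ^ 2)) (fun G => ?_)
    (ae_of_all _ fun x => ?_) fun G => ?_
  · have : Measurable fun x => ∑ j ∈ G, u j * M.feature j x :=
      Finset.measurable_fun_sum G fun j _ => (hξ.measurable j).const_mul _
    exact Measurable.aemeasurable (by fun_prop)
  · have h1 : HasSum (fun j => u j * M.feature j x) (inner ℝ x d) := by
      refine (M.hasSum_inner x d).congr_fun ?_ |> fun h => h
      intro j
      rw [M.inner_eq_sqrt_mul_feature j x, hu]; ring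
    have h2 : Tendsto (fun G => ∑ j ∈ G, u j * M.feature j x) atTop (𝓝 (inner ℝ x d)) := h1
    simp_rw [zero_add]
    exact (ENNReal.continuous_ofReal.tendsto _).comp (h2.pow 2)
  · rw [lintegral_affine_sq_of_iIndepFun hξ.indep (fun j => (hξ.sub j).memLp 2) hξ.mean hξ.second]
    apply ENNReal.ofReal_le_ofReal
    simp_rw [hu2]
    rw [zero_pow two_ne_zero, zero_add, one_mul]
    exact hsum.summable.sum_le_tsum G fun j _ => mul_nonneg (M.eig_coe_pos j).le (sq_nonneg _)

/-- Sum and average are interchanged by nonnegativity, and each `⟪u j, e⟫ ^ 2` averages to `noiseVar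
* ‖u j‖ ^ 2`. This yields the variance terms of both head and tail. -/
theorem NoiseRegular.lintegral_hasSum_inner_sq_le {ι : Type*} [Countable ι]
    (hX : M.NoiseRegular X) {w : ι → ℝ} (hw : ∀ j, 0 ≤ w j) {u : ι → EuclideanSpace ℝ (Fin n)}
    {Q : (Fin n → ℝ) → ℝ}
    (hQ : ∀ e, HasSum (fun j => w j * inner ℝ (u j) (WithLp.toLp 2 e) ^ 2) (Q e)) {g : ι → ℝ} {V : ℝ}
    (hg : ∀ j, w j * ‖u j‖ ^ 2 ≤ g j) (hV : HasSum g V) :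
    ∫⁻ e, ENNReal.ofReal (Q e) ∂(Measure.pi fun l => M.noise (X l)) ≤
      ENNReal.ofReal (M.noiseVar * V) := by
  have hσ := M.noiseVar_pos
  have hin : ∀ j (e : Fin n → ℝ), inner ℝ (u j) (WithLp.toLp 2 e) = 0 + ∑ l, u j l * e l :=
    fun j e => by rw [EuclideanSpace.real_inner_eq_sum, zero_add]
  have hmeas : ∀ j, Measurable fun e : Fin n → ℝ =>
      ENNReal.ofReal (inner ℝ (u j) (WithLp.toLp 2 e) ^ 2) := fun j => by
    simp_rw [hin]; fun_prop
  have h1 : ∀ e, ENNReal.ofReal (Q e) = ∑' j, ENNReal.ofReal (w j) *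
      ENNReal.ofReal (inner ℝ (u j) (WithLp.toLp 2 e) ^ 2) := fun e => by
    rw [← (hQ e).tsum_eq, ENNReal.ofReal_tsum_of_nonneg
      (fun j => mul_nonneg (hw j) (sq_nonneg _)) (hQ e).summable]
    exact tsum_congr fun j => ENNReal.ofReal_mul (hw j)
  simp_rw [h1]
  rw [lintegral_tsum fun j => ((hmeas j).const_mul _).aemeasurable]
  have hg0 : ∀ j, 0 ≤ g j := fun j => (mul_nonneg (hw j) (sq_nonneg _)).trans (hg j)
  rw [← hV.tsum_eq, ← tsum_mul_left, ENNReal.ofReal_tsum_of_nonneg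
    (fun j => mul_nonneg hσ.le (hg0 j)) (hV.summable.mul_left _)]
  refine ENNReal.tsum_le_tsum fun j => ?_
  rw [lintegral_const_mul _ (hmeas j)]
  simp_rw [hin]
  rw [hX.lintegral_affine_sq, ← ENNReal.ofReal_mul (hw j), ← EuclideanSpace.real_norm_sq_eq]
  apply ENNReal.ofReal_le_ofReal
  nlinarith [mul_le_mul_of_nonneg_left (hg j) hσ.le]

theorem tailCov_signed [CompleteSpace H] (F : Finset (CoordIdx M.p)) (s : CoordIdx M.p → Bool) :
    M.tailCov F (M.signed s) = M.tailCov F M.θ := by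
  unfold tailCov
  simp_rw [(M.hasSum_signed s).2, mul_pow, coinSign_sq, one_mul]

theorem inner_tailProj_comm (F : Finset (CoordIdx M.p)) (g h : H) :
    inner ℝ g (M.tailProj F h) = inner ℝ (M.tailProj F g) h := by
  refine (M.hasSum_inner g (M.tailProj F h)).unique
    ((M.hasSum_inner (M.tailProj F g) h).congr_fun fun j => ?_)
  rw [inner_v_tailProj, inner_v_tailProj]
  split_ifs <;> simp

theorem eig_mul_norm_col_sq (X : Fin n → H) (j : CoordIdx M.p) :
    M.eig j * ‖M.col X j‖ ^ 2 = ∑ l, inner ℝ (M.v j) (X l) ^ 2 := by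
  rw [norm_col_sq, Finset.mul_sum]
  exact Finset.sum_congr rfl fun l _ => (M.inner_sq_eq_mul_feature_sq j (X l)).symm

theorem summable_eig_mul_norm_col_sq (X : Fin n → H) :
    Summable fun j : CoordIdx M.p => M.eig j * ‖M.col X j‖ ^ 2 := by
  simp_rw [eig_mul_norm_col_sq]
  exact summable_sum fun l _ => (M.hasSum_norm_sq (X l)).summable

theorem summable_mul_norm_col_sq (X : Fin n → H) {w : CoordIdx M.p → ℝ} (hw : ∀ j, 0 ≤ w j) {C : ℝ}
    (hwC : ∀ j, w j ≤ C * M.eig j) : Summable fun j => w j * ‖M.col X j‖ ^ 2 := by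
  refine ((summable_eig_mul_norm_col_sq X).mul_left C).of_nonneg_of_le
    (fun j => mul_nonneg (hw j) (sq_nonneg _)) fun j => ?_
  rw [← mul_assoc]
  exact mul_le_mul_of_nonneg_right (hwC j) (sq_nonneg _)

theorem inner_v_sq_le (h : H) (j : CoordIdx M.p) : inner ℝ (M.v j) h ^ 2 ≤ ‖h‖ ^ 2 :=
  le_hasSum (M.hasSum_norm_sq h) j fun _ _ => sq_nonneg _

/-- The random signs remove the products of different coordinates, so that the tail signal becomes a
weighted sum of the `‖col j‖ ^ 2`, to which concentration applies. -/
theorem lintegral_sum_inner_signed_sq [CompleteSpace H] (F : Finset (CoordIdx M.p))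
    (X : Fin n → H) :
    ∫⁻ s, ENNReal.ofReal (∑ l, inner ℝ (X l) (M.tailProj F (M.signed s)) ^ 2)
      ∂(fairCoins (CoordIdx M.p)) =
    ENNReal.ofReal (∑' j, (if j ∈ F then 0 else M.eig j * inner ℝ (M.v j) M.θ ^ 2) *
      ‖M.col X j‖ ^ 2) := by
  have hsl : ∀ l, Summable fun j => inner ℝ (M.v j) (M.tailProj F (X l)) ^ 2 *
      inner ℝ (M.v j) M.θ ^ 2 := fun l =>
    ((M.hasSum_norm_sq (M.tailProj F (X l))).summable.mul_right (‖M.θ‖ ^ 2)).of_nonneg_of_le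
      (fun j => by positivity) fun j => mul_le_mul_of_nonneg_left (inner_v_sq_le _ _) (sq_nonneg _)
  simp_rw [inner_tailProj_comm, ENNReal.ofReal_sum_of_nonneg fun l _ => sq_nonneg _]
  have hml : ∀ l, Measurable fun s : CoordIdx M.p → Bool =>
      ENNReal.ofReal (inner ℝ (M.tailProj F (X l)) (M.signed s) ^ 2) := fun l =>
    ENNReal.measurable_ofReal.comp
      ((M.measurable_inner_signed (M.tailProj F (X l))).pow_const (2 : ℕ))
  rw [lintegral_finsetSum _ fun l _ => hml l]
  simp_rw [lintegral_inner_signed_sq]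
  rw [← ENNReal.ofReal_sum_of_nonneg fun l _ => tsum_nonneg fun j => by positivity,
    ← Summable.tsum_finsetSum fun l _ => hsl l]
  congr 1
  refine tsum_congr fun j => ?_
  simp_rw [inner_v_tailProj]
  split_ifs with hj
  · simp
  · rw [mul_right_comm, eig_mul_norm_col_sq, Finset.sum_mul]

/-- Upper bound for the averaged risk on a well-conditioned sample. -/
theorem stdRisk_le [CompleteSpace H] [BorelSpace H] (hT : M.TailBounds F X S c₁ C₁) {β lam : ℝ}
    (hH : M.HeadBounds F X a A)
    (hX : M.NoiseRegular X)
    (hn : 0 < n) (hS : 0 < S) (hc₁ : 0 < c₁) (hC₁ : 0 < C₁) (ha : 0 < a) (hA : 0 < A) (hβ : 0 < β)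
    (hW : ∀ j ∉ F, M.eig j ≤ β * S / n) (hlam : 0 ≤ lam) (hlamS : n * lam ≤ S) {V₄ V₅ : ℝ}
    (hV₄ : ∑' j : CoordIdx M.p, (if j ∈ F then 0 else M.eig j ^ 2) * ‖M.col X j‖ ^ 2 ≤ V₄)
    (hV₅ : ∑' j : CoordIdx M.p, (if j ∈ F then 0 else M.eig j * inner ℝ (M.v j) M.θ ^ 2) *
      ‖M.col X j‖ ^ 2 ≤ V₅) {κ B : ℝ}
    (hκ : κ = 1 + 6 * β * C₁ * A / c₁ ^ 2) (hB : B = 3 * κ * (C₁ + 1) ^ 2 / a ^ 2) :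
    M.stdRisk lam X ≤ ENNReal.ofReal (2 * M.tailCov F M.θ +
      B * (S / n) ^ 2 * ∑ j ∈ F, inner ℝ (M.v j) M.θ ^ 2 / M.eig j +
      (B * A / c₁ ^ 2 + 6 * β * C₁ / c₁ ^ 2) / n * V₅ +
      B * (S / n) ^ 2 * (M.noiseVar * (F.card * (A * n / (c₁ * S) ^ 2))) +
      6 * (M.noiseVar * (V₄ / (c₁ * S) ^ 2))) := by
  have hσ := M.noiseVar_pos
  have hκ0 : 0 < κ := by rw [hκ]; positivity
  have hB0 : 0 < B := by rw [hB]; positivity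
  have hn' : (0 : ℝ) < n := by exact_mod_cast hn
  obtain ⟨R, hRA, hR, hRn, hRC⟩ := hT.exists_inverse (ρ := n * lam) hS hc₁ (by positivity) hlamS
  set c0 : ℝ := 2 * M.tailCov F M.θ +
    B * (S / n) ^ 2 * ∑ j ∈ F, inner ℝ (M.v j) M.θ ^ 2 / M.eig j with hc0
  have hc00 : 0 ≤ c0 := by
    have h1 := M.tailCov_nonneg F M.θ
    have h2 : 0 ≤ ∑ j ∈ F, inner ℝ (M.v j) M.θ ^ 2 / M.eig j :=
      Finset.sum_nonneg fun j _ => div_nonneg (sq_nonneg _) (M.eig_coe_pos j).le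
    positivity
  set b : ℝ := (B * A / c₁ ^ 2 + 6 * β * C₁ / c₁ ^ 2) / n with hb
  have hb0 : 0 ≤ b := by positivity
  set b' : ℝ := B * (S / n) ^ 2 with hb'
  have hb'0 : 0 ≤ b' := by positivity
  -- the average over the noise
  have hhead : ∫⁻ e, ENNReal.ofReal (∑ j ∈ F, inner ℝ (M.col X j) (R (WithLp.toLp 2 e)) ^ 2)
      ∂(Measure.pi fun l => M.noise (X l)) ≤
      ENNReal.ofReal (M.noiseVar * (F.card * (A * n / (c₁ * S) ^ 2))) := by
    refine hX.lintegral_hasSum_inner_sq_le (ι := F) (w := fun _ => 1) (fun _ => zero_le_one)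
      (u := fun j => R (M.col X j)) (fun e => ?_) (g := fun _ => A * n / (c₁ * S) ^ 2)
      (fun j => ?_) ?_
    · simp_rw [one_mul, hR _ (WithLp.toLp 2 e)]
      rw [← Finset.sum_coe_sort F]
      exact hasSum_fintype _
    · rw [one_mul]
      refine (hRn _).trans ?_
      gcongr
      exact hH.norm_col_sq_le j.2
    · convert hasSum_fintype (fun _ : F => A * n / (c₁ * S) ^ 2) using 1
      simp
  have htailsum : Summable fun j : CoordIdx M.p =>
      (if j ∈ F then 0 else M.eig j ^ 2) * ‖M.col X j‖ ^ 2 := by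
    refine summable_mul_norm_col_sq X (fun j => by split_ifs <;> positivity) (C := M.eig 0) fun j => ?_
    have h1 := M.eig_coe_pos j
    have h2 := M.eig_le_zero_idx j
    split_ifs
    · exact mul_nonneg (h1.le.trans h2) h1.le
    · rw [sq]; gcongr
  have htail : ∫⁻ e, ENNReal.ofReal (M.tailCov F (combMap X (R (WithLp.toLp 2 e))))
      ∂(Measure.pi fun l => M.noise (X l)) ≤
      ENNReal.ofReal (M.noiseVar * (V₄ / (c₁ * S) ^ 2)) := by
    refine (hX.lintegral_hasSum_inner_sq_le
      (w := fun j : CoordIdx M.p => if j ∈ F then 0 else M.eig j ^ 2)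
      (fun j => by split_ifs <;> positivity)
      (u := fun j => R (M.col X j)) (fun e => ?_)
      (g := fun j => (if j ∈ F then 0 else M.eig j ^ 2) * ‖M.col X j‖ ^ 2 / (c₁ * S) ^ 2)
      (fun j => ?_) (htailsum.div_const _).hasSum).trans ?_
    · have := (M.summable_tailCov F (combMap X (R (WithLp.toLp 2 e)))).hasSum
      refine this.congr_fun ?_ |> fun h => h
      intro j
      rw [inner_v_combMap, hR, mul_pow, Real.sq_sqrt (M.eig_coe_pos j).le]
      split_ifs
      · ring
      · ring
    · rw [mul_div_assoc]
      gcongr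
      exact hRn _
    · rw [tsum_div_const]
      gcongr
  -- The remaining dependence on the signs is through the tail signal; the other terms in `θ`
  -- contain only squares of coordinates.
  have hfix : ∀ s, ∫⁻ e, ∫⁻ x, ENNReal.ofReal ((inner ℝ x (ridgeEstimator lam X (M.signed s) e) -
      inner ℝ x (M.signed s)) ^ 2) ∂M.D ∂(Measure.pi fun i => M.noise (X i)) ≤
      ENNReal.ofReal (c0 + b' * (M.noiseVar * (F.card * (A * n / (c₁ * S) ^ 2))) +
        6 * (M.noiseVar * (V₄ / (c₁ * S) ^ 2))) +
      ENNReal.ofReal b *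
        ENNReal.ofReal (∑ l, inner ℝ (X l) (M.tailProj F (M.signed s)) ^ 2) := by
    intro s
    have := M.noise_markov
    set rs := ∑ l, inner ℝ (X l) (M.tailProj F (M.signed s)) ^ 2 with hrs
    have hrs0 : 0 ≤ rs := Finset.sum_nonneg fun _ _ => sq_nonneg _
    have hpt : ∀ e, ∫⁻ x, ENNReal.ofReal ((inner ℝ x (ridgeEstimator lam X (M.signed s) e) -
        inner ℝ x (M.signed s)) ^ 2) ∂M.D ≤
        (ENNReal.ofReal (c0 + b * rs) +
          ENNReal.ofReal b' *
            ENNReal.ofReal (∑ j ∈ F, inner ℝ (M.col X j) (R (WithLp.toLp 2 e)) ^ 2)) +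
          ENNReal.ofReal 6 * ENNReal.ofReal (M.tailCov F (combMap X (R (WithLp.toLp 2 e)))) := by
      intro e
      simp_rw [← inner_sub_right]
      refine (M.lintegral_inner_sq_le _).trans ?_
      rw [← ENNReal.ofReal_mul hb'0, ← ENNReal.ofReal_mul (by norm_num : (0 : ℝ) ≤ 6),
        ← ENNReal.ofReal_add (by positivity)
          (mul_nonneg hb'0 (Finset.sum_nonneg fun _ _ => sq_nonneg _)),
        ← ENNReal.ofReal_add (add_nonneg (by positivity)
          (mul_nonneg hb'0 (Finset.sum_nonneg fun _ _ => sq_nonneg _)))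
          (mul_nonneg (by norm_num) (M.tailCov_nonneg F _))]
      apply ENNReal.ofReal_le_ofReal
      have h1 := cov_error_le hT hH hn hS hc₁ hC₁ ha hA hβ hW hlam hRA hR hRn hRC (M.signed s) e
        hκ hB
      simp_rw [tailCov_signed, (M.hasSum_signed s).2, mul_pow, coinSign_sq, one_mul] at h1
      rw [← hb, ← hrs, ← hb'] at h1
      rw [hc0]
      linarith
    have hmeas1 : Measurable fun e : Fin n → ℝ =>
        ENNReal.ofReal (∑ j ∈ F, inner ℝ (M.col X j) (R (WithLp.toLp 2 e)) ^ 2) := by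
      simp_rw [← hR _ (WithLp.toLp 2 _), EuclideanSpace.real_inner_eq_sum]
      fun_prop
    refine (lintegral_mono hpt).trans ?_
    have hmeas2 : Measurable fun e : Fin n → ℝ => ENNReal.ofReal (c0 + b * rs) +
        ENNReal.ofReal b' *
          ENNReal.ofReal (∑ j ∈ F, inner ℝ (M.col X j) (R (WithLp.toLp 2 e)) ^ 2) :=
      measurable_const.add (hmeas1.const_mul _)
    rw [lintegral_add_left hmeas2, lintegral_add_left measurable_const,
      lintegral_const_mul _ hmeas1, lintegral_const_mul' _ _ ENNReal.ofReal_ne_top, lintegral_const,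
      measure_univ, mul_one]
    have hcard0 : 0 ≤ M.noiseVar * (F.card * (A * n / (c₁ * S) ^ 2)) := by positivity
    have hV₄0 : 0 ≤ V₄ := le_trans (tsum_nonneg fun j => by split_ifs <;> positivity) hV₄
    have hV₄' : 0 ≤ M.noiseVar * (V₄ / (c₁ * S) ^ 2) := by positivity
    calc _ ≤ ENNReal.ofReal (c0 + b * rs) +
          ENNReal.ofReal b' * ENNReal.ofReal (M.noiseVar * (F.card * (A * n / (c₁ * S) ^ 2))) +
          ENNReal.ofReal 6 * ENNReal.ofReal (M.noiseVar * (V₄ / (c₁ * S) ^ 2)) := by gcongr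
      _ = _ := by
          rw [← ENNReal.ofReal_mul hb'0, ← ENNReal.ofReal_mul (by norm_num : (0 : ℝ) ≤ 6),
            ← ENNReal.ofReal_mul hb0, ← ENNReal.ofReal_add (by positivity) (by positivity),
            ← ENNReal.ofReal_add (by positivity) (by positivity),
            ← ENNReal.ofReal_add (by positivity) (by positivity)]
          congr 1; ring
  have hV₅0 : 0 ≤ V₅ := le_trans (tsum_nonneg fun j => by
    have := M.eig_coe_pos j
    split_ifs <;> positivity) hV₅
  have hV₄0 : 0 ≤ V₄ := le_trans (tsum_nonneg fun j => by split_ifs <;> positivity) hV₄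
  unfold stdRisk
  refine (lintegral_mono hfix).trans ?_
  rw [lintegral_add_left measurable_const, lintegral_const, measure_univ, mul_one,
    lintegral_const_mul' _ _ ENNReal.ofReal_ne_top, lintegral_sum_inner_signed_sq]
  calc _ ≤ ENNReal.ofReal (c0 + b' * (M.noiseVar * (F.card * (A * n / (c₁ * S) ^ 2))) +
        6 * (M.noiseVar * (V₄ / (c₁ * S) ^ 2))) + ENNReal.ofReal b * ENNReal.ofReal V₅ := by
        gcongr
    _ = _ := by
        rw [← ENNReal.ofReal_mul hb0, ← ENNReal.ofReal_add (by positivity) (by positivity)]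
        congr 1; ring

/-! ### The averaged squared norm of the estimator -/

/-- Lower bound for the averaged squared norm of the estimator, component by component. -/
theorem le_normSqMean [CompleteSpace H] (hX : M.NoiseRegular X) {lam : ℝ}
    {Q : EuclideanSpace ℝ (Fin n) →ₗ[ℝ] EuclideanSpace ℝ (Fin n)}
    (hQ : ∀ u, Q (regGram X (n * lam) u) = u) (hQs : Q.IsSymmetric) :
    ∑' j : CoordIdx M.p, ENNReal.ofReal
      (inner ℝ (M.v j) M.θ ^ 2 * (M.eig j * inner ℝ (Q (M.col X j)) (M.col X j)) ^ 2 +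
        M.noiseVar * (M.eig j * ‖Q (M.col X j)‖ ^ 2)) ≤ M.normSqMean lam X := by
  have hσ := M.noiseVar_pos
  have hm := M.noise_markov
  set g : CoordIdx M.p → H := fun j => √(M.eig j) • combMap X (Q (M.col X j)) with hg
  have hcoord : ∀ j (s : CoordIdx M.p → Bool) (e : Fin n → ℝ),
      inner ℝ (M.v j) (ridgeEstimator lam X (M.signed s) e) =
        inner ℝ (g j) (M.signed s) + ∑ l, (√(M.eig j) * Q (M.col X j) l) * e l := by
    intro j s e
    unfold ridgeEstimator
    rw [ridge_eq lam X _ Q hQ, inner_v_combMap, ← hQs, EuclideanSpace.real_inner_eq_sum,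
      hg]
    simp only
    rw [real_inner_smul_left, real_inner_comm, inner_combMap, Finset.mul_sum, Finset.mul_sum,
      ← Finset.sum_add_distrib]
    refine Finset.sum_congr rfl fun l _ => ?_
    rw [real_inner_comm]; ring
  have hs : ∀ s, ∫⁻ e, ENNReal.ofReal (‖ridgeEstimator lam X (M.signed s) e‖ ^ 2)
      ∂(Measure.pi fun i => M.noise (X i)) = ∑' j : CoordIdx M.p,
      (ENNReal.ofReal (inner ℝ (g j) (M.signed s) ^ 2) +
        ENNReal.ofReal (M.noiseVar * (M.eig j * ‖Q (M.col X j)‖ ^ 2))) := by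
    intro s
    have h1 : ∀ e, ENNReal.ofReal (‖ridgeEstimator lam X (M.signed s) e‖ ^ 2) =
        ∑' j : CoordIdx M.p, ENNReal.ofReal ((inner ℝ (g j) (M.signed s) +
          ∑ l, (√(M.eig j) * Q (M.col X j) l) * e l) ^ 2) := fun e => by
      have h2 := M.hasSum_norm_sq (ridgeEstimator lam X (M.signed s) e)
      rw [← h2.tsum_eq, ENNReal.ofReal_tsum_of_nonneg (fun j => sq_nonneg _) h2.summable]
      simp_rw [hcoord]
    simp_rw [h1]
    rw [lintegral_tsum fun j => Measurable.aemeasurable (by fun_prop)]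
    refine tsum_congr fun j => ?_
    rw [hX.lintegral_affine_sq, ENNReal.ofReal_add (sq_nonneg _) (mul_nonneg hσ.le
      (Finset.sum_nonneg fun _ _ => sq_nonneg _))]
    simp_rw [mul_pow, Real.sq_sqrt (M.eig_coe_pos j).le]
    rw [← Finset.mul_sum, ← EuclideanSpace.real_norm_sq_eq]
  unfold normSqMean
  simp_rw [hs]
  have hmeas : ∀ j, Measurable fun s : CoordIdx M.p → Bool =>
      ENNReal.ofReal (inner ℝ (g j) (M.signed s) ^ 2) +
        ENNReal.ofReal (M.noiseVar * (M.eig j * ‖Q (M.col X j)‖ ^ 2)) := fun j =>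
    (ENNReal.measurable_ofReal.comp
      ((M.measurable_inner_signed (g j)).pow_const (2 : ℕ))).add measurable_const
  rw [lintegral_tsum fun j => (hmeas j).aemeasurable]
  refine ENNReal.tsum_le_tsum fun j => ?_
  have hsum : Summable fun i => inner ℝ (M.v i) (g j) ^ 2 * inner ℝ (M.v i) M.θ ^ 2 :=
    ((M.hasSum_norm_sq (g j)).summable.mul_right (‖M.θ‖ ^ 2)).of_nonneg_of_le
      (fun i => by positivity) fun i => mul_le_mul_of_nonneg_left (inner_v_sq_le _ _) (sq_nonneg _)
  have hpos := M.eig_coe_pos j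
  rw [lintegral_add_right _ measurable_const, lintegral_inner_signed_sq, lintegral_const,
    measure_univ, mul_one, ENNReal.ofReal_add (by positivity) (by positivity)]
  gcongr
  -- Of the sum over `i` left by the sign average, only the diagonal term `i = j` is kept.
  have h3 := hsum.le_tsum j fun i _ => by positivity
  refine le_trans (le_of_eq ?_) h3
  have h4 : inner ℝ (M.v j) (g j) = M.eig j * inner ℝ (Q (M.col X j)) (M.col X j) := by
    rw [hg]; simp only
    rw [inner_smul_right, inner_v_combMap, ← mul_assoc, Real.mul_self_sqrt hpos.le, real_inner_comm]
  rw [h4, mul_comm]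

end LinearModel

namespace LinearModel

variable {H : Type*} [NormedAddCommGroup H] [InnerProductSpace ℝ H] [MeasurableSpace H]
  {σx : ℝ≥0} (M : LinearModel H σx)

/-! ### The first eigendirections -/

open Classical in
/-- The positions of the first `k` eigenvectors. -/
def headIdx (k : ℕ) : Finset (CoordIdx M.p) :=
  (Finset.range k).subtype fun j : ℕ => (j : ℕ∞) < M.p

theorem mem_headIdx {k : ℕ} {j : CoordIdx M.p} : j ∈ M.headIdx k ↔ (j : ℕ) < k := by
  simp [headIdx]

theorem card_headIdx_le (k : ℕ) : (M.headIdx k).card ≤ k := by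
  rw [headIdx, Finset.card_subtype]
  exact (Finset.card_filter_le _ _).trans (Finset.card_range k).le

theorem sum_headIdx {f : ℕ → ℝ} (hf : ∀ j : ℕ, M.p ≤ j → f j = 0) (k : ℕ) :
    ∑ j ∈ M.headIdx k, f j = ∑ i ∈ Finset.range k, f i := by
  classical
  rw [headIdx, Finset.sum_subtype_eq_sum_filter]
  refine Finset.sum_filter_of_ne fun j _ hj => ?_
  by_contra h
  exact hj (hf j (not_lt.1 h))

theorem hasSum_tail {f : ℕ → ℝ} (hf : ∀ j : ℕ, M.p ≤ j → f j = 0) (hs : Summable f) (k : ℕ) :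
    HasSum (fun j : CoordIdx M.p => if j ∈ M.headIdx k then 0 else f j) (∑' i, f (i + k)) := by
  have h1 : HasSum (fun i => if i < k then 0 else f i) (∑' i, f (i + k)) := by
    have h2 := ((summable_nat_add_iff k).2 hs).hasSum
    rw [← hasSum_nat_add_iff' k]
    have h3 : ∑ i ∈ Finset.range k, (if i < k then 0 else f i) = 0 :=
      Finset.sum_eq_zero fun i hi => if_pos (Finset.mem_range.1 hi)
    rw [h3, sub_zero]
    refine h2.congr_fun fun i => ?_
    simp
  have h2 := (hasSum_subtype_iff_of_support_subset (s := {j : ℕ | (j : ℕ∞) < M.p})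
    (f := fun i => if i < k then 0 else f i) (fun i hi => by
      by_contra h
      refine hi ?_
      simp [hf i (not_lt.1 h)])).2 h1
  refine h2.congr_fun fun j => ?_
  simp [mem_headIdx]

theorem coord_coe (j : CoordIdx M.p) : M.coord j = inner ℝ (M.v j) M.θ := by
  rw [coord, dif_pos j.2]

theorem coord_eq_zero {j : ℕ} (hj : M.p ≤ j) : M.coord j = 0 := by
  rw [coord, dif_neg (not_lt.2 hj)]

theorem eig_nonneg (j : ℕ) : 0 ≤ M.eig j := by
  rcases lt_or_ge (j : ℕ∞) M.p with h | h
  · exact (M.eig_pos j h).le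
  · exact (M.eig_zero j h).ge

theorem summable_coord_sq : Summable fun j => M.coord j ^ 2 := by
  have h1 : Summable fun j : CoordIdx M.p => M.coord j ^ 2 := by
    simp_rw [coord_coe]
    exact (M.hasSum_norm_sq M.θ).summable
  refine ((hasSum_subtype_iff_of_support_subset (s := {j : ℕ | (j : ℕ∞) < M.p})
    (f := fun j => M.coord j ^ 2) fun j hj => ?_).1 h1.hasSum).summable
  by_contra h
  refine hj ?_
  simp [M.coord_eq_zero (not_lt.1 h)]

theorem summable_eig_pow_mul_coord_sq (m : ℕ) : Summable fun j => M.eig j ^ m * M.coord j ^ 2 :=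
  (M.summable_coord_sq.mul_left (M.eig 0 ^ m)).of_nonneg_of_le
    (fun j => mul_nonneg (pow_nonneg (M.eig_nonneg j) _) (sq_nonneg _)) fun j => by
      have := M.eig_nonneg j
      gcongr
      exact M.eig_le_zero_idx j

theorem summable_eig_sq : Summable fun j => M.eig j ^ 2 :=
  (M.eig_summable.mul_left (M.eig 0)).of_nonneg_of_le (fun j => sq_nonneg _) fun j => by
    rw [sq]
    exact mul_le_mul_of_nonneg_right (M.eig_le_zero_idx j) (M.eig_nonneg j)

theorem hasSum_tailSum (k : ℕ) :
    HasSum (fun j : CoordIdx M.p => if j ∈ M.headIdx k then 0 else M.eig j) (M.tailSum k) :=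
  M.hasSum_tail M.eig_zero M.eig_summable k

theorem hasSum_tailSqSum (k : ℕ) :
    HasSum (fun j : CoordIdx M.p => if j ∈ M.headIdx k then 0 else M.eig j ^ 2)
      (M.tailSqSum k) :=
  M.hasSum_tail (f := fun j => M.eig j ^ 2) (fun j hj => by rw [M.eig_zero j hj]; simp)
    M.summable_eig_sq k

theorem hasSum_tailNormSq (k : ℕ) :
    HasSum (fun j : CoordIdx M.p => if j ∈ M.headIdx k then 0 else
      M.eig j * inner ℝ (M.v j) M.θ ^ 2) (M.tailNormSq k) := by
  have h := M.summable_eig_pow_mul_coord_sq 1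
  simp_rw [pow_one] at h
  simp_rw [← coord_coe]
  exact M.hasSum_tail (f := fun j => M.eig j * M.coord j ^ 2)
    (fun j hj => by rw [M.eig_zero j hj]; simp) h k

theorem tailCov_headIdx (k : ℕ) : M.tailCov (M.headIdx k) M.θ = M.tailNormSq k := by
  rw [tailCov, ← (M.hasSum_tailNormSq k).tsum_eq]
  exact tsum_congr fun j => by split_ifs <;> simp

theorem sum_headIdx_inner_sq_div (k : ℕ) :
    ∑ j ∈ M.headIdx k, inner ℝ (M.v j) M.θ ^ 2 / M.eig j = M.headNormSq k := by
  simp_rw [← coord_coe]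
  exact M.sum_headIdx (f := fun j => M.coord j ^ 2 / M.eig j)
    (fun j hj => by rw [M.eig_zero j hj]; simp) k

/-! ### The critical index -/

theorem le_effRank_critIndex {n : ℕ} {b : ℝ} (h : ∃ k, b * n ≤ M.effRank k) :
    b * n ≤ M.effRank (M.critIndex n b) := Nat.sInf_mem (s := {k | b * n ≤ M.effRank k}) h

variable {M}

theorem eig_pos_of_effRank_pos {k : ℕ} (h : 0 < M.effRank k) : 0 < M.eig k := by
  refine (M.eig_nonneg k).lt_of_ne fun h0 => ?_
  rw [effRank, ← h0, div_zero] at h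
  exact h.false

theorem eig_mul_effRank {k : ℕ} (h : 0 < M.effRank k) : M.eig k * M.effRank k = M.tailSum k := by
  rw [effRank, mul_div_cancel₀ _ (eig_pos_of_effRank_pos h).ne']

theorem tailSum_pos {k : ℕ} (h : 0 < M.effRank k) : 0 < M.tailSum k := by
  rw [← eig_mul_effRank h]
  exact mul_pos (eig_pos_of_effRank_pos h) h

/-- Each tail eigenvalue is at most the first one, which equals `tailSum k / effRank k`. -/
theorem eig_le_of_not_mem_headIdx {k n : ℕ} {b : ℝ} (hb : 0 < b) (hn : 0 < n)
    (h : b * n ≤ M.effRank k) (j : CoordIdx M.p) (hj : j ∉ M.headIdx k) :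
    M.eig j ≤ 1 / b * M.tailSum k / n := by
  have hn' : (0 : ℝ) < n := by exact_mod_cast hn
  have hr : 0 < M.effRank k := lt_of_lt_of_le (by positivity) h
  rw [mem_headIdx, not_lt] at hj
  refine (M.eig_antitone hj).trans ?_
  rw [← eig_mul_effRank hr, le_div_iff₀ hn', one_div, ← div_eq_inv_mul, le_div_iff₀ hb]
  nlinarith [eig_pos_of_effRank_pos hr]

/-- Eigenvalues above `τ = η * S / n` add up to at most the sum of squares divided by `τ`, hence to
at most `S / 4`. The other three quarters leave room for cutting down to a finite set. -/
theorem exists_finset_tail_half {k n : ℕ} (hn : 0 < n) (hS : 0 < M.tailSum k) {η : ℝ} (hη : 0 < η)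
    (h : n / M.effRank₂ k ≤ η / 4) :
    ∃ G : Finset (CoordIdx M.p),
      (∀ j ∈ G, (if j ∈ M.headIdx k then 0 else M.eig j) ≤ η * M.tailSum k / n) ∧
      M.tailSum k / 2 ≤ ∑ j ∈ G, if j ∈ M.headIdx k then 0 else M.eig j := by
  classical
  have hn' : (0 : ℝ) < n := by exact_mod_cast hn
  set S := M.tailSum k with hSdef
  set w : CoordIdx M.p → ℝ := fun j => if j ∈ M.headIdx k then 0 else M.eig j with hw
  have hw0 : ∀ j, 0 ≤ w j := M.tailEig_nonneg _
  have hsum : HasSum w S := M.hasSum_tailSum k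
  have hsq : HasSum (fun j => w j ^ 2) (M.tailSqSum k) :=
    (M.hasSum_tailSqSum k).congr_fun fun j => by rw [hw]; simp only; split_ifs <;> simp
  set τ := η * S / n with hτ
  have hτ0 : 0 < τ := by positivity
  set w' : CoordIdx M.p → ℝ := fun j => if w j ≤ τ then w j else 0 with hw'
  have hw's : Summable w' := hsum.summable.of_nonneg_of_le
    (fun j => by rw [hw']; simp only; split_ifs; exacts [hw0 j, le_rfl])
    (fun j => by rw [hw']; simp only; split_ifs; exacts [le_rfl, hw0 j])
  have hle : S - M.tailSqSum k / τ ≤ ∑' j, w' j := by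
    refine hasSum_le (fun j => ?_) (hsum.sub (hsq.div_const τ)) hw's.hasSum
    rw [hw']; simp only
    split_ifs with hj
    · have : 0 ≤ w j ^ 2 / τ := by positivity
      linarith
    · rw [sub_nonpos, le_div_iff₀ hτ0, sq]
      exact mul_le_mul_of_nonneg_left (not_le.1 hj).le (hw0 j)
  have hq : M.tailSqSum k / τ ≤ S / 4 := by
    rw [effRank₂, ← hSdef, div_div_eq_mul_div, div_le_iff₀ (by positivity)] at h
    rw [hτ, div_div_eq_mul_div, div_le_iff₀ (by positivity)]
    nlinarith
  obtain ⟨s, hs⟩ := ((hw's.hasSum : Tendsto _ _ _).eventually_const_le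
    (u := S / 2) (by linarith)).exists
  refine ⟨s.filter fun j => w j ≤ τ, fun j hj => (Finset.mem_filter.1 hj).2, ?_⟩
  rw [Finset.sum_filter]
  exact hs

/-! ### The lower bound for the squared norm on a well-conditioned sample -/

/-- The weight of the `j`-th coordinate in the lower bound for the squared norm. -/
def normWeight (M : LinearModel H σx) (n : ℕ) (S : ℝ) (j : ℕ) : ℝ :=
  (M.noiseVar / M.eig j + n * M.coord j ^ 2) * min (1 / (n : ℝ)) (n * M.eig j ^ 2 / S ^ 2)

theorem normWeight_nonneg (n : ℕ) (S : ℝ) (j : ℕ) : 0 ≤ M.normWeight n S j := by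
  have := M.eig_nonneg j
  have := M.noiseVar_pos
  unfold normWeight
  positivity

theorem normWeight_eq_zero (n : ℕ) (S : ℝ) {j : ℕ} (hj : M.p ≤ j) : M.normWeight n S j = 0 := by
  rw [normWeight, M.coord_eq_zero hj, M.eig_zero j hj]; simp

theorem summable_normWeight (n : ℕ) (S : ℝ) : Summable fun j => M.normWeight n S j := by
  have hσ := M.noiseVar_pos
  refine Summable.of_nonneg_of_le (normWeight_nonneg n S) (fun j => ?_)
    ((M.eig_summable.mul_left (n * M.noiseVar / S ^ 2)).add
      ((M.summable_eig_pow_mul_coord_sq 2).mul_left ((n : ℝ) ^ 2 / S ^ 2)))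
  have h0 := M.eig_nonneg j
  unfold normWeight
  calc _ ≤ (M.noiseVar / M.eig j + n * M.coord j ^ 2) * (n * M.eig j ^ 2 / S ^ 2) := by
        gcongr
        exact min_le_right _ _
    _ = n * M.noiseVar / S ^ 2 * (M.eig j ^ 2 / M.eig j) +
        (n : ℝ) ^ 2 / S ^ 2 * (M.eig j ^ 2 * M.coord j ^ 2) := by ring
    _ ≤ _ := by
        gcongr
        rw [sq, mul_self_div_self]

/-- Beyond `k` one has `b * n * λ_j ≤ S`, so the first entry of the minimum is at least `b ^ 2`
times the second. Up to `min 1 (b ^ 2)` the tail weights thus sum to the last two terms of the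
target, and head and tail can be treated alike. -/
theorem le_tsum_normWeight {k n : ℕ} {b : ℝ} (hb : 0 < b) (hn : 0 < n)
    (h : b * n ≤ M.effRank k) :
    min 1 (b ^ 2) * (∑ i ∈ Finset.range k, M.normWeight n (M.tailSum k) i +
      n * M.noiseVar / M.tailSum k +
      n ^ 2 * (∑' j : ℕ, M.coord (j + k) ^ 2 * M.eig (j + k) ^ 2) / M.tailSum k ^ 2) ≤
      ∑' j : CoordIdx M.p, M.normWeight n (M.tailSum k) j := by
  have hn' : (0 : ℝ) < n := by exact_mod_cast hn
  have hr : 0 < M.effRank k := lt_of_lt_of_le (by positivity) h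
  have hσ := M.noiseVar_pos
  have hS := tailSum_pos hr
  set S := M.tailSum k with hSdef
  have h0 := M.hasSum_tail (fun j hj => normWeight_eq_zero n S hj) (summable_normWeight n S) 0
  have h1 : ∑' j : CoordIdx M.p, M.normWeight n S j = ∑' j, M.normWeight n S j := by
    simp_rw [add_zero] at h0
    rw [← h0.tsum_eq]
    exact tsum_congr fun j => by simp [mem_headIdx]
  have hm0 : 0 ≤ min 1 (b ^ 2) := by positivity
  rw [h1, ← (summable_normWeight n S).sum_add_tsum_nat_add k, add_assoc, mul_add]
  have hsq : Summable fun j => M.coord (j + k) ^ 2 * M.eig (j + k) ^ 2 := by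
    refine (((summable_nat_add_iff k).2 (M.summable_eig_pow_mul_coord_sq 2))).congr fun j => ?_
    ring
  have hes : Summable fun j => M.eig (j + k) := (summable_nat_add_iff k).2 M.eig_summable
  refine add_le_add ?_ ?_
  · refine mul_le_of_le_one_left (Finset.sum_nonneg fun i _ => normWeight_nonneg n S i)
      (min_le_left _ _)
  · have h2 : n * M.noiseVar / S + n ^ 2 * (∑' j : ℕ, M.coord (j + k) ^ 2 * M.eig (j + k) ^ 2) /
        S ^ 2 = ∑' j, (n * M.noiseVar / S ^ 2 * M.eig (j + k) +
          (n : ℝ) ^ 2 / S ^ 2 * (M.coord (j + k) ^ 2 * M.eig (j + k) ^ 2)) := by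
      rw [(hes.mul_left _).tsum_add (hsq.mul_left _), tsum_mul_left, tsum_mul_left]
      change _ = n * M.noiseVar / S ^ 2 * M.tailSum k + _
      rw [← hSdef]
      field_simp
    rw [h2, ← tsum_mul_left]
    refine Summable.tsum_le_tsum (fun j => ?_) (((hes.mul_left _).add (hsq.mul_left _)).mul_left _)
      ((summable_nat_add_iff k).2 (summable_normWeight n S))
    have he0 := M.eig_nonneg (j + k)
    have heS : n * M.eig (j + k) * b ≤ S := by
      have := M.eig_antitone (Nat.le_add_left k j)
      rw [hSdef, ← eig_mul_effRank hr]
      calc n * M.eig (j + k) * b = M.eig (j + k) * (b * n) := by ring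
        _ ≤ M.eig k * M.effRank k := by
          have := M.eig_nonneg k
          gcongr
    have hmin : min 1 (b ^ 2) * (n * M.eig (j + k) ^ 2 / S ^ 2) ≤
        min (1 / (n : ℝ)) (n * M.eig (j + k) ^ 2 / S ^ 2) := by
      refine le_min ?_ (mul_le_of_le_one_left (by positivity) (min_le_left _ _))
      calc _ ≤ b ^ 2 * (n * M.eig (j + k) ^ 2 / S ^ 2) := by gcongr; exact min_le_right _ _
        _ = (n * M.eig (j + k) * b) ^ 2 / (S ^ 2 * n) := by field_simp
        _ ≤ S ^ 2 / (S ^ 2 * n) := by gcongr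
        _ = 1 / n := by field_simp
    unfold normWeight
    calc _ = (M.noiseVar * (M.eig (j + k) ^ 2 / M.eig (j + k) / M.eig (j + k)) *
              M.eig (j + k)) * (min 1 (b ^ 2) * (n / S ^ 2)) +
            n * M.coord (j + k) ^ 2 * (min 1 (b ^ 2) * (n * M.eig (j + k) ^ 2 / S ^ 2)) := by
          -- Beyond a finite dimension the eigenvalue is `0`, and with `x / 0 = 0` both sides
          -- vanish.
          rcases he0.eq_or_lt with h3 | h3
          · simp [← h3]
          · field_simp
      _ = (M.noiseVar / M.eig (j + k) + n * M.coord (j + k) ^ 2) *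
            (min 1 (b ^ 2) * (n * M.eig (j + k) ^ 2 / S ^ 2)) := by
          rcases he0.eq_or_lt with h3 | h3
          · simp [← h3]
          · field_simp
      _ ≤ _ := by gcongr

/-- The contribution of a well-conditioned coordinate to the squared norm. -/
theorem normWeight_le {n : ℕ} {F : Finset (CoordIdx M.p)} {X : Fin n → H} {S c₁ C₁ ρ a A : ℝ}
    (hT : M.TailBounds F X S c₁ C₁) {j : CoordIdx M.p}
    (hH : M.HeadBounds (insert j F) X a A) (hn : 0 < n) (hS : 0 < S) (hC₁ : 0 < C₁) (ha : 0 < a)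
    (hA : 0 < A) (hρ : 0 ≤ ρ) (hρS : ρ ≤ S)
    {Q : EuclideanSpace ℝ (Fin n) →ₗ[ℝ] EuclideanSpace ℝ (Fin n)}
    (hQ : ∀ u, regGram X ρ (Q u) = u) :
    min 1 (1 / A) * (a / (a + (C₁ + 1))) ^ 2 * M.normWeight n S j ≤
      inner ℝ (M.v j) M.θ ^ 2 * (M.eig j * inner ℝ (Q (M.col X j)) (M.col X j)) ^ 2 +
        M.noiseVar * (M.eig j * ‖Q (M.col X j)‖ ^ 2) := by
  have hn' : (0 : ℝ) < n := by exact_mod_cast hn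
  have hσ := M.noiseVar_pos
  have he := M.eig_coe_pos j
  have h1 := hT.shrinkage_ge hH hn hS hC₁ ha hρ hρS hQ
  have hcol := hH.norm_col_sq_le (Finset.mem_insert_self j F)
  set t := M.eig j * inner ℝ (Q (M.col X j)) (M.col X j) with ht
  set g := a / (a + (C₁ + 1)) with hg
  have hg0 : 0 < g := by positivity
  set μ := min (1 / (n : ℝ)) (n * (M.eig j : ℝ) ^ 2 / S ^ 2) with hμ
  have hμ0 : 0 ≤ μ := by positivity
  have ht2 : g ^ 2 * (n * μ) ≤ t ^ 2 := by
    have h2 : n * μ ≤ (min 1 (n * M.eig j / S)) ^ 2 := by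
      rcases min_cases 1 (n * M.eig j / S) with ⟨h3, -⟩ | ⟨h3, -⟩ <;> rw [h3]
      · calc n * μ ≤ n * (1 / n) := by gcongr; exact min_le_left _ _
          _ = 1 ^ 2 := by field_simp
      · calc n * μ ≤ n * (n * (M.eig j : ℝ) ^ 2 / S ^ 2) := by gcongr; exact min_le_right _ _
          _ = _ := by ring
    calc g ^ 2 * (n * μ) ≤ g ^ 2 * (min 1 (n * M.eig j / S)) ^ 2 := by gcongr
      _ = (g * min 1 (n * M.eig j / S)) ^ 2 := by ring
      _ ≤ t ^ 2 := by gcongr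
  -- For the noise part: as `‖col j‖ ^ 2 ≤ A * n`, a lower bound on the shrinkage factor forces one
  -- on `‖Q (col j)‖`.
  have hcs : t ^ 2 ≤ M.eig j * (A * n) * (M.eig j * ‖Q (M.col X j)‖ ^ 2) := by
    have h2 : inner ℝ (Q (M.col X j)) (M.col X j) ^ 2 ≤
        ‖Q (M.col X j)‖ ^ 2 * ‖M.col X j‖ ^ 2 := by
      rw [← mul_pow, ← sq_abs]
      gcongr
      exact abs_real_inner_le_norm _ _
    calc t ^ 2 = M.eig j ^ 2 * inner ℝ (Q (M.col X j)) (M.col X j) ^ 2 := by rw [ht]; ring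
      _ ≤ M.eig j ^ 2 * (‖Q (M.col X j)‖ ^ 2 * (A * n)) := by
          gcongr
          exact h2.trans (by gcongr)
      _ = _ := by ring
  have hnorm : 1 / A * g ^ 2 * (μ / M.eig j) ≤ M.eig j * ‖Q (M.col X j)‖ ^ 2 := by
    have h2 := ht2.trans hcs
    have : 1 / A * g ^ 2 * (μ / M.eig j) = g ^ 2 * (n * μ) / (M.eig j * (A * n)) := by field_simp
    rw [this, div_le_iff₀ (by positivity)]
    linarith
  unfold normWeight
  rw [coord_coe, ← hμ]
  set q := inner ℝ (M.v j) M.θ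
  calc _ = M.noiseVar * (min 1 (1 / A) * g ^ 2 * (μ / M.eig j)) +
        q ^ 2 * (min 1 (1 / A) * (g ^ 2 * (n * μ))) := by ring
    _ ≤ M.noiseVar * (1 / A * g ^ 2 * (μ / M.eig j)) + q ^ 2 * (1 * (g ^ 2 * (n * μ))) := by
        gcongr
        · exact min_le_right _ _
        · exact min_le_left _ _
    _ ≤ M.noiseVar * (M.eig j * ‖Q (M.col X j)‖ ^ 2) + q ^ 2 * t ^ 2 := by
        rw [one_mul]; gcongr
    _ = _ := by ring

end LinearModel

/-- If each of the events `B j` is unlikely, then at least half of a total weight is usually carried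
by indices whose event does not occur. -/
theorem measure_not_tsum_le_two_mul_tsum_indicator_compl_le {Ω : Type*} [MeasurableSpace Ω]
    {μ : Measure Ω} {ι : Type*} [Countable ι] {α : ι → ℝ≥0∞} (hα : ∑' j, α j ≠ ∞) {B : ι → Set Ω}
    {p : ℝ≥0∞} (hB : ∀ j, μ (B j) ≤ p) :
    μ {ω | ¬ (∑' j, α j ≤ 2 * ∑' j, (B j)ᶜ.indicator (fun _ => α j) ω)} ≤ 2 * p := by
  set s := ∑' j, α j with hs
  rcases eq_or_ne s 0 with h0 | h0
  · simp [h0]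
  have hs2 : s / 2 ≠ 0 := ENNReal.div_ne_zero.2 ⟨h0, by norm_num⟩
  have hs2' : s / 2 ≠ ∞ := ENNReal.div_ne_top hα (by norm_num)
  -- The weight lost, taken over measurable hulls because the events need not be measurable. Its
  -- mean is at most `s * p`, so by Markov's inequality it reaches `s / 2` with probability at most
  -- `2 * p`.
  set g : Ω → ℝ≥0∞ := fun ω => ∑' j, (toMeasurable μ (B j)).indicator (fun _ => α j) ω with hg
  have hmeas : ∀ j, Measurable ((toMeasurable μ (B j)).indicator fun _ : Ω => α j) := fun j =>
    measurable_const.indicator (measurableSet_toMeasurable _ _)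
  have hgm : Measurable g := Measurable.tsum hmeas
  have hgi : ∫⁻ ω, g ω ∂μ ≤ s * p := by
    rw [hg, lintegral_tsum fun j => (hmeas j).aemeasurable, hs, ← ENNReal.tsum_mul_right]
    refine ENNReal.tsum_le_tsum fun j => ?_
    rw [lintegral_indicator_const (measurableSet_toMeasurable _ _), measure_toMeasurable]
    gcongr
    exact hB j
  refine (measure_mono fun ω hω => ?_ : _ ≤ μ {ω | s / 2 ≤ g ω}).trans ?_
  · simp only [Set.mem_ofPred_eq, not_le] at hω ⊢
    by_contra! h
    have h1 : ∑' j, (B j)ᶜ.indicator (fun _ => α j) ω < s / 2 := by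
      rw [ENNReal.lt_div_iff_mul_lt (Or.inl (by norm_num)) (Or.inl (by norm_num)), mul_comm]
      exact hω
    have h2 : s ≤ ∑' j, (B j)ᶜ.indicator (fun _ => α j) ω + g ω := by
      rw [hg, hs]
      simp only
      rw [← ENNReal.tsum_add]
      refine ENNReal.tsum_le_tsum fun j => ?_
      by_cases hj : ω ∈ B j
      · rw [Set.indicator_of_mem (subset_toMeasurable μ _ hj)]
        exact le_add_self
      · rw [Set.indicator_of_mem (s := (B j)ᶜ) hj]
        exact le_self_add
    have h3 := ENNReal.add_lt_add h1 h
    rw [ENNReal.add_halves] at h3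
    exact h2.not_gt h3
  · refine (meas_ge_le_lintegral_div hgm.aemeasurable hs2 hs2').trans ?_
    rw [ENNReal.div_le_iff hs2 hs2']
    refine hgi.trans (le_of_eq ?_)
    rw [mul_comm 2 p, mul_assoc, ENNReal.mul_div_cancel (by norm_num) (by norm_num), mul_comm]

namespace LinearModel

variable {H : Type*} [NormedAddCommGroup H] [InnerProductSpace ℝ H] [MeasurableSpace H]
  {σx : ℝ≥0} (M : LinearModel H σx)

/-! ### Well-conditioned samples are likely -/

/-- The wide matrix bounds for the whitened array with the tail eigenvalues as weights: `b * n ≤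
r_k` limits the largest weight, and a small `n / R_k` provides the spread-out set `G`. -/
theorem exists_measure_not_tailBounds_le.{u} {σx : ℝ≥0} (hσx : 0 < σx) {b : ℝ} (hb : 0 < b) :
    ∃ C₁ > (0 : ℝ), ∃ η > (0 : ℝ), ∀ {H : Type u} [NormedAddCommGroup H] [InnerProductSpace ℝ H]
      [MeasurableSpace H] [BorelSpace H] (M : LinearModel H σx) {n k : ℕ}, 0 < n →
      b * n ≤ M.effRank k →
      n / M.effRank₂ k ≤ η →
      (Measure.pi fun _ : Fin n => M.D)
        {X | ¬ M.TailBounds (M.headIdx k) X (M.tailSum k) (1 / 16) C₁} ≤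
        ENNReal.ofReal (2 * Real.exp (-n)) := by
  have hc : 0 < σx ^ 2 := by positivity
  have hc' : (0 : ℝ) < (σx ^ 2 : ℝ≥0) := hc
  set K : ℝ := 6 * (σx ^ 2 : ℝ≥0) * (3 * (1 / b) + 1) with hK
  have hK0 : 0 < K := by positivity
  obtain ⟨η, hη, hlow⟩ := IsStdSubgaussian.exists_wide_matrix_lower (σx ^ 2) hc hK0
  refine ⟨4 * K, by positivity, η / 4, by positivity, fun {H} _ _ _ _ M {n k} hn hr hR => ?_⟩
  have := M.D_prob
  have hn' : (0 : ℝ) < n := by exact_mod_cast hn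
  have hS : 0 < M.tailSum k := tailSum_pos (lt_of_lt_of_le (by positivity) hr)
  have hζ := M.isStdSubgaussian_array n
  set w : CoordIdx M.p → ℝ := fun j => if j ∈ M.headIdx k then 0 else M.eig j with hw
  have hw0 : ∀ j, 0 ≤ w j := M.tailEig_nonneg _
  have hsum : HasSum w (M.tailSum k) := M.hasSum_tailSum k
  set L : (Fin n → H) → EuclideanSpace ℝ (Fin n) →ₗ[ℝ] H := fun X =>
    (M.tailProj (M.headIdx k)).comp (combMap X) with hL
  have hLs : ∀ X x, HasSum (fun j => w j * (∑ l, x l * M.feature j (X l)) ^ 2) (‖L X x‖ ^ 2) := by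
    intro X x
    refine (M.hasSum_tailProj_combMap (M.headIdx k) X x).congr_fun fun j => ?_
    rw [EuclideanSpace.real_inner_eq_sum]
    simp_rw [mul_comm (x _)]
    rfl
  have hup := hζ.wide_matrix_upper hc hw0 (W := 1 / b * M.tailSum k / n) (S := M.tailSum k)
    (β := 1 / b) (by positivity) (fun j => by
      rw [hw]; simp only
      split_ifs with hj
      · positivity
      · exact eig_le_of_not_mem_headIdx hb hn hr j hj)
    (fun s => sum_le_hasSum s (fun j _ => hw0 j) hsum) (by positivity)
    (by rw [div_mul_cancel₀ _ hn'.ne']) hS.le L hLs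
  obtain ⟨G, hG1, hG2⟩ := exists_finset_tail_half (M := M) hn hS hη hR
  have hlo := hlow hn hζ hw0 hS G hG1 hG2 L hLs
  rw [← hK] at hup
  have hsub : {X | ¬ M.TailBounds (M.headIdx k) X (M.tailSum k) (1 / 16) (4 * K)} ⊆
      {X | ¬ ∀ x, ‖L X x‖ ≤ 2 * √(K * M.tailSum k) * ‖x‖} ∪
      {X | (∀ x, ‖L X x‖ ≤ 2 * √(K * M.tailSum k) * ‖x‖) ∧
        ¬ ∀ x, √(M.tailSum k) / 4 * ‖x‖ ≤ ‖L X x‖} := by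
    intro X hX
    by_contra h
    simp only [Set.mem_union, Set.mem_ofPred_eq, not_or, not_not, not_and] at h hX
    refine hX ⟨fun u => ?_, fun u => ?_⟩
    · have h1 := pow_le_pow_left₀ (by positivity) (h.2 h.1 u) 2
      rw [mul_pow, div_pow, Real.sq_sqrt hS.le] at h1
      refine le_trans (le_of_eq ?_) h1
      ring
    · have h1 := pow_le_pow_left₀ (norm_nonneg _) (h.1 u) 2
      rw [mul_pow, mul_pow, Real.sq_sqrt (by positivity)] at h1
      refine h1.trans (le_of_eq ?_)
      ring
  refine (measure_mono hsub).trans ((measure_union_le _ _).trans ((add_le_add hup hlo).trans ?_))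
  rw [← ENNReal.ofReal_add (Real.exp_pos _).le (Real.exp_pos _).le, two_mul]

/-- The constants are uniform in `F`, so that they serve both the head and the head enlarged by any
one index. -/
theorem exists_measure_not_headBounds_le.{u} {σx : ℝ≥0} (hσx : 0 < σx) :
    ∃ a > (0 : ℝ), ∃ A > (0 : ℝ), ∃ m > (0 : ℝ), ∃ κ > (0 : ℝ), ∀ {H : Type u}
      [NormedAddCommGroup H] [InnerProductSpace ℝ H] [MeasurableSpace H] [BorelSpace H]
      (M : LinearModel H σx) {n : ℕ} (F : Finset (CoordIdx M.p)), 0 < n → (F.card : ℝ) ≤ m * n →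
      (Measure.pi fun _ : Fin n => M.D) {X | ¬ M.HeadBounds F X a A} ≤
        ENNReal.ofReal (2 * Real.exp (-(κ * n))) := by
  obtain ⟨a, ha, A, hA, m, hm, κ, hκ, h⟩ :=
    IsStdSubgaussian.exists_tall_matrix_bounds (σx ^ 2) (by positivity)
  refine ⟨a, ha, A, hA, m, hm, κ, hκ, fun {H} _ _ _ _ M {n} F hn hF => ?_⟩
  have := M.D_prob
  have hζ := (M.isStdSubgaussian_array n).precomp
    (g := Prod.map (id : Fin n → Fin n) (Subtype.val : F → CoordIdx M.p))
    (Function.injective_id.prodMap Subtype.val_injective)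
  refine le_trans (measure_mono fun X hX => ?_) (h hn hζ (by simpa using hF) (M.headMap F)
    fun X x l => M.headMap_apply_apply ..)
  intro h'
  exact hX ⟨fun x => (h' x).1, fun x => (h' x).2⟩

/-- Used with the tail weights `λ_j ^ 2` for the noise and `λ_j * θ_j ^ 2` for the signal. The
domination by `eig` makes the series converge for every sample. -/
theorem measure_not_tsum_mul_norm_col_sq_le [BorelSpace H] (hσx : 0 < σx) (n : ℕ)
    {w : CoordIdx M.p → ℝ}
    (hw : ∀ j, 0 ≤ w j) {C : ℝ} (hwC : ∀ j, w j ≤ C * M.eig j) {V : ℝ} (hV : HasSum w V) :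
    (Measure.pi fun _ : Fin n => M.D)
      {X | ¬ ∑' j, w j * ‖M.col X j‖ ^ 2 ≤ 12 * (σx ^ 2 : ℝ≥0) * n * V} ≤
      ENNReal.ofReal (Real.exp (-n)) := by
  have := M.D_prob
  refine (M.isStdSubgaussian_array n).weighted_array_upper (by positivity) hw hV fun X => ?_
  refine (summable_mul_norm_col_sq X hw hwC).hasSum.congr_fun fun j => ?_
  rw [norm_col_sq]

variable {M}

/-! ### Bounds on a well-conditioned sample -/

/-- All powers of `S` and `n` cancel into the four quantities of the target; `C₃` is the sum of
their coefficients and so dominates each. -/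
theorem stdRisk_le_of_bounds [CompleteSpace H] [BorelSpace H] {b : ℝ} (hb : 0 < b) {n k : ℕ}
    {X : Fin n → H} {c₁ C₁ a A c lam : ℝ} (hn : 0 < n) (hr : b * n ≤ M.effRank k)
    (hX : M.NoiseRegular X)
    (hT : M.TailBounds (M.headIdx k) X (M.tailSum k) c₁ C₁) (hH : M.HeadBounds (M.headIdx k) X a A)
    (hV₄ : ∑' j : CoordIdx M.p, (if j ∈ M.headIdx k then 0 else M.eig j ^ 2) * ‖M.col X j‖ ^ 2 ≤
      12 * c * n * M.tailSqSum k)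
    (hV₅ : ∑' j : CoordIdx M.p, (if j ∈ M.headIdx k then 0 else
      M.eig j * inner ℝ (M.v j) M.θ ^ 2) * ‖M.col X j‖ ^ 2 ≤ 12 * c * n * M.tailNormSq k)
    (hc₁ : 0 < c₁) (hC₁ : 0 < C₁) (ha : 0 < a) (hA : 0 < A) (hc : 0 < c) (hlam : 0 ≤ lam)
    (hlamS : n * lam ≤ M.tailSum k) {B C₃ : ℝ}
    (hB : B = 3 * (1 + 6 * (1 / b) * C₁ * A / c₁ ^ 2) * (C₁ + 1) ^ 2 / a ^ 2)
    (hC₃ : C₃ = 2 + 12 * c * (B * A / c₁ ^ 2 + 6 * (1 / b) * C₁ / c₁ ^ 2) + B + B * A / c₁ ^ 2 +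
      72 * c / c₁ ^ 2) :
    M.stdRisk lam X ≤ ENNReal.ofReal (C₃ * (M.tailNormSq k +
      (M.tailSum k / n) ^ 2 * M.headNormSq k +
      M.noiseVar * (k / n + n / M.effRank₂ k))) := by
  have hn' : (0 : ℝ) < n := by exact_mod_cast hn
  have hσ := M.noiseVar_pos
  have hS : 0 < M.tailSum k := tailSum_pos (lt_of_lt_of_le (by positivity) hr)
  have hB0 : 0 < B := by rw [hB]; positivity
  refine (stdRisk_le hT hH hX hn hS hc₁ hC₁ ha hA (β := 1 / b) (by positivity)
    (eig_le_of_not_mem_headIdx hb hn hr) hlam hlamS hV₄ hV₅ rfl hB).trans ?_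
  apply ENNReal.ofReal_le_ofReal
  rw [tailCov_headIdx, sum_headIdx_inner_sq_div]
  have h1 : 0 ≤ M.tailNormSq k := by rw [← tailCov_headIdx]; exact M.tailCov_nonneg _ _
  have h2 : 0 ≤ M.headNormSq k := Finset.sum_nonneg fun i _ =>
    div_nonneg (sq_nonneg _) (M.eig_nonneg i)
  have hq0 : 0 ≤ M.tailSqSum k := tsum_nonneg fun _ => sq_nonneg _
  have h3 : n / M.effRank₂ k = n * M.tailSqSum k / M.tailSum k ^ 2 := by
    rw [effRank₂, div_div_eq_mul_div]
  have h4 : 0 ≤ n / M.effRank₂ k := by rw [h3]; positivity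
  have hcard : ((M.headIdx k).card : ℝ) ≤ k := by exact_mod_cast M.card_headIdx_le k
  have e1 : B * (M.tailSum k / n) ^ 2 * (M.noiseVar * ((M.headIdx k).card *
      (A * n / (c₁ * M.tailSum k) ^ 2))) = B * A / c₁ ^ 2 * (M.noiseVar * ((M.headIdx k).card / n)) := by
    field_simp
  have e2 : 6 * (M.noiseVar * (12 * c * n * M.tailSqSum k / (c₁ * M.tailSum k) ^ 2)) =
      72 * c / c₁ ^ 2 * (M.noiseVar * (n / M.effRank₂ k)) := by
    rw [h3]; field_simp; ring
  have e3 : (B * A / c₁ ^ 2 + 6 * (1 / b) * C₁ / c₁ ^ 2) / n * (12 * c * n * M.tailNormSq k) =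
      12 * c * (B * A / c₁ ^ 2 + 6 * (1 / b) * C₁ / c₁ ^ 2) * M.tailNormSq k := by
    field_simp
  have h5 : B * A / c₁ ^ 2 * (M.noiseVar * ((M.headIdx k).card / n)) ≤
      B * A / c₁ ^ 2 * (M.noiseVar * (k / n)) := by gcongr
  rw [e1, e2, e3]
  have h6 : 0 ≤ (M.tailSum k / n) ^ 2 * M.headNormSq k := by positivity
  have h7 : 0 ≤ M.noiseVar * (k / n) := by positivity
  have h8 : 0 ≤ M.noiseVar * (n / M.effRank₂ k) := by positivity
  set D := 12 * c * (B * A / c₁ ^ 2 + 6 * (1 / b) * C₁ / c₁ ^ 2) with hD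
  have hD0 : 0 ≤ D := by positivity
  have hBA : 0 ≤ B * A / c₁ ^ 2 := by positivity
  have hcc : 0 ≤ 72 * c / c₁ ^ 2 := by positivity
  set E := B * A / c₁ ^ 2
  set G := 72 * c / c₁ ^ 2
  set T := M.tailNormSq k
  set U := (M.tailSum k / n) ^ 2 * M.headNormSq k with hU
  set P := M.noiseVar * (k / n) with hP
  set R := M.noiseVar * (n / M.effRank₂ k) with hR
  have hbU : B * (M.tailSum k / n) ^ 2 * M.headNormSq k = B * U := by rw [hU]; ring
  rw [mul_add M.noiseVar, ← hP, ← hR, hbU, hC₃]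
  have : 0 ≤ (B + E + G) * T + (2 + D + E + G) * U + (2 + D + B + G) * P + (2 + D + B + E) * R := by
    positivity
  linarith

/-- Each index with a well-conditioned enlarged head contributes a fixed fraction of its weight. In
`C₄`, the factor `1 / 2` pays for the other indices and `min 1 (b ^ 2)` for the comparison of the
weights with the target. -/
theorem le_normSqMean_of_bounds [CompleteSpace H] {b : ℝ} (hb : 0 < b) {n k : ℕ}
    {X : Fin n → H} {c₁ C₁ a A lam : ℝ} (hn : 0 < n) (hr : b * n ≤ M.effRank k)
    (hX : M.NoiseRegular X) (hT : M.TailBounds (M.headIdx k) X (M.tailSum k) c₁ C₁)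
    (hw : ∑' j : CoordIdx M.p, ENNReal.ofReal (M.normWeight n (M.tailSum k) j) ≤
      2 * ∑' j : CoordIdx M.p, {X | ¬ M.HeadBounds (insert j (M.headIdx k)) X a A}ᶜ.indicator
        (fun _ => ENNReal.ofReal (M.normWeight n (M.tailSum k) j)) X)
    (hc₁ : 0 < c₁) (hC₁ : 0 < C₁) (ha : 0 < a) (hA : 0 < A) (hlam : 0 ≤ lam)
    (hlamS : n * lam ≤ M.tailSum k) {C₄ : ℝ}
    (hC₄ : C₄ = min 1 (1 / A) * (a / (a + (C₁ + 1))) ^ 2 / 2 * min 1 (b ^ 2)) :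
    ENNReal.ofReal (C₄ * (∑ i ∈ Finset.range k, M.normWeight n (M.tailSum k) i +
      n * M.noiseVar / M.tailSum k +
      n ^ 2 * (∑' j : ℕ, M.coord (j + k) ^ 2 * M.eig (j + k) ^ 2) / M.tailSum k ^ 2)) ≤
      M.normSqMean lam X := by
  have hn' : (0 : ℝ) < n := by exact_mod_cast hn
  have hS : 0 < M.tailSum k := tailSum_pos (lt_of_lt_of_le (by positivity) hr)
  obtain ⟨Q, hQ1, hQ2, hQs⟩ := hT.exists_full_inverse (ρ := n * lam) hS hc₁ (by positivity)
  set g := min 1 (1 / A) * (a / (a + (C₁ + 1))) ^ 2 with hg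
  have hg0 : 0 < g := by positivity
  set α : CoordIdx M.p → ℝ := fun j => M.normWeight n (M.tailSum k) j with hα
  have hα0 : ∀ j, 0 ≤ α j := fun j => normWeight_nonneg _ _ _
  have hsum : Summable α := (summable_normWeight (M := M) n (M.tailSum k)).comp_injective
    Subtype.val_injective
  have h1 := le_tsum_normWeight hb hn hr
  calc _ ≤ ENNReal.ofReal (g / 2 * ∑' j, α j) := by
        apply ENNReal.ofReal_le_ofReal
        rw [hC₄, mul_assoc]
        gcongr
    _ = ENNReal.ofReal (g / 2) * ∑' j, ENNReal.ofReal (α j) := by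
        rw [ENNReal.ofReal_mul (by positivity), ENNReal.ofReal_tsum_of_nonneg hα0 hsum]
    _ ≤ ENNReal.ofReal (g / 2) * (2 * ∑' j : CoordIdx M.p,
          {X | ¬ M.HeadBounds (insert j (M.headIdx k)) X a A}ᶜ.indicator
            (fun _ => ENNReal.ofReal (α j)) X) := by gcongr
    _ = ∑' j : CoordIdx M.p, ENNReal.ofReal g *
          {X | ¬ M.HeadBounds (insert j (M.headIdx k)) X a A}ᶜ.indicator
            (fun _ => ENNReal.ofReal (α j)) X := by
        rw [ENNReal.tsum_mul_left, ← mul_assoc]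
        congr 1
        rw [← ENNReal.ofReal_ofNat 2, ← ENNReal.ofReal_mul (by positivity)]
        congr 1; ring
    _ ≤ _ := by
        refine le_trans (ENNReal.tsum_le_tsum fun j => ?_) (le_normSqMean hX hQ2 hQs)
        by_cases hj : M.HeadBounds (insert j (M.headIdx k)) X a A
        · rw [Set.indicator_of_mem (by simpa using hj), ← ENNReal.ofReal_mul hg0.le]
          exact ENNReal.ofReal_le_ofReal
            (normWeight_le hT hj hn hS hC₁ ha hA (by positivity) hlamS hQ1)
        · rw [Set.indicator_of_notMem (by simpa using hj), mul_zero]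
          exact zero_le

end LinearModel

/-- The complement of an unlikely set is likely, measurable or not. -/
theorem ofReal_one_sub_le_of_measure_compl_le {Ω : Type*} [MeasurableSpace Ω] {μ : Measure Ω}
    [IsProbabilityMeasure μ] {s : Set Ω} {δ : ℝ} (hδ : 0 ≤ δ) (h : μ sᶜ ≤ ENNReal.ofReal δ) :
    ENNReal.ofReal (1 - δ) ≤ μ s := by
  rw [ENNReal.ofReal_sub _ hδ, ENNReal.ofReal_one, tsub_le_iff_right]
  calc (1 : ℝ≥0∞) = μ (s ∪ sᶜ) := by rw [Set.union_compl_self, measure_univ]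
    _ ≤ μ s + μ sᶜ := measure_union_le _ _
    _ ≤ _ := by gcongr

/-! ### Union of the exceptional events -/

namespace LinearModel

/-- The two bounds at a fixed sample size. -/
theorem exists_measure_not_bounds_le.{u} {σx : ℝ≥0} (hσx : 0 < σx) {b : ℝ} (hb : 0 < b) :
    ∃ C₃ > (0 : ℝ), ∃ C₄ > (0 : ℝ), ∃ m > (0 : ℝ), ∃ η > (0 : ℝ), ∃ κ > (0 : ℝ),
      ∀ {H : Type u} [NormedAddCommGroup H] [InnerProductSpace ℝ H] [CompleteSpace H]
        [MeasurableSpace H] [BorelSpace H] (M : LinearModel H σx) {n k : ℕ}, 0 < n →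
        b * n ≤ M.effRank k → n / M.effRank₂ k ≤ η → (k : ℝ) + 1 ≤ m * n →
        (Measure.pi fun _ : Fin n => M.D) {X | ∀ lam : ℝ, 0 ≤ lam → n * lam ≤ M.tailSum k →
          M.stdRisk lam X ≤ ENNReal.ofReal (C₃ * (M.tailNormSq k +
            (M.tailSum k / n) ^ 2 * M.headNormSq k +
            M.noiseVar * (k / n + n / M.effRank₂ k))) ∧
          ENNReal.ofReal (C₄ * (∑ i ∈ Finset.range k, M.normWeight n (M.tailSum k) i +
            n * M.noiseVar / M.tailSum k +
            n ^ 2 * (∑' j : ℕ, M.coord (j + k) ^ 2 * M.eig (j + k) ^ 2) / M.tailSum k ^ 2)) ≤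
            M.normSqMean lam X}ᶜ ≤ ENNReal.ofReal (10 * Real.exp (-(κ * n))) := by
  obtain ⟨C₁, hC₁, η, hη, htail⟩ := exists_measure_not_tailBounds_le.{u} hσx hb
  obtain ⟨a, ha, A, hA, m, hm, κ, hκ, hhead⟩ := exists_measure_not_headBounds_le.{u} hσx
  have hc : (0 : ℝ) < (σx ^ 2 : ℝ≥0) := by positivity
  set c : ℝ := ((σx ^ 2 : ℝ≥0) : ℝ)
  set c₁ : ℝ := 1 / 16 with hc₁def
  have hc₁ : 0 < c₁ := by norm_num [hc₁def]
  set B := 3 * (1 + 6 * (1 / b) * C₁ * A / c₁ ^ 2) * (C₁ + 1) ^ 2 / a ^ 2 with hB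
  have hB0 : 0 < B := by positivity
  set C₃ := 2 + 12 * c * (B * A / c₁ ^ 2 + 6 * (1 / b) * C₁ / c₁ ^ 2) + B + B * A / c₁ ^ 2 +
      72 * c / c₁ ^ 2 with hC₃
  set C₄ := min 1 (1 / A) * (a / (a + (C₁ + 1))) ^ 2 / 2 * min 1 (b ^ 2) with hC₄
  refine ⟨C₃, by positivity, C₄, by positivity, m, hm, η, hη, min 1 κ, by positivity,
    fun {H} _ _ _ _ _ M {n k} hn hr hR hk => ?_⟩
  have := M.D_prob
  have hn' : (0 : ℝ) < n := by exact_mod_cast hn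
  set μ := Measure.pi fun _ : Fin n => M.D with hμ
  set F := M.headIdx k with hF
  set S := M.tailSum k with hS
  have hFk : (F.card : ℝ) ≤ k := by exact_mod_cast M.card_headIdx_le k
  set p : ℝ := Real.exp (-(min 1 κ * n)) with hp
  have hp0 : 0 < p := Real.exp_pos _
  have hp1 : Real.exp (-n) ≤ p := by
    apply Real.exp_le_exp.2
    nlinarith [min_le_left 1 κ]
  have hp2 : Real.exp (-(κ * n)) ≤ p := by
    apply Real.exp_le_exp.2
    nlinarith [min_le_right 1 κ]
  have hE₁ : μ {X | ¬ M.NoiseRegular X} = 0 := M.ae_noiseRegular n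
  have hE₂ : μ {X | ¬ M.TailBounds F X S c₁ C₁} ≤ ENNReal.ofReal (2 * p) :=
    (htail M hn hr hR).trans (ENNReal.ofReal_le_ofReal (by linarith))
  have hE₃ : μ {X | ¬ M.HeadBounds F X a A} ≤ ENNReal.ofReal (2 * p) :=
    (hhead M F hn (by linarith)).trans (ENNReal.ofReal_le_ofReal (by linarith))
  have hE₄ : μ {X | ¬ ∑' j : CoordIdx M.p, (if j ∈ F then 0 else M.eig j ^ 2) * ‖M.col X j‖ ^ 2 ≤
      12 * c * n * M.tailSqSum k} ≤ ENNReal.ofReal p := by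
    refine (M.measure_not_tsum_mul_norm_col_sq_le hσx n (fun j => by split_ifs <;> positivity)
      (C := M.eig 0) (fun j => ?_) (M.hasSum_tailSqSum k)).trans (ENNReal.ofReal_le_ofReal hp1)
    have h1 := M.eig_nonneg j
    have h2 := M.eig_le_zero_idx j
    split_ifs
    · exact mul_nonneg (h1.trans h2) h1
    · rw [sq]; gcongr
  have hE₅ : μ {X | ¬ ∑' j : CoordIdx M.p, (if j ∈ F then 0 else
      M.eig j * inner ℝ (M.v j) M.θ ^ 2) * ‖M.col X j‖ ^ 2 ≤ 12 * c * n * M.tailNormSq k} ≤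
      ENNReal.ofReal p := by
    refine (M.measure_not_tsum_mul_norm_col_sq_le hσx n (fun j => ?_)
      (C := ‖M.θ‖ ^ 2) (fun j => ?_) (M.hasSum_tailNormSq k)).trans (ENNReal.ofReal_le_ofReal hp1)
    · have := M.eig_nonneg j
      split_ifs <;> positivity
    · have := M.eig_nonneg j
      split_ifs
      · positivity
      · rw [mul_comm]
        exact mul_le_mul_of_nonneg_right (inner_v_sq_le _ _) this
  -- A union bound over the possibly infinitely many `j` is not available; the Markov argument costs
  -- only twice the probability of a single event.
  have hE₆ : μ {X | ¬ (∑' j : CoordIdx M.p, ENNReal.ofReal (M.normWeight n S j) ≤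
      2 * ∑' j : CoordIdx M.p, {X | ¬ M.HeadBounds (insert j F) X a A}ᶜ.indicator
        (fun _ => ENNReal.ofReal (M.normWeight n S j)) X)} ≤ ENNReal.ofReal (4 * p) := by
    have hsum : Summable fun j : CoordIdx M.p => M.normWeight n S j :=
      (summable_normWeight (M := M) n S).comp_injective Subtype.val_injective
    refine (measure_not_tsum_le_two_mul_tsum_indicator_compl_le
      (p := ENNReal.ofReal (2 * p)) ?_ fun j => ?_).trans (le_of_eq ?_)
    · rw [← ENNReal.ofReal_tsum_of_nonneg (fun j : CoordIdx M.p => normWeight_nonneg n S j) hsum]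
      exact ENNReal.ofReal_ne_top
    · refine (hhead M (insert j F) hn ?_).trans (ENNReal.ofReal_le_ofReal (by linarith))
      -- The inserted index is the reason for `k + 1` in the hypothesis.
      have h1 : ((insert j F).card : ℝ) ≤ F.card + 1 := by exact_mod_cast Finset.card_insert_le j F
      linarith
    · rw [← ENNReal.ofReal_ofNat 2, ← ENNReal.ofReal_mul (by positivity)]
      congr 1; ring
  refine (measure_mono fun X hX => ?_ : _ ≤ μ (({X | ¬ M.NoiseRegular X} ∪
    {X | ¬ M.TailBounds F X S c₁ C₁}) ∪ ({X | ¬ M.HeadBounds F X a A} ∪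
    {X | ¬ ∑' j : CoordIdx M.p, (if j ∈ F then 0 else M.eig j ^ 2) * ‖M.col X j‖ ^ 2 ≤
      12 * c * n * M.tailSqSum k}) ∪ ({X | ¬ ∑' j : CoordIdx M.p, (if j ∈ F then 0 else
      M.eig j * inner ℝ (M.v j) M.θ ^ 2) * ‖M.col X j‖ ^ 2 ≤ 12 * c * n * M.tailNormSq k} ∪
    {X | ¬ (∑' j : CoordIdx M.p, ENNReal.ofReal (M.normWeight n S j) ≤
      2 * ∑' j : CoordIdx M.p, {X | ¬ M.HeadBounds (insert j F) X a A}ᶜ.indicator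
        (fun _ => ENNReal.ofReal (M.normWeight n S j)) X)}))).trans ?_
  · by_contra h
    simp only [Set.mem_union, Set.mem_ofPred_eq, not_or, not_not] at h
    obtain ⟨⟨⟨h1, h2⟩, h3, h4⟩, h5, h6⟩ := h
    exact hX fun lam hlam hlamS =>
      ⟨stdRisk_le_of_bounds hb hn hr h1 h2 h3 h4 h5 hc₁ hC₁ ha hA hc hlam hlamS hB hC₃,
        le_normSqMean_of_bounds hb hn hr h1 h2 h6 hc₁ hC₁ ha hA hlam hlamS hC₄⟩
  · refine (measure_union_le _ _).trans ((add_le_add ((measure_union_le _ _).trans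
      (add_le_add ((measure_union_le _ _).trans (add_le_add hE₁.le hE₂))
        ((measure_union_le _ _).trans (add_le_add hE₃ hE₄))))
      ((measure_union_le _ _).trans (add_le_add hE₅ hE₆))).trans (le_of_eq ?_))
    rw [zero_add, ← ENNReal.ofReal_add (by positivity) (by positivity),
      ← ENNReal.ofReal_add (by positivity) (by positivity),
      ← ENNReal.ofReal_add (by positivity) (by positivity),
      ← ENNReal.ofReal_add (by positivity) (by positivity)]
    congr 1; ring

end LinearModel

end

/-! ### The asymptotic statement -/

theorem corollary7 (b : ℝ) (hb : 0 < b) (σx : ℝ≥0) (hσx : 0 < σx) :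
    ∃ C₃ : ℝ, 0 < C₃ ∧ ∃ C₄ : ℝ, 0 < C₄ ∧ ∃ c : ℝ, 1 < c ∧
      ∀ (H : ℕ → Type*) [∀ n, NormedAddCommGroup (H n)] [∀ n, InnerProductSpace ℝ (H n)]
        [∀ n, CompleteSpace (H n)] [∀ n, MeasurableSpace (H n)] [∀ n, BorelSpace (H n)]
        (M : ∀ n, LinearModel (H n) σx), BenignOverfitting M b →
        ∀ᶠ n : ℕ in atTop, ∀ k : ℕ, k = (M n).critIndex n b →
          ∀ δ : ℝ, 0 < δ → δ < 1 → Real.log (1 / δ) < n / c →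
          ∀ lam : ℝ, 0 ≤ lam → lam ≤ (M n).eig k * (M n).effRank k / n →
            ENNReal.ofReal (1 - δ) ≤ (Measure.pi fun _ : Fin n => (M n).D)
              {X : Fin n → H n |
                (M n).stdRisk lam X ≤ ENNReal.ofReal (C₃ *
                  ((M n).tailNormSq k
                    + ((M n).eig k * (M n).effRank k / n) ^ 2 * (M n).headNormSq k
                    + (M n).noiseVar * (k / n + n / (M n).effRank₂ k))) ∧
                ENNReal.ofReal (C₄ *
                  (∑ i ∈ Finset.range k, ((M n).noiseVar / (M n).eig i + n * (M n).coord i ^ 2) *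
                      min (1 / (n : ℝ))
                        (n * (M n).eig i ^ 2 / ((M n).effRank k ^ 2 * (M n).eig k ^ 2))
                    + n * (M n).noiseVar / ((M n).effRank k * (M n).eig k)
                    + n ^ 2 * (∑' j : ℕ, (M n).coord (j + k) ^ 2 * (M n).eig (j + k) ^ 2) /
                        ((M n).eig k ^ 2 * (M n).effRank k ^ 2))) ≤
                  (M n).normSqMean lam X} := by
  obtain ⟨C₃, hC₃, C₄, hC₄, m, hm, η, hη, κ, hκ, hmain⟩ :=
    LinearModel.exists_measure_not_bounds_le hσx hb
  -- The entry `2 / κ` lets `log (1 / δ)` use at most half of the exponent `κ * n`, the other half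
  -- being kept for the factor `10`; the entry `2` ensures `c > 1`.
  refine ⟨C₃, hC₃, C₄, hC₄, max 2 (2 / κ), lt_of_lt_of_le one_lt_two (le_max_left _ _),
    fun H _ _ _ _ _ M hM => ?_⟩
  set c := max 2 (2 / κ) with hc
  have hc2 : 2 / κ ≤ c := le_max_right _ _
  have hc0 : 0 < c := lt_of_lt_of_le two_pos (le_max_left _ _)
  have hcκ : 1 / c ≤ κ / 2 := by
    rw [div_le_iff₀ hκ] at hc2
    rw [div_le_div_iff₀ hc0 two_pos]
    linarith
  have hlarge : ∀ r : ℝ, ∀ᶠ n : ℕ in atTop, r ≤ n := fun r =>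
    tendsto_natCast_atTop_atTop.eventually_ge_atTop r
  -- For large `n`, half of `m * n` has room for `k` and the other half for the extra index, while
  -- `n ≥ 2 * log 10 / κ` absorbs the factor `10`.
  filter_upwards [hM.critIndex_finite, hM.index.eventually_le_const (half_pos hm),
    hM.rank.eventually_le_const hη, hlarge 1, hlarge (2 / m), hlarge (2 * Real.log 10 / κ)]
    with n hfin hidx hrank hn1 hnm hnκ k hk δ hδ0 _ hδ lam hlam0 hlam
  subst hk
  have hn' : (0 : ℝ) < n := lt_of_lt_of_le one_pos hn1
  have hn : 0 < n := by exact_mod_cast hn'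
  have hr := (M n).le_effRank_critIndex hfin
  generalize (M n).critIndex n b = k at *
  have hr0 : 0 < (M n).effRank k := lt_of_lt_of_le (by positivity) hr
  have hS := LinearModel.eig_mul_effRank hr0
  have := (M n).D_prob
  have hk1 : (k : ℝ) + 1 ≤ m * n := by
    rw [div_le_iff₀ hn'] at hidx
    rw [div_le_iff₀ hm] at hnm
    linarith
  have hsmall : 10 * Real.exp (-(κ * n)) ≤ δ := by
    rw [div_le_iff₀ hκ] at hnκ
    rw [one_div, Real.log_inv] at hδ
    rw [← Real.exp_log (by norm_num : (0 : ℝ) < 10), ← Real.exp_add, ← Real.le_log_iff_exp_le hδ0]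
    have h1 : (n : ℝ) / c ≤ κ / 2 * n := by
      rw [div_eq_inv_mul, ← one_div]
      gcongr
    linarith
  refine ofReal_one_sub_le_of_measure_compl_le hδ0.le (le_trans (measure_mono ?_)
    ((hmain (M n) hn hr hrank hk1).trans (ENNReal.ofReal_le_ofReal hsmall)))
  refine Set.compl_subset_compl.2 fun X hX => ?_
  rw [hS, le_div_iff₀ hn', mul_comm] at hlam
  have h := hX lam hlam0 hlam
  rw [Set.mem_ofPred_eq, ← mul_pow, ← mul_pow, mul_comm ((M n).effRank k), hS]
  exact h
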